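/- **Setting.** Spacetime is $\mathbf R^n$, with bosonic fields $\phi^i$ ($1\le i\le m$), a Lagrangian $\mathcal L_0$ with Euler–Lagrange derivatives $\mathcal L_i$, gauge transformations $\delta_\varepsilon\phi^i=\sum_J R^{iJ}_\alpha\,\partial_J\varepsilon^\alpha$ and (possibly) first order reducibility operators $\varepsilon^\alpha=\sum_J Z^{\alpha J}_\Delta\,\partial_J\eta^\Delta$, all coefficients being local functions, i.e. smooth real functions of $x$, the fields and finitely many of their derivatives. The Noether identities $\sum_{i,J}(-1)^{|J|}\partial_J(R^{iJ}_\alpha\mathcal L_i)=0$ hold, and $R^i_\alpha Z^\alpha_\Delta=0$ holds up to terms $M^{ij}_\Delta$ proportional to the equations of motion. *Local forms.* Introduce generators $dx^\mu$, ghosts $C^\alpha$, ghosts of ghosts $C^\Delta$, antifields $\phi^*_i,C^*_\alpha,C^*_\Delta$ and all derivatives of these ($dx^\mu$ excepted), with antighost numbers $0,0,0,1,2,3$, pure ghost numbers $0,1,2,0,0,0$, and $C^\alpha,\phi^*_i,C^*_\Delta,dx^\mu$ anticommuting, $C^\Delta,C^*_\alpha$ commuting. A local $p$-form of antighost number $j$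 is an element of form degree $p$ and antighost number $j$ of the free graded commutative algebra on these generators over the local functions. A local $p$-form of ghost number $k$ is a formal series $a=\sum_{j\ge0}a_j$, possibly infinite, where $a_j$ is a local $p$-form of antighost number $j$ and pure ghost number $k+j$. All differentials act from the right, $\partial_\mu$ denotes the total derivative, and $da=\sum_\mu(\partial_\mu a)\,dx^\mu$. *Differentials.* The Koszul–Tate differential $\delta$ is the odd right derivation that commutes with the $\partial_\mu$, vanishes on local functions, ghosts and $dx^\mu$, and satisfies $$\delta\phi^*_i=-\mathcal L_i,\qquad \delta C^*_\alpha=\sum_{i,J}(-1)^{|J|}\partial_J(R^{iJ}_\alpha\phi^*_i),$$ $$\delta C^*_\Delta=-\sum_{\alpha,J}(-1)^{|J|}\partial_J(Z^{\alpha J}_\Delta C^*_\alpha)+\tfrac12\sum M^{iJ,jK}_\Delta\,\partial_J\phi^*_i\,\partial_K\phi^*_j .$$ A BRST differential is a sum $s=\delta+\gamma+s_1+s_2+\cdots$ of odd right derivations of ghost number $1$ and antighost numbers $-1,0,1,2,\dots$, commuting with the $\partial_\mu$ and vanishing on $x^\mu$ and $dx^\mu$, with $s^2=0$, $\gamma\phi^i=\sum_J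 R^{iJ}_\alpha\partial_JC^\alpha$ and $\gamma C^\alpha=\sum_J Z^{\alpha J}_\Delta\partial_JC^\Delta$ + (terms quadratic in the $C^\beta$ and their derivatives). *Regularity.* Arbitrarily large finite collections $E$ of derivatives $\partial_J\mathcal L_i$ of the equations of motion, $G$ of derivatives of the Noether identities and $H$ of derivatives of the reducibility identities exist such that the identities in $G$ involve only the equations in $E$, those in $H$ (with their $M$-terms) only members of $E$ and $G$, and, at each point of the surface defined in jet space by the equations $E$, there are splittings of $E$ into independent and dependent equations and of $G$ into independent and dependent identities for which: the independent equations have linearly independent differentials at the point (so they can be taken as part of a local coordinate system); the independent identities in $G$ (regarded as linear relations among independent variables $\partial_J\mathcal L_i$) can be solved uniquely for the dependent equations near the point; the identities $H$ can be solved uniquely for the dependent identities in $G$ near the point. *Cohomology groups* (for each form degree $p$). - $H^k(s|d)$: $p$-forms $a$ of ghost number $k$ with $sa+db=0$ for some $(p-1)$-form $b$ of ghost number $k+1$, modulo the $su+dv$ with $u$ of ghost number $k-1$, $v$ of ghost number $k$. - $H_j(\delta|d)$: $p$-forms $a$ of antighost number $j$ with $\delta a+db=0$ for some $(p-1)$-form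 $b$ of antighost number $j-1$, modulo the $\delta u+dv$ with $u$ of antighost number $j+1$, $v$ of antighost number $j$. - $H^k(\gamma|d,H_0(\delta))$: the cohomology of $\gamma$ modulo $d$ in $H_0(\delta)$, i.e. $p$-forms $a$ of antighost number $0$ and pure ghost number $k$ with $\gamma a+db+\delta c=0$ for some $b$ of antighost number $0$ and $c$ of antighost number $1$, modulo the $\gamma u+dv+\delta w$ with $u,v$ of antighost number $0$ and $w$ of antighost number $1$. **Theorem.** Under these regularity conditions, for every BRST differential $s$ and in each form degree $p$: (i) for $k<0$, $[a]\mapsto[a_{-k}]$ is a well-defined linear isomorphism $H^k(s|d)\simeq H_{-k}(\delta|d)$; (ii) for $k\ge0$, $[a]\mapsto[a_0]$ is a well-defined linear isomorphism $H^k(s|d)\simeq H^k(\gamma|d,H_0(\delta))$. (Here $a_{-k}$, respectively $a_0$, is the component of $a$ of lowest antighost number.) -/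

import Mathlib

open scoped ContDiff

noncomputable section

namespace LocalBRST

/-! ## Jet space and local functions -/

/-- Multi-indices `J` for the derivatives `∂_J = ∂_{μ₁} ⋯ ∂_{μ_k}` on `ℝⁿ`. -/
abbrev MIdx (n : ℕ) : Type := Fin n → ℕ

/-- The order `|J|` of a multi-index. -/
def MIdx.order {n : ℕ} (J : MIdx n) : ℕ := ∑ μ, J μ

/-- The multi-index `J + μ` (one more derivative in the direction `μ`). -/
def MIdx.shift {n : ℕ} (J : MIdx n) (μ : Fin n) : MIdx n := J + Pi.single μ 1

/-- Coordinates of the jet space: the `x^μ` and the `∂_J φ^i`. -/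
abbrev Coord (n m : ℕ) : Type := Fin n ⊕ (Fin m × MIdx n)

/-- The (infinite) jet space of `m` scalar components over `ℝⁿ`. -/
abbrev Jet (n m : ℕ) : Type := Coord n m → ℝ

/-- Local functions: smooth functions of finitely many of the jet coordinates, i.e. of `x`, the
fields and a finite number of their derivatives. -/
def IsLocal {n m : ℕ} (f : Jet n m → ℝ) : Prop :=
  ∃ (T : Finset (Coord n m)) (g : (T → ℝ) → ℝ), ContDiff ℝ ∞ g ∧ ∀ u, f u = g fun c => u c

section LocalFunctions

variable {n m : ℕ}

theorem isLocal_enlarge {T T' : Finset (Coord n m)} (h : T ⊆ T') {g : (T → ℝ) → ℝ}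
    (hg : ContDiff ℝ ∞ g) :
    ContDiff ℝ ∞ (fun v : T' → ℝ => g fun c => v ⟨c, h c.2⟩) :=
  hg.comp (contDiff_pi.2 fun c => contDiff_apply ℝ ℝ (⟨c, h c.2⟩ : T'))

theorem isLocal_const (r : ℝ) : IsLocal (fun _ : Jet n m => r) :=
  ⟨∅, fun _ => r, contDiff_const, fun _ => rfl⟩

theorem IsLocal.add {f g : Jet n m → ℝ} (hf : IsLocal f) (hg : IsLocal g) : IsLocal (f + g) := by
  obtain ⟨S, f', hf', hf⟩ := hf
  obtain ⟨T, g', hg', hg⟩ := hg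
  refine ⟨S ∪ T, _, (isLocal_enlarge Finset.subset_union_left hf').add
    (isLocal_enlarge Finset.subset_union_right hg'), fun u => ?_⟩
  simp [hf, hg]

theorem IsLocal.mul {f g : Jet n m → ℝ} (hf : IsLocal f) (hg : IsLocal g) : IsLocal (f * g) := by
  obtain ⟨S, f', hf', hf⟩ := hf
  obtain ⟨T, g', hg', hg⟩ := hg
  refine ⟨S ∪ T, _, (isLocal_enlarge Finset.subset_union_left hf').mul
    (isLocal_enlarge Finset.subset_union_right hg'), fun u => ?_⟩
  simp [hf, hg]

theorem isLocal_coord (c : Coord n m) : IsLocal (fun u : Jet n m => u c) :=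
  ⟨{c}, fun v => v ⟨c, Finset.mem_singleton_self c⟩, contDiff_apply ℝ ℝ _, fun _ => rfl⟩

end LocalFunctions

/-- The algebra of local functions of `x`, the fields and their derivatives. -/
def localFunctions (n m : ℕ) : Subalgebra ℝ (Jet n m → ℝ) where
  carrier := {f | IsLocal f}
  mul_mem' := IsLocal.mul
  add_mem' := IsLocal.add
  algebraMap_mem' := isLocal_const

/-- The type of local functions. -/
def LocFun (n m : ℕ) : Type := localFunctions n m

instance (n m : ℕ) : CommRing (LocFun n m) := inferInstanceAs (CommRing (localFunctions n m))

instance (n m : ℕ) : Algebra ℝ (LocFun n m) := inferInstanceAs (Algebra ℝ (localFunctions n m))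

/-- The value of a local function at a jet. -/
def LocFun.eval {n m : ℕ} (f : LocFun n m) (u : Jet n m) : ℝ := f.1 u

section Derivatives

variable {n m : ℕ}

/-- The coordinate functions `x^μ` and `∂_J φ^i`. -/
def coord (c : Coord n m) : LocFun n m := ⟨fun u => u c, isLocal_coord c⟩

/-- The partial derivative of a function on jet space with respect to a jet coordinate. -/
def pdFun (c : Coord n m) (f : Jet n m → ℝ) : Jet n m → ℝ :=
  fun u => deriv (fun t => f (Function.update u c t)) (u c)

theorem hasDerivAt_slice {f : Jet n m → ℝ} {T : Finset (Coord n m)} {g : (T → ℝ) → ℝ}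
    (hg : ContDiff ℝ ∞ g) (hf : ∀ u, f u = g fun c => u c) {c : Coord n m} (hc : c ∈ T)
    (u : Jet n m) :
    HasDerivAt (fun t => f (Function.update u c t))
      (fderiv ℝ g (fun a => u a) (Pi.single ⟨c, hc⟩ 1)) (u c) := by
  have e : (fun t => f (Function.update u c t)) =
      g ∘ Function.update (fun a : T => u a) ⟨c, hc⟩ := by
    funext t
    rw [hf, Function.comp_apply]
    congr 1
    funext a
    by_cases h : a = ⟨c, hc⟩
    · subst h; simp
    · have h' : (a : Coord n m) ≠ c := fun e => h (Subtype.ext e)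
      simp [Function.update_of_ne h, Function.update_of_ne h']
  rw [e]
  have h0 : Function.update (fun a : T => u a) ⟨c, hc⟩ (u c) = fun a : T => u a :=
    Function.update_eq_self (⟨c, hc⟩ : T) (fun a : T => u a)
  have h1 : HasFDerivAt g (fderiv ℝ g (fun a => u a))
      (Function.update (fun a : T => u a) ⟨c, hc⟩ (u c)) := by
    rw [h0]
    exact (hg.differentiable (by simp)).differentiableAt.hasFDerivAt
  exact h1.comp_hasDerivAt (u c) (hasDerivAt_update (fun a : T => u a) ⟨c, hc⟩ (u c))

theorem slice_const {f : Jet n m → ℝ} {T : Finset (Coord n m)} {g : (T → ℝ) → ℝ}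
    (hf : ∀ u, f u = g fun c => u c) {c : Coord n m} (hc : c ∉ T) (u : Jet n m) (t : ℝ) :
    f (Function.update u c t) = f u := by
  rw [hf, hf]
  congr 1
  funext a
  have h : (a : Coord n m) ≠ c := fun e => hc (e ▸ a.2)
  simp [Function.update_of_ne h]

theorem differentiableAt_slice {f : Jet n m → ℝ} (hf : IsLocal f) (c : Coord n m) (u : Jet n m) :
    DifferentiableAt ℝ (fun t => f (Function.update u c t)) (u c) := by
  obtain ⟨T, g, hg, hfg⟩ := hf
  by_cases hc : c ∈ T
  · exact (hasDerivAt_slice hg hfg hc u).differentiableAt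
  · simp only [slice_const hfg hc]
    exact differentiableAt_const _

theorem IsLocal.pdFun {f : Jet n m → ℝ} (hf : IsLocal f) (c : Coord n m) :
    IsLocal (pdFun c f) := by
  obtain ⟨T, g, hg, hfg⟩ := hf
  by_cases hc : c ∈ T
  · refine ⟨T, fun v => fderiv ℝ g v (Pi.single ⟨c, hc⟩ 1), ?_, fun u =>
      (hasDerivAt_slice hg hfg hc u).deriv⟩
    exact (hg.fderiv_right (m := ∞) (by simp)).clm_apply contDiff_const
  · have : LocalBRST.pdFun c f = fun _ => 0 := by
      funext u
      simp [LocalBRST.pdFun, slice_const hfg hc]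
    rw [this]
    exact isLocal_const 0

/-- The partial derivative `∂f/∂c` of local functions with respect to a jet coordinate `c`. -/
def pd (c : Coord n m) : LocFun n m →ₗ[ℝ] LocFun n m where
  toFun f := ⟨pdFun c f.1, IsLocal.pdFun f.2 c⟩
  map_add' f g := Subtype.ext <| funext fun u =>
    deriv_add (differentiableAt_slice f.2 c u) (differentiableAt_slice g.2 c u)
  map_smul' r f := Subtype.ext <| funext fun u =>
    deriv_const_mul r (differentiableAt_slice f.2 c u)

theorem finite_pd (f : LocFun n m) : {c : Coord n m | pd c f ≠ 0}.Finite := by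
  obtain ⟨T, g, hg, hfg⟩ := f.2
  refine T.finite_toSet.subset fun c hc => ?_
  by_contra h
  refine hc (Subtype.ext (funext fun u => ?_))
  have h' : c ∉ T := h
  change deriv (fun t => f.1 (Function.update u c t)) (u c) = 0
  simp only [slice_const hfg h']
  exact deriv_const _ _

theorem finite_support_pd (f : LocFun n m) (w : Fin m × MIdx n → LocFun n m) :
    (Function.support fun c : Fin m × MIdx n => w c * pd (Sum.inr c) f).Finite := by
  refine ((finite_pd f).preimage Sum.inr_injective.injOn).subset fun c hc => ?_
  intro h
  exact hc (by simp [h])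

/-- The total derivative of local functions,
`∂_μ f = ∂f/∂x^μ + ∑_{i,J} (∂_{J+μ} φ^i) ∂f/∂(∂_J φ^i)`; the sum is finite. -/
def totalD (μ : Fin n) : LocFun n m →ₗ[ℝ] LocFun n m where
  toFun f := pd (Sum.inl μ) f +
    ∑ᶠ c : Fin m × MIdx n, coord (Sum.inr (c.1, c.2.shift μ)) * pd (Sum.inr c) f
  map_add' f g := by
    rw [map_add, add_add_add_comm, ← finsum_add_distrib (finite_support_pd f _)
      (finite_support_pd g _)]
    simp only [map_add, mul_add]
  map_smul' r f := by
    rw [RingHom.id_apply, smul_add, smul_finsum, map_smul]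
    simp only [map_smul, mul_smul_comm]

/-- The iterated total derivative `∂_J` of local functions. -/
def totalDs (J : MIdx n) : Module.End ℝ (LocFun n m) :=
  (List.ofFn fun μ => (totalD μ : Module.End ℝ (LocFun n m)) ^ J μ).prod

end Derivatives

/-! ## The algebra of local forms with ghosts and antifields -/

/-- The anticommuting generators: `dx^μ`, and the derivatives of the ghosts `C^α`, of the antifields
`φ*_i` and of the antifields `C*_Δ` of the ghosts of ghosts. -/
inductive OddGen (n m q r : ℕ) : Type
  | dx (μ : Fin n)
  | ghost (α : Fin q) (J : MIdx n)
  | antifield (i : Fin m) (J : MIdx n)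
  | antighost2 (Δ : Fin r) (J : MIdx n)

/-- The commuting generators: the derivatives of the ghosts of ghosts `C^Δ` and of the antifields
`C*_α` of the ghosts. (The fields themselves enter through the local functions.) -/
inductive EvenGen (n q r : ℕ) : Type
  | ghost2 (Δ : Fin r) (J : MIdx n)
  | antighost (α : Fin q) (J : MIdx n)

/-- Some total order on the anticommuting generators, used to fix the order of the factors of a
monomial. -/
instance (n m q r : ℕ) : LinearOrder (OddGen n m q r) :=
  @linearOrderOfSTO _ WellOrderingRel _ (Classical.decRel _)

/-- A monomial: the product, in increasing order, of a finite set of distinct anticommuting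
generators, times a product of powers of commuting generators. -/
@[ext]
structure Mono (n m q r : ℕ) : Type where
  odd : Finset (OddGen n m q r)
  even : EvenGen n q r →₀ ℕ

/-- Local forms: the free graded commutative algebra over the local functions on the
generators above, as the free module on the monomials. -/
abbrev Form (n m q r : ℕ) : Type := Mono n m q r →₀ LocFun n m

instance (n m q r : ℕ) : AddCommGroup (Form n m q r) := inferInstance

section Algebra

variable {n m q r : ℕ}

/-- The number of transpositions needed to order the concatenation of the ordered products of `S`
and `T`. -/
def inversions (S T : Finset (OddGen n m q r)) : ℕ := ((S ×ˢ T).filter fun x => x.2 < x.1).card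

/-- The graded commutative product of two monomials. -/
def monoMul (M N : Mono n m q r) : Form n m q r :=
  if Disjoint M.odd N.odd then
    Finsupp.single ⟨M.odd ∪ N.odd, M.even + N.even⟩ ((-1) ^ inversions M.odd N.odd)
  else 0

/-- The graded commutative product of local forms, bilinear over the local functions. -/
def wedgeHom : Form n m q r →ₗ[LocFun n m] Form n m q r →ₗ[LocFun n m] Form n m q r :=
  Finsupp.linearCombination (LocFun n m) fun M =>
    Finsupp.linearCombination (LocFun n m) fun N => monoMul M N

/-- The product `a b` of local forms. -/
def wedge (a b : Form n m q r) : Form n m q r :=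
  (wedgeHom : Form n m q r →ₗ[LocFun n m] Form n m q r →ₗ[LocFun n m] Form n m q r) a b

/-- A local function as a local form. -/
def ofFun (f : LocFun n m) : Form n m q r := Finsupp.single ⟨∅, 0⟩ f

/-- An anticommuting generator as a monomial. -/
def oddMono (g : OddGen n m q r) : Mono n m q r := ⟨{g}, 0⟩

/-- A commuting generator as a monomial. -/
def evenMono (g : EvenGen n q r) : Mono n m q r := ⟨∅, Finsupp.single g 1⟩

/-- An anticommuting generator as a local form. -/
def oddGen (g : OddGen n m q r) : Form n m q r := Finsupp.single (oddMono g) 1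

/-- A commuting generator as a local form. -/
def evenGen (g : EvenGen n q r) : Form n m q r := Finsupp.single (evenMono g) 1

/-- The operator `X = ∑_g (∂^R a/∂g) X(g)` with prescribed values on the generators, linear over the
local functions. It is the right derivation with these values when these all have the same
parity relative to the generators. -/
def rightDer (vo : OddGen n m q r → Form n m q r) (ve : EvenGen n q r → Form n m q r) :
    Form n m q r →ₗ[LocFun n m] Form n m q r :=
  Finsupp.linearCombination (LocFun n m) fun M =>
    (∑ g ∈ M.odd, (-1 : ℤ) ^ (M.odd.filter fun h => g < h).card •
      wedge (Finsupp.single ⟨M.odd.erase g, M.even⟩ 1) (vo g)) +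
    ∑ g ∈ M.even.support, M.even g •
      wedge (Finsupp.single ⟨M.odd, M.even - Finsupp.single g 1⟩ 1) (ve g)

/-- `∂_μ` on anticommuting generators. -/
def shiftOdd (μ : Fin n) : OddGen n m q r → Form n m q r
  | .dx _ => 0
  | .ghost α J => oddGen (.ghost α (J.shift μ))
  | .antifield i J => oddGen (.antifield i (J.shift μ))
  | .antighost2 Δ J => oddGen (.antighost2 Δ (J.shift μ))

/-- `∂_μ` on commuting generators. -/
def shiftEven (μ : Fin n) : EvenGen n q r → Form n m q r
  | .ghost2 Δ J => evenGen (.ghost2 Δ (J.shift μ))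
  | .antighost α J => evenGen (.antighost α (J.shift μ))

/-- The total derivative `∂_μ` on local forms. -/
def formD (μ : Fin n) : Form n m q r →ₗ[ℝ] Form n m q r :=
  Finsupp.mapRange.linearMap (totalD μ) +
    (rightDer (shiftOdd μ) (shiftEven μ) : Form n m q r →ₗ[LocFun n m] Form n m q r).restrictScalars ℝ

/-- The iterated total derivative `∂_J` on local forms. -/
def formDs (J : MIdx n) : Module.End ℝ (Form n m q r) :=
  (List.ofFn fun μ => (formD μ : Module.End ℝ (Form n m q r)) ^ J μ).prod

/-- Multiplication from the right by `b`. -/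
def rightMul (b : Form n m q r) : Form n m q r →ₗ[LocFun n m] Form n m q r :=
  LinearMap.flip wedgeHom b

/-- The spacetime exterior derivative, acting from the right: `d a = ∑_μ (∂_μ a) dx^μ`. -/
def extD : Form n m q r →ₗ[ℝ] Form n m q r :=
  ∑ μ : Fin n, (rightMul (oddGen (.dx μ) : Form n m q r)).restrictScalars ℝ ∘ₗ (formD μ : Form n m q r →ₗ[ℝ] Form n m q r)

/-! ### Gradings -/

/-- Antighost number of the anticommuting generators. -/
def OddGen.antigh : OddGen n m q r → ℤ
  | .dx _ => 0
  | .ghost _ _ => 0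
  | .antifield _ _ => 1
  | .antighost2 _ _ => 3

/-- Antighost number of the commuting generators. -/
def EvenGen.antigh : EvenGen n q r → ℤ
  | .ghost2 _ _ => 0
  | .antighost _ _ => 2

/-- Pure ghost number of the anticommuting generators. -/
def OddGen.puregh : OddGen n m q r → ℤ
  | .dx _ => 0
  | .ghost _ _ => 1
  | .antifield _ _ => 0
  | .antighost2 _ _ => 0

/-- Pure ghost number of the commuting generators. -/
def EvenGen.puregh : EvenGen n q r → ℤ
  | .ghost2 _ _ => 2
  | .antighost _ _ => 0

/-- Form degree of the anticommuting generators. -/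
def OddGen.formDeg : OddGen n m q r → ℤ
  | .dx _ => 1
  | _ => 0

/-- Antighost number of a monomial. -/
def Mono.antigh (M : Mono n m q r) : ℤ :=
  ∑ g ∈ M.odd, g.antigh + M.even.sum fun g e => e * g.antigh

/-- Pure ghost number of a monomial. -/
def Mono.puregh (M : Mono n m q r) : ℤ :=
  ∑ g ∈ M.odd, g.puregh + M.even.sum fun g e => e * g.puregh

/-- Form degree of a monomial. -/
def Mono.formDeg (M : Mono n m q r) : ℤ := ∑ g ∈ M.odd, g.formDeg

end Algebra

/-- Local `p`-forms of antighost number `j`. -/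
def antighPiece (n m q r : ℕ) (j p : ℤ) : Submodule ℝ (Form n m q r) :=
  Finsupp.supported (LocFun n m) ℝ {M | M.antigh = j ∧ M.formDeg = p}

/-- Local `p`-forms of antighost number `j` and pure ghost number `g`. -/
def piece (n m q r : ℕ) (j g p : ℤ) : Submodule ℝ (Form n m q r) :=
  Finsupp.supported (LocFun n m) ℝ {M | M.antigh = j ∧ M.puregh = g ∧ M.formDeg = p}

/-- Local `p`-forms of (total) ghost number `k`, as formal series `∑_{j ≥ 0} a_j` of
local forms `a_j` of antighost number `j`. -/
def Series (n m q r : ℕ) (k p : ℤ) : Submodule ℝ (ℕ → Form n m q r) :=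
  Submodule.pi Set.univ fun j : ℕ => piece n m q r j (j + k) p

/-- `d` on formal series. -/
def extDSeries (n m q r : ℕ) : (ℕ → Form n m q r) →ₗ[ℝ] (ℕ → Form n m q r) :=
  LinearMap.pi fun j => extD ∘ₗ LinearMap.proj j

/-! ## Cohomology of one operator modulo another one -/

section Relative

variable {V : Type*} [AddCommGroup V] [Module ℝ V]

/-- `D`-cocycles modulo `d`: the `a ∈ X` with `D a + d b = 0` for some `b ∈ Y`. -/
def relCocycles (D d : V →ₗ[ℝ] V) (X Y : Submodule ℝ V) : Submodule ℝ V where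
  carrier := {a | a ∈ X ∧ ∃ b ∈ Y, D a + d b = 0}
  zero_mem' := ⟨X.zero_mem, 0, Y.zero_mem, by simp⟩
  add_mem' := by
    rintro a a' ⟨ha, b, hb, h⟩ ⟨ha', b', hb', h'⟩
    refine ⟨X.add_mem ha ha', b + b', Y.add_mem hb hb', ?_⟩
    rw [map_add, map_add, add_add_add_comm, h, h', add_zero]
  smul_mem' := by
    rintro t a ⟨ha, b, hb, h⟩
    refine ⟨X.smul_mem t ha, t • b, Y.smul_mem t hb, ?_⟩
    rw [map_smul, map_smul, ← smul_add, h, smul_zero]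

/-- `D`-coboundaries modulo `d`: the `D u + d v` with `u ∈ X'` and `v ∈ Y'`. -/
def relCoboundaries (D d : V →ₗ[ℝ] V) (X' Y' : Submodule ℝ V) : Submodule ℝ V :=
  X'.map D ⊔ Y'.map d

end Relative

/-! ## Gauge theories -/

/-- The data of a gauge theory with `m` bosonic fields, `q` gauge generators and `r` reducibility
functions on `ℝⁿ`.
* `L` is the Lagrangian;
* `R i α` are the coefficients of the gauge transformations
  `δ_ε φ^i = ∑_{α,J} R^{iJ}_α ∂_J ε^α`;
* `Z α Δ` are the coefficients of the reducibility operators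
  `ε^α = ∑_{Δ,J} Z^{αJ}_Δ ∂_J η^Δ`;
* `M Δ` are the coefficients of the terms quadratic in the antifields `φ*_i` in the Koszul-Tate
  differential of `C*_Δ` (zero if the reducibility identities hold off-shell). -/
structure GaugeTheory (n m q r : ℕ) : Type where
  L : LocFun n m
  R : Fin m → Fin q → MIdx n →₀ LocFun n m
  Z : Fin q → Fin r → MIdx n →₀ LocFun n m
  M : Fin r → (Fin m × MIdx n) × (Fin m × MIdx n) →₀ LocFun n m

namespace GaugeTheory

variable {n m q r : ℕ} (T : GaugeTheory n m q r)

/-- The Euler-Lagrange derivatives `𝓛_i = ∑_J (-1)^{|J|} ∂_J (∂L/∂(∂_J φ^i))`. -/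
def EL (i : Fin m) : LocFun n m :=
  ∑ᶠ J : MIdx n, (-1 : ℤ) ^ J.order • totalDs J (pd (Sum.inr (i, J)) T.L)

/-- `δ C*_α = ∑_{i,J} (-1)^{|J|} ∂_J (R^{iJ}_α φ*_i)`. -/
def deltaAntighost (α : Fin q) : Form n m q r :=
  ∑ i, (T.R i α).sum fun J f =>
    (-1 : ℤ) ^ J.order • formDs J (f • (oddGen (.antifield i 0) : Form n m q r))

/-- `δ C*_Δ = - ∑_{α,J} (-1)^{|J|} ∂_J (Z^{αJ}_Δ C*_α)
  + 1/2 ∑ M^{iJ,jK}_Δ (∂_J φ*_i) (∂_K φ*_j)`. -/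
def deltaAntighost2 (Δ : Fin r) : Form n m q r :=
  -(∑ α, (T.Z α Δ).sum fun J f =>
    (-1 : ℤ) ^ J.order • formDs J (f • (evenGen (.antighost α 0) : Form n m q r))) +
  (1 / 2 : ℝ) • (T.M Δ).sum fun c f =>
    f • (wedge (oddGen (.antifield c.1.1 c.1.2)) (oddGen (.antifield c.2.1 c.2.2)) : Form n m q r)

/-- The Koszul-Tate differential on the anticommuting generators. -/
def deltaOdd : OddGen n m q r → Form n m q r
  | .dx _ => 0
  | .ghost _ _ => 0
  | .antifield i J => -formDs J (ofFun (T.EL i))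
  | .antighost2 Δ J => formDs J (T.deltaAntighost2 Δ)

/-- The Koszul-Tate differential on the commuting generators. -/
def deltaEven : EvenGen n q r → Form n m q r
  | .ghost2 _ _ => 0
  | .antighost α J => formDs J (T.deltaAntighost α)

/-- The Koszul-Tate differential `δ`; it annihilates the local functions, the ghosts and `dx`. -/
def delta : Form n m q r →ₗ[LocFun n m] Form n m q r := rightDer T.deltaOdd T.deltaEven

/-- `δ` as a real linear map. -/
def deltaR : Form n m q r →ₗ[ℝ] Form n m q r := T.delta.restrictScalars ℝ

/-- The identities that `R` and `Z` have to satisfy: the Lagrangian is gauge invariant (Noether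
identities), and the gauge transformations `R Z η` vanish on-shell, `R^i_α Z^α_Δ` being
expressed by `M^{ij}_Δ` and the equations of motion. The second identity, contracted with
`φ*_i`, reads `δ (δ C*_Δ) = 0`. -/
structure Identities : Prop where
  noether : ∀ α, ∑ i, (T.R i α).sum (fun J f =>
    (-1 : ℤ) ^ J.order • totalDs J (f * T.EL i)) = 0
  reducibility : ∀ Δ, T.delta (T.deltaAntighost2 Δ) = 0

/-- The derivatives `∂_J 𝓛_i` of the equations of motion. -/
def eqJet (e : Fin m × MIdx n) : LocFun n m := totalDs e.2 (T.EL e.1)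

/-- The Noether identity `∂_K R_α`, with the `∂_J 𝓛_i` regarded as independent variables `l_{iJ}`, is
the linear form `∑ noetherCoeff (α,K) (i,J) l_{iJ}`. -/
def noetherCoeff (a : Fin q × MIdx n) (e : Fin m × MIdx n) : LocFun n m :=
  T.deltaEven (.antighost a.1 a.2) (oddMono (.antifield e.1 e.2))

/-- The coefficients, up to sign, of the reducibility identity `∂_K Z_Δ` as a linear form in
independent variables for the derivatives `∂_J R_α` of the Noether identities. -/
def reducibilityCoeff (b : Fin r × MIdx n) (a : Fin q × MIdx n) : LocFun n m :=
  T.deltaOdd (.antighost2 b.1 b.2) (evenMono (.antighost a.1 a.2))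

/-- A finite collection `E` of derivatives of equations of motion, `G` of derivatives of Noether
identities and `H` of derivatives of reducibility identities is closed if the identities in `G`
involve the equations in `E` only, and those in `H` the members of `E` and `G` only. -/
structure Closed (E : Finset (Fin m × MIdx n)) (G : Finset (Fin q × MIdx n))
    (H : Finset (Fin r × MIdx n)) : Prop where
  noether : ∀ a ∈ G, ∀ e ∉ E, T.noetherCoeff a e = 0
  reducibility : ∀ b ∈ H, ∀ a ∉ G, T.reducibilityCoeff b a = 0
  quadratic : ∀ b ∈ H, ∀ M, T.deltaOdd (.antighost2 b.1 b.2) M ≠ 0 →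
    ∀ i J, OddGen.antifield i J ∈ M.odd → (i, J) ∈ E

/-- The splitting at the jet `u` of the equations `E` into independent ones `E₁` and dependent ones
`E \ E₁`, and of the Noether identities `G` into independent ones `G₁` and dependent ones `G \ G₁`:
* the functions `E₁` have independent differentials at `u`, hence are part of a local
  coordinate system around `u` in the jet space;
* the identities `G₁` can be solved for the equations `E \ E₁`, around `u` (so that they are
  independent, and the equations `E \ E₁` hold as a consequence of the equations `E₁`);
* the identities `H` can be solved for the identities `G \ G₁`, around `u` (so that there are no
  relations among the `H`, and the identities `G \ G₁` hold as a consequence of the `G₁`). -/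
def SplitsAt (E : Finset (Fin m × MIdx n)) (G : Finset (Fin q × MIdx n))
    (H : Finset (Fin r × MIdx n)) (u : Jet n m) : Prop :=
  ∃ E₁ ⊆ E, ∃ G₁ ⊆ G,
    LinearIndependent ℝ (fun (e : E₁) (c : Coord n m) => (pd c (T.eqJet e)).eval u) ∧
    Function.Bijective (fun (v : (E \ E₁ : Finset _) → ℝ) (a : G₁) =>
      ∑ e : (E \ E₁ : Finset _), (T.noetherCoeff a e).eval u * v e) ∧
    Function.Bijective (fun (v : (G \ G₁ : Finset _) → ℝ) (b : H) =>
      ∑ a : (G \ G₁ : Finset _), (T.reducibilityCoeff b a).eval u * v a)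

/-- The regularity conditions: there are arbitrarily large closed finite collections of derivatives
of equations of motion, Noether identities and reducibility identities that split around each
point of the surface defined in jet space by the equations of the collection. -/
def Regular : Prop :=
  ∀ (E₀ : Finset (Fin m × MIdx n)) (G₀ : Finset (Fin q × MIdx n)) (H₀ : Finset (Fin r × MIdx n)),
    ∃ E G H, E₀ ⊆ E ∧ G₀ ⊆ G ∧ H₀ ⊆ H ∧ T.Closed E G H ∧
      ∀ u : Jet n m, (∀ e ∈ E, (T.eqJet e).eval u = 0) → T.SplitsAt E G H u

/-- The BRST differential `s = δ + γ + s₁ + ⋯`: its component of antighost number `k - 1` is `comp k`,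
so that `comp 0 = δ` and `comp 1 = γ`. Each component is an odd right derivation that
commutes with `∂_μ` and annihilates `x^μ` and `dx^μ`; `s` has ghost number one and squares to
zero; and `γ φ^i = R^i_α C^α`, `γ C^α = Z^α_Δ C^Δ + 1/2 C^α_{βγ} C^β C^γ` in condensed notation. -/
structure BRSTDifferential where
  comp : ℕ → Form n m q r →ₗ[ℝ] Form n m q r
  leibniz : ∀ k a M f, comp k (wedge a (Finsupp.single M f)) =
    wedge a (comp k (Finsupp.single M f)) +
      (-1 : ℤ) ^ M.odd.card • wedge (comp k a) (Finsupp.single M f)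
  chain : ∀ k f, comp k (ofFun f) =
    ∑ᶠ c : Fin m × MIdx n, pd (Sum.inr c) f • comp k (ofFun (coord (Sum.inr c)))
  comp_dx : ∀ k μ, comp k (oddGen (.dx μ)) = 0
  comm : ∀ k μ a, comp k (formD μ a) = formD μ (comp k a)
  degree : ∀ (k : ℕ) (j g p : ℤ), ∀ a ∈ piece n m q r j g p,
    comp k a ∈ piece n m q r (j + k - 1) (g + k) p
  comp_zero : comp 0 = T.deltaR
  gamma_field : ∀ i, comp 1 (ofFun (coord (Sum.inr (i, 0)))) =
    ∑ α, (T.R i α).sum fun J f => f • (oddGen (.ghost α J) : Form n m q r)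
  gamma_ghost : ∀ α, ∃ c : (Fin q × MIdx n) × (Fin q × MIdx n) →₀ LocFun n m,
    comp 1 (oddGen (.ghost α 0)) =
      (∑ Δ, (T.Z α Δ).sum fun J f => f • (evenGen (.ghost2 Δ J) : Form n m q r)) +
      (1 / 2 : ℝ) • c.sum fun b f =>
        f • (wedge (oddGen (.ghost b.1.1 b.1.2)) (oddGen (.ghost b.2.1 b.2.2)) : Form n m q r)
  nilpotent : ∀ N a, ∑ x ∈ Finset.HasAntidiagonal.antidiagonal N, comp x.1 (comp x.2 a) = 0

/-- The cocycles of `H_j(δ|d)` in form degree `p`. -/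
def deltaCocycles (j p : ℤ) : Submodule ℝ (Form n m q r) :=
  relCocycles T.deltaR extD (antighPiece n m q r j p) (antighPiece n m q r (j - 1) (p - 1))

/-- The coboundaries of `H_j(δ|d)` in form degree `p`. -/
def deltaCoboundaries (j p : ℤ) : Submodule ℝ (Form n m q r) :=
  relCoboundaries T.deltaR extD (antighPiece n m q r (j + 1) p) (antighPiece n m q r j (p - 1))

/-- `H_j(δ|d)` in form degree `p`, where `j` is the antighost number. -/
abbrev HDelta (j p : ℤ) : Type :=
  T.deltaCocycles j p ⧸ (T.deltaCoboundaries j p).submoduleOf (T.deltaCocycles j p)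

namespace BRSTDifferential

variable {T} (s : T.BRSTDifferential)

/-- `s` on formal series. -/
def total : (ℕ → Form n m q r) →ₗ[ℝ] (ℕ → Form n m q r) :=
  LinearMap.pi fun j => ∑ x ∈ Finset.HasAntidiagonal.antidiagonal (j + 1), s.comp x.1 ∘ₗ LinearMap.proj x.2

/-- The cocycles of `H^k(s|d)` in form degree `p`. -/
def cocycles (k p : ℤ) : Submodule ℝ (ℕ → Form n m q r) :=
  relCocycles s.total (extDSeries n m q r) (Series n m q r k p) (Series n m q r (k + 1) (p - 1))

/-- The coboundaries of `H^k(s|d)` in form degree `p`. -/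
def coboundaries (k p : ℤ) : Submodule ℝ (ℕ → Form n m q r) :=
  relCoboundaries s.total (extDSeries n m q r) (Series n m q r (k - 1) p)
    (Series n m q r k (p - 1))

/-- `H^k(s|d)` in form degree `p`, where `k` is the ghost number. -/
abbrev H (k p : ℤ) : Type :=
  s.cocycles k p ⧸ (s.coboundaries k p).submoduleOf (s.cocycles k p)

/-- The differential `γ`. -/
def gamma : Form n m q r →ₗ[ℝ] Form n m q r := s.comp 1

/-- The representatives of the cocycles of `H^k(γ|d, H_0(δ))` in form degree `p`: the `a` of antighost
number zero and pure ghost number `k` such that the class of `γ a + d b` in `H_0(δ)` is zero,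
i.e. `γ a + d b + δ c = 0`, for some `b` and `c`. -/
def gammaCocycles (k p : ℤ) : Submodule ℝ (Form n m q r) where
  carrier := {a | a ∈ piece n m q r 0 k p ∧ ∃ b ∈ piece n m q r 0 (k + 1) (p - 1),
    ∃ c ∈ piece n m q r 1 (k + 1) p, s.gamma a + extD b + T.deltaR c = 0}
  zero_mem' := ⟨zero_mem _, 0, zero_mem _, 0, zero_mem _, by simp⟩
  add_mem' := by
    rintro a a' ⟨ha, b, hb, c, hc, h⟩ ⟨ha', b', hb', c', hc', h'⟩
    refine ⟨add_mem ha ha', b + b', add_mem hb hb', c + c', add_mem hc hc', ?_⟩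
    rw [map_add, map_add, map_add]
    calc _ = (s.gamma a + extD b + T.deltaR c) + (s.gamma a' + extD b' + T.deltaR c') := by abel
      _ = 0 := by rw [h, h', add_zero]
  smul_mem' := by
    rintro t a ⟨ha, b, hb, c, hc, h⟩
    refine ⟨Submodule.smul_mem _ t ha, t • b, Submodule.smul_mem _ t hb, t • c,
      Submodule.smul_mem _ t hc, ?_⟩
    rw [map_smul, map_smul, map_smul, ← smul_add, ← smul_add, h, smul_zero]

/-- The representatives of the coboundaries of `H^k(γ|d, H_0(δ))` in form degree `p`: the
`γ u + d v + δ w`. -/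
def gammaCoboundaries (k p : ℤ) : Submodule ℝ (Form n m q r) :=
  (piece n m q r 0 (k - 1) p).map s.gamma ⊔ (piece n m q r 0 k (p - 1)).map extD ⊔
    (piece n m q r 1 k p).map T.deltaR

/-- `H^k(γ|d, H_0(δ))` in form degree `p`: the cohomology of `γ` modulo `d` in `H_0(δ)`, the local
forms of antighost number zero modulo the `δ`-exact ones. -/
abbrev HGamma (k p : ℤ) : Type :=
  s.gammaCocycles k p ⧸ (s.gammaCoboundaries k p).submoduleOf (s.gammaCocycles k p)

end BRSTDifferential

end GaugeTheory

end LocalBRST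

end

/-!
# The cohomology of the BRST differential modulo `d`

Assigning to a cocycle of `s` modulo `d` its component of lowest antighost number is an isomorphism
in cohomology because the equations for the higher components can always be solved. Suppose that the
components of `e = c + s u + d v` of antighost number below `N` vanish, where `s c` is `d`-exact. From
`s² = 0` and `s d + d s = 0` it follows that `e_N` is a cocycle of `δ` modulo `d`, of antighost number
`N` and, when `e` has ghost number `k + 1`, of pure ghost number `N + k + 1`. If both are positive,
then `e_N = δ x + d y`, and subtracting `x` from `u_{N+1}` and `y` from `v_N` removes `e_N`. Iteration
gives formal series `u`, `v` with `e = 0` (`exists_correction`). With `c = 0` this extends truncated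
cocycles to cocycles; with `c` a cocycle it shows that those with trivial lowest component are
coboundaries.

The input is thus that the cohomology of `δ` modulo `d` vanishes in positive antighost number and
positive pure ghost number (`GaugeTheory.BRSTDifferential.exists_relative_primitive`), which has two
ingredients.

*The Koszul-Tate differential `δ` is acyclic in positive antighost number* (`exists_primitive`).
Finitely many generators occur in a form, so that `δ b = a` is a finite linear system over the local
functions. Its solutions at a point form an affine space, so by a partition of unity it suffices to
solve it near each point `u` of the jet space (`exists_solution_of_local`); a neighbourhood of `u` is
encoded by a local function `χ` with `χ(u) ≠ 0`, and the equation to be solved is `δ b = χ a`.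
If an equation of motion does not vanish at `u`, it gives a contracting homotopy. Otherwise the
regularity conditions provide a splitting at `u`. The antifields `φ*_i` of dependent equations pair
with the `C*_α` of independent identities, and the `C*_α` of dependent identities with the `C*_Δ`; a
derivation `σ` that inverts `δ` on these pairs up to terms of lower weight removes them
(`exists_homologous_weight_zero`, `exists_homologous_independent`). What is left is the Koszul complex
of functions `f_i` with independent differentials. By Hadamard's lemma, each of these is not a zero
divisor modulo the others near `u` (`LocFun.exists_mul_mem_ideal`), whence the complex is acyclic
(`exists_koszul`).

*The passage to the cohomology modulo `d`.* Let `a` be a cocycle of `δ` modulo `d` of positive pure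
ghost number. For a ghost or ghost of ghost `C`, replace each factor `∂_J C` of `a` in turn by a
monomial `t^J`. On the resulting polynomials in `t_μ`, whose coefficients are local forms, `d` becomes
`∑_μ (t_μ + ∂_μ) dx^μ`. With the homotopy `∑_μ (∂/∂t_μ) ι_μ`, where `ι_μ` contracts `dx^μ`, the
anticommutator is, up to terms of lower degree in `t`, multiplication by `N + n - p` in polynomial
degree `N` and form degree `p`. This number vanishes for `N = 0`, `p = n` only; there the Euler
operator, which annihilates the image of `d`, shows that `δ` annihilates the polynomial. An induction
on the degree together with the acyclicity of `δ` then makes the marked cocycle trivial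
(`VariationalData.exists_relative_primitive`). Replacing the `t^J` by the `∂_J C` again and summing
over the `C`, each weighted with its pure ghost number, one recovers `a`, multiplied by its pure ghost
number (`sum_unmark_mark`).
-/

open scoped ContDiff

noncomputable section

namespace LocalBRST

/-! ### The graded commutative algebra of local forms -/

section GradedAlgebra

variable {n m q r : ℕ}

theorem wedge_add_left (a b c : Form n m q r) : wedge (a + b) c = wedge a c + wedge b c := by
  simp [wedge]

theorem wedge_add_right (a b c : Form n m q r) : wedge a (b + c) = wedge a b + wedge a c := by
  simp [wedge]

@[simp]
theorem wedge_zero_left (c : Form n m q r) : wedge 0 c = 0 := by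
  simp [wedge]

@[simp]
theorem wedge_zero_right (c : Form n m q r) : wedge c 0 = 0 := by
  simp [wedge]

theorem wedge_neg_left (a c : Form n m q r) : wedge (-a) c = -wedge a c := by
  simp [wedge]

theorem wedge_neg_right (a c : Form n m q r) : wedge a (-c) = -wedge a c := by
  simp [wedge]

theorem wedge_smul_left (f : LocFun n m) (a c : Form n m q r) :
    wedge (f • a) c = f • wedge a c := by
  simp [wedge]

theorem wedge_smul_right (f : LocFun n m) (a c : Form n m q r) :
    wedge a (f • c) = f • wedge a c := by
  simp [wedge]

theorem wedge_zsmul_left (z : ℤ) (a c : Form n m q r) : wedge (z • a) c = z • wedge a c := by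
  simp [wedge]

theorem wedge_zsmul_right (z : ℤ) (a c : Form n m q r) : wedge a (z • c) = z • wedge a c := by
  simp [wedge]

theorem wedge_nsmul_left (z : ℕ) (a c : Form n m q r) : wedge (z • a) c = z • wedge a c := by
  simp [wedge]

theorem wedge_sum_left {ι : Type*} (s : Finset ι) (a : ι → Form n m q r) (c : Form n m q r) :
    wedge (∑ i ∈ s, a i) c = ∑ i ∈ s, wedge (a i) c := by
  simp [wedge]

theorem wedge_single (M N : Mono n m q r) (f g : LocFun n m) :
    wedge (Finsupp.single M f) (Finsupp.single N g) =
      if Disjoint M.odd N.odd then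
        Finsupp.single ⟨M.odd ∪ N.odd, M.even + N.even⟩ ((-1) ^ inversions M.odd N.odd * (f * g))
      else 0 := by
  simp only [wedge, wedgeHom, Finsupp.linearCombination_single, LinearMap.smul_apply, monoMul]
  split_ifs
  · simp only [Finsupp.smul_single, smul_eq_mul]
    congr 1
    ring
  · simp

theorem inversions_union_right {S T U : Finset (OddGen n m q r)} (h : Disjoint T U) :
    inversions S (T ∪ U) = inversions S T + inversions S U := by
  rw [inversions, Finset.product_union, Finset.filter_union, Finset.card_union_of_disjoint]
  · rfl
  · exact Finset.disjoint_filter_filter (Finset.disjoint_product.2 (Or.inr h))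

theorem inversions_union_left {S T U : Finset (OddGen n m q r)} (h : Disjoint S T) :
    inversions (S ∪ T) U = inversions S U + inversions T U := by
  rw [inversions, Finset.union_product, Finset.filter_union, Finset.card_union_of_disjoint]
  · rfl
  · exact Finset.disjoint_filter_filter (Finset.disjoint_product.2 (Or.inl h))

theorem inversions_add_inversions {S T : Finset (OddGen n m q r)} (h : Disjoint S T) :
    inversions S T + inversions T S = S.card * T.card := by
  have e : inversions T S = ((S ×ˢ T).filter fun x => ¬ x.2 < x.1).card := by
    unfold inversions
    refine Finset.card_bij (fun x _ => (x.2, x.1)) ?_ ?_ ?_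
    · rintro ⟨a, b⟩ hx
      simp only [Finset.mem_filter, Finset.mem_product] at hx ⊢
      exact ⟨⟨hx.1.2, hx.1.1⟩, not_lt.2 hx.2.le⟩
    · rintro ⟨a, b⟩ _ ⟨c, d⟩ _ hh
      simp only [Prod.mk.injEq] at hh ⊢
      exact ⟨hh.2, hh.1⟩
    · rintro ⟨a, b⟩ hx
      simp only [Finset.mem_filter, Finset.mem_product] at hx
      refine ⟨(b, a), ?_, rfl⟩
      simp only [Finset.mem_filter, Finset.mem_product]
      refine ⟨⟨hx.1.2, hx.1.1⟩, lt_of_le_of_ne (not_lt.1 hx.2) ?_⟩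
      rintro rfl
      exact Finset.disjoint_left.1 h hx.1.1 hx.1.2
  rw [e, inversions, Finset.card_filter_add_card_filter_not, Finset.card_product]

@[simp]
theorem inversions_empty_left (S : Finset (OddGen n m q r)) : inversions ∅ S = 0 := by
  simp [inversions]

@[simp]
theorem inversions_empty_right (S : Finset (OddGen n m q r)) : inversions S ∅ = 0 := by
  simp [inversions]

theorem inversions_singleton (S : Finset (OddGen n m q r)) (g : OddGen n m q r) :
    inversions S {g} = (S.filter fun h => g < h).card := by
  unfold inversions
  refine Finset.card_bij (fun x _ => x.1) ?_ ?_ ?_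
  · rintro ⟨a, b⟩ hx
    simp only [Finset.mem_filter, Finset.mem_product, Finset.mem_singleton] at hx ⊢
    obtain ⟨⟨h1, rfl⟩, h2⟩ := hx
    exact ⟨h1, h2⟩
  · rintro ⟨a, b⟩ hx ⟨c, d⟩ hy hh
    simp only [Finset.mem_filter, Finset.mem_product, Finset.mem_singleton] at hx hy hh
    rw [Prod.mk.injEq]
    exact ⟨hh, by rw [hx.1.2, hy.1.2]⟩
  · intro a ha
    simp only [Finset.mem_filter] at ha
    exact ⟨(a, g), by simp [ha], rfl⟩

theorem wedge_assoc (a b c : Form n m q r) : wedge (wedge a b) c = wedge a (wedge b c) := by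
  induction a using Finsupp.induction_linear with
  | zero => simp
  | add x y hx hy => simp only [wedge_add_left, hx, hy]
  | single M f =>
  induction b using Finsupp.induction_linear with
  | zero => simp
  | add x y hx hy => simp only [wedge_add_left, wedge_add_right, hx, hy]
  | single N g =>
  induction c using Finsupp.induction_linear with
  | zero => simp
  | add x y hx hy => simp only [wedge_add_right, hx, hy]
  | single P h =>
  by_cases h1 : Disjoint M.odd N.odd
  · by_cases h2 : Disjoint N.odd P.odd
    · by_cases h3 : Disjoint M.odd P.odd
      · simp only [wedge_single, if_pos h1, if_pos h2,
          if_pos (Finset.disjoint_union_left.2 ⟨h3, h2⟩),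
          if_pos (Finset.disjoint_union_right.2 ⟨h1, h3⟩),
          inversions_union_left h1, inversions_union_right h2, Finset.union_assoc, add_assoc]
        congr 1
        ring
      · simp only [wedge_single, if_pos h1, if_pos h2]
        rw [if_neg, if_neg]
        · simp only [Finset.disjoint_union_right]; tauto
        · simp only [Finset.disjoint_union_left]; tauto
    · simp only [wedge_single, if_pos h1, if_neg h2, wedge_zero_right]
      rw [if_neg]
      simp only [Finset.disjoint_union_left]; tauto
  · simp only [wedge_single, if_neg h1, wedge_zero_left]
    split_ifs with h2
    · rw [wedge_single, if_neg]
      simp only [Finset.disjoint_union_right]; tauto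
    · simp

/-- Local forms of parity `p` modulo `2`. -/
def parityPiece (n m q r : ℕ) (p : ℕ) : Submodule (LocFun n m) (Form n m q r) :=
  Finsupp.supported (LocFun n m) (LocFun n m) {M | M.odd.card % 2 = p % 2}

theorem single_mem_parityPiece (M : Mono n m q r) (f : LocFun n m) :
    Finsupp.single M f ∈ parityPiece n m q r M.odd.card :=
  Finsupp.single_mem_supported _ _ rfl

theorem parityPiece_congr {p p' : ℕ} (h : p % 2 = p' % 2) :
    parityPiece n m q r p = parityPiece n m q r p' := by
  simp only [parityPiece, h]

/-- Induction on the monomials of a form supported on a set of monomials. -/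
theorem supported_induction {S : Set (Mono n m q r)} {P : Form n m q r → Prop} (zero : P 0)
    (add : ∀ a b, P a → P b → P (a + b)) (single : ∀ M ∈ S, ∀ f, P (Finsupp.single M f))
    (a : Form n m q r) (ha : ↑a.support ⊆ S) : P a := by
  rw [← Finsupp.sum_single a]
  exact Finset.sum_induction _ P add zero fun M hM => single M (ha hM) _

theorem neg_one_pow_congr_mod {p p' : ℕ} (h : p % 2 = p' % 2) : (-1 : ℤ) ^ p = (-1) ^ p' := by
  rw [neg_one_pow_eq_pow_mod_two, h, ← neg_one_pow_eq_pow_mod_two]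

theorem wedge_comm_single (M N : Mono n m q r) (f g : LocFun n m) :
    wedge (Finsupp.single M f) (Finsupp.single N g) =
      (-1 : ℤ) ^ (M.odd.card * N.odd.card) •
        wedge (Finsupp.single N g) (Finsupp.single M f) := by
  simp only [wedge_single]
  by_cases h : Disjoint M.odd N.odd
  · rw [if_pos h, if_pos h.symm, ← inversions_add_inversions h, Finset.union_comm, add_comm M.even,
      Finsupp.smul_single]
    congr 1
    rw [zsmul_eq_mul, pow_add]
    push_cast
    have : ((-1 : LocFun n m) ^ inversions N.odd M.odd) * (-1) ^ inversions N.odd M.odd = 1 := by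
      rw [← mul_pow]; simp
    linear_combination (-((-1) ^ inversions M.odd N.odd * (f * g))) * this
  · rw [if_neg h, if_neg fun h' => h h'.symm, smul_zero]

theorem wedge_comm_of_parity {p p' : ℕ} {a b : Form n m q r} (ha : a ∈ parityPiece n m q r p)
    (hb : b ∈ parityPiece n m q r p') :
    wedge a b = (-1 : ℤ) ^ (p * p') • wedge b a := by
  refine supported_induction (P := fun a => wedge a b = (-1 : ℤ) ^ (p * p') • wedge b a) (by simp)
    (fun x y hx hy => ?_) (fun M hM f => ?_) a ha
  · rw [wedge_add_left, wedge_add_right, hx, hy, smul_add]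
  refine supported_induction (P := fun b => wedge (Finsupp.single M f) b =
    (-1 : ℤ) ^ (p * p') • wedge b (Finsupp.single M f)) (by simp)
    (fun x y hx hy => ?_) (fun N hN g => ?_) b hb
  · rw [wedge_add_left, wedge_add_right, hx, hy, smul_add]
  rw [wedge_comm_single]
  congr 1
  apply neg_one_pow_congr_mod
  rw [Nat.mul_mod, hM, hN, ← Nat.mul_mod]

/-- The support of a product is controlled by the supports of the factors. -/
theorem wedge_mem_supported {A B C : Set (Mono n m q r)}
    (h : ∀ M ∈ A, ∀ N ∈ B, Disjoint M.odd N.odd → ⟨M.odd ∪ N.odd, M.even + N.even⟩ ∈ C)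
    {a b : Form n m q r} (ha : a ∈ Finsupp.supported (LocFun n m) (LocFun n m) A)
    (hb : b ∈ Finsupp.supported (LocFun n m) (LocFun n m) B) :
    wedge a b ∈ Finsupp.supported (LocFun n m) (LocFun n m) C := by
  refine supported_induction (P := fun a => wedge a b ∈
    Finsupp.supported (LocFun n m) (LocFun n m) C) (by simp) (fun x y hx hy => ?_) (fun M hM f => ?_) a ha
  · rw [wedge_add_left]; exact add_mem hx hy
  refine supported_induction (P := fun b => wedge (Finsupp.single M f) b ∈
    Finsupp.supported (LocFun n m) (LocFun n m) C) (by simp)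
    (fun x y hx hy => ?_) (fun N hN g => ?_) b hb
  · rw [wedge_add_right]; exact add_mem hx hy
  rw [wedge_single]
  split_ifs with hd
  · exact Finsupp.single_mem_supported _ _ (h M hM N hN hd)
  · exact zero_mem _

theorem wedge_mem_parityPiece {p p' : ℕ} {a b : Form n m q r} (ha : a ∈ parityPiece n m q r p)
    (hb : b ∈ parityPiece n m q r p') : wedge a b ∈ parityPiece n m q r (p + p') :=
  wedge_mem_supported (fun M hM N hN hd => by
    change _ % 2 = _ at hM hN ⊢
    rw [Finset.card_union_of_disjoint hd]; omega) ha hb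

theorem wedge_ofFun_one (a : Form n m q r) : wedge (ofFun 1) a = a := by
  induction a using Finsupp.induction_linear with
  | zero => simp
  | add x y hx hy => rw [wedge_add_right, hx, hy]
  | single M f => simp [ofFun, wedge_single]

theorem wedge_ofFun_right (f : LocFun n m) (a : Form n m q r) : wedge a (ofFun f) = f • a := by
  have h : (ofFun f : Form n m q r) = f • ofFun 1 := by simp [ofFun]
  have h1 : wedge a (ofFun 1) = a := by
    induction a using Finsupp.induction_linear with
    | zero => simp
    | add x y hx hy => rw [wedge_add_left, hx, hy]
    | single M f => simp [ofFun, wedge_single]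
  rw [h, wedge_smul_right, h1]

theorem ofFun_mem_parityPiece (f : LocFun n m) : (ofFun f : Form n m q r) ∈ parityPiece n m q r 0 :=
  single_mem_parityPiece ⟨∅, 0⟩ f

theorem oddGen_mem_parityPiece (g : OddGen n m q r) :
    (oddGen g : Form n m q r) ∈ parityPiece n m q r 1 :=
  single_mem_parityPiece (oddMono g) 1

theorem evenGen_mem_parityPiece (g : EvenGen n q r) :
    (evenGen g : Form n m q r) ∈ parityPiece n m q r 0 :=
  single_mem_parityPiece (evenMono g) 1

theorem single_wedge_evenGen (M : Mono n m q r) (f : LocFun n m) (g : EvenGen n q r) :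
    wedge (Finsupp.single M f) (evenGen g) =
      Finsupp.single ⟨M.odd, M.even + Finsupp.single g 1⟩ f := by
  simp [evenGen, wedge_single, evenMono]

theorem single_wedge_oddGen_of_mem {M : Mono n m q r} (f : LocFun n m) {g : OddGen n m q r}
    (hg : g ∈ M.odd) : wedge (Finsupp.single M f) (oddGen g) = 0 := by
  simp [oddGen, wedge_single, oddMono, hg]

theorem single_wedge_oddGen_of_notMem {M : Mono n m q r} (f : LocFun n m) {g : OddGen n m q r}
    (hg : g ∉ M.odd) : wedge (Finsupp.single M f) (oddGen g) =
      (-1 : ℤ) ^ (M.odd.filter fun h => g < h).card •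
        Finsupp.single ⟨insert g M.odd, M.even⟩ f := by
  rw [oddGen, wedge_single]
  simp only [oddMono, Finset.disjoint_singleton_right, hg, not_false_eq_true, if_true,
    inversions_singleton, add_zero, mul_one, Finsupp.smul_single]
  rw [Finset.union_comm, ← Finset.insert_eq]
  congr 1
  rw [zsmul_eq_mul]
  push_cast
  rfl

/-- Every monomial is obtained from `1` by multiplication with larger and larger anticommuting
generators, followed by multiplications with commuting generators. -/
theorem mono_induction {P : Mono n m q r → Prop} (one : P ⟨∅, 0⟩)
    (odd : ∀ M g, (∀ h ∈ M.odd, h < g) → P M → P ⟨insert g M.odd, M.even⟩)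
    (even : ∀ M g, P M → P ⟨M.odd, M.even + Finsupp.single g 1⟩) (M : Mono n m q r) : P M := by
  obtain ⟨S, E⟩ := M
  have h0 : P ⟨S, 0⟩ := by
    induction S using Finset.induction_on_max with
    | empty => exact one
    | insert g S hg ih => exact odd ⟨S, 0⟩ g hg ih
  induction E using Finsupp.induction with
  | zero => exact h0
  | single_add g e E _ _ ih =>
    have key : ∀ e : ℕ, P ⟨S, Finsupp.single g e + E⟩ := by
      intro e
      induction e with
      | zero => simpa using ih
      | succ e ihe =>
        have := even _ g ihe
        rwa [Finsupp.single_add, add_right_comm]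
    exact key e

theorem single_insert_eq_wedge {M : Mono n m q r} (f : LocFun n m) {g : OddGen n m q r}
    (hg : ∀ h ∈ M.odd, h < g) :
    (Finsupp.single ⟨insert g M.odd, M.even⟩ f : Form n m q r) =
      wedge (Finsupp.single M f) (oddGen g) := by
  have hn : g ∉ M.odd := fun h => lt_irrefl g (hg g h)
  rw [single_wedge_oddGen_of_notMem f hn,
    Finset.filter_false_of_mem fun h hh => not_lt.2 (hg h hh).le, Finset.card_empty,
        pow_zero, one_smul]

/-- Local forms are generated, from local functions, by right multiplication with generators. -/
theorem form_induction {P : Form n m q r → Prop} (fn : ∀ f, P (ofFun f))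
    (add : ∀ a b, P a → P b → P (a + b)) (odd : ∀ a g, P a → P (wedge a (oddGen g)))
    (even : ∀ a g, P a → P (wedge a (evenGen g))) (a : Form n m q r) : P a := by
  induction a using Finsupp.induction_linear with
  | zero => simpa [ofFun] using fn 0
  | add x y hx hy => exact add x y hx hy
  | single M f =>
  induction M using mono_induction with
  | one => exact fn f
  | odd M g hg ih => exact single_insert_eq_wedge f hg ▸ odd _ g ih
  | even M g ih => exact single_wedge_evenGen M f g ▸ even _ g ih

end GradedAlgebra

/-! ### Right derivations -/

section RightDerivations

variable {n m q r : ℕ}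

/-- The real-linear right derivations of parity `ε` (mod `2`) of the algebra of local forms. -/
structure IsRightDer (ε : ℕ) (X : Form n m q r →ₗ[ℝ] Form n m q r) : Prop where
  leibniz : ∀ p a b, b ∈ parityPiece n m q r p →
    X (wedge a b) = wedge a (X b) + (-1 : ℤ) ^ (ε * p) • wedge (X a) b
  parity : ∀ p, ∀ a ∈ parityPiece n m q r p, X a ∈ parityPiece n m q r (p + ε)

theorem IsRightDer.oddGen {ε : ℕ} {X : Form n m q r →ₗ[ℝ] Form n m q r} (hX : IsRightDer ε X)
    (a : Form n m q r) (g : OddGen n m q r) :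
    X (wedge a (oddGen g)) = wedge a (X (oddGen g)) + (-1 : ℤ) ^ ε • wedge (X a) (oddGen g) := by
  rw [hX.leibniz 1 _ _ (oddGen_mem_parityPiece g), mul_one]

theorem IsRightDer.evenGen {ε : ℕ} {X : Form n m q r →ₗ[ℝ] Form n m q r} (hX : IsRightDer ε X)
    (a : Form n m q r) (g : EvenGen n q r) :
    X (wedge a (evenGen g)) = wedge a (X (evenGen g)) + wedge (X a) (evenGen g) := by
  rw [hX.leibniz 0 _ _ (evenGen_mem_parityPiece g), mul_zero, pow_zero, one_smul]

/-- A right derivation is determined by its values on local functions and generators. -/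
theorem IsRightDer.ext {ε : ℕ} {X Y : Form n m q r →ₗ[ℝ] Form n m q r} (hX : IsRightDer ε X)
    (hY : IsRightDer ε Y) (fn : ∀ f, X (ofFun f) = Y (ofFun f))
    (odd : ∀ g, X (LocalBRST.oddGen g) = Y (LocalBRST.oddGen g))
    (even : ∀ g, X (LocalBRST.evenGen g) = Y (LocalBRST.evenGen g)) : X = Y := by
  refine LinearMap.ext fun a => ?_
  induction a using form_induction with
  | fn f => exact fn f
  | add a b ha hb => rw [map_add, map_add, ha, hb]
  | odd a g ha => rw [hX.oddGen, hY.oddGen, ha, odd]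
  | even a g ha => rw [hX.evenGen, hY.evenGen, ha, even]

theorem isRightDer_zero (ε : ℕ) : IsRightDer ε (0 : Form n m q r →ₗ[ℝ] Form n m q r) where
  leibniz p a b _ := by simp
  parity p a _ := by simp

theorem IsRightDer.add {ε : ℕ} {X Y : Form n m q r →ₗ[ℝ] Form n m q r} (hX : IsRightDer ε X)
    (hY : IsRightDer ε Y) : IsRightDer ε (X + Y) where
  leibniz p a b hb := by
    simp only [LinearMap.add_apply, hX.leibniz p a b hb, hY.leibniz p a b hb, wedge_add_left,
      wedge_add_right, smul_add]
    abel
  parity p a ha := add_mem (hX.parity p a ha) (hY.parity p a ha)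

/-- The graded commutator of right derivations is a right derivation. -/
theorem IsRightDer.commutator {ε ε' : ℕ} {X Y : Form n m q r →ₗ[ℝ] Form n m q r}
    (hX : IsRightDer ε X) (hY : IsRightDer ε' Y) :
    IsRightDer (ε + ε') (X ∘ₗ Y - (-1 : ℤ) ^ (ε * ε') • (Y ∘ₗ X)) where
  leibniz p a b hb := by
    simp only [LinearMap.sub_apply, LinearMap.comp_apply, LinearMap.smul_apply]
    rw [hX.leibniz p a b hb, hY.leibniz p a b hb, map_add, map_add, map_zsmul, map_zsmul,
      hX.leibniz (p + ε') a (Y b) (hY.parity p b hb), hX.leibniz p (Y a) b hb,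
      hY.leibniz (p + ε) a (X b) (hX.parity p b hb), hY.leibniz p (X a) b hb]
    have hC : ((-1 : ℤ) ^ (ε * ε')) * (-1) ^ (ε * ε') = 1 := by rw [← mul_pow]; simp
    have hC' : (-1 : ℤ) ^ (ε' * ε) = (-1) ^ (ε * ε') := by rw [mul_comm]
    simp only [mul_add, add_mul, pow_add, sub_eq_add_neg, wedge_add_left, wedge_add_right,
      wedge_neg_left, wedge_neg_right, wedge_zsmul_left, wedge_zsmul_right, hC']
    generalize (-1 : ℤ) ^ (ε * ε') = C at *
    generalize (-1 : ℤ) ^ (ε * p) = A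
    generalize (-1 : ℤ) ^ (ε' * p) = B
    rcases mul_self_eq_one_iff.1 hC with rfl | rfl <;> module
  parity p a ha := by
    have h1 : X (Y a) ∈ parityPiece n m q r (p + (ε + ε')) := by
      have := hX.parity _ _ (hY.parity p a ha)
      rwa [add_assoc, add_comm ε'] at this
    have h2 : Y (X a) ∈ parityPiece n m q r (p + (ε + ε')) := by
      have := hY.parity _ _ (hX.parity p a ha)
      rwa [add_assoc] at this
    exact sub_mem h1 (zsmul_mem h2 _)

section RightDer

variable (vo : OddGen n m q r → Form n m q r) (ve : EvenGen n q r → Form n m q r)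

theorem rightDer_single (M : Mono n m q r) (f : LocFun n m) :
    rightDer vo ve (Finsupp.single M f) =
    (∑ g ∈ M.odd, (-1 : ℤ) ^ (M.odd.filter fun h => g < h).card •
      wedge (Finsupp.single ⟨M.odd.erase g, M.even⟩ f) (vo g)) +
    ∑ g ∈ M.even.support, M.even g •
      wedge (Finsupp.single ⟨M.odd, M.even - Finsupp.single g 1⟩ f) (ve g) := by
  have h (M : Mono n m q r) :
      (Finsupp.single M f : Form n m q r) = f • Finsupp.single M 1 := by simp
  rw [rightDer, Finsupp.linearCombination_single, smul_add, Finset.smul_sum, Finset.smul_sum]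
  congr 1
  · refine Finset.sum_congr rfl fun g _ => ?_
    rw [h ⟨M.odd.erase g, M.even⟩, wedge_smul_left, smul_comm]
  · refine Finset.sum_congr rfl fun g _ => ?_
    rw [h ⟨M.odd, M.even - Finsupp.single g 1⟩, wedge_smul_left, smul_comm]

@[simp]
theorem rightDer_ofFun (f : LocFun n m) : rightDer vo ve (ofFun f) = 0 := by
  rw [ofFun, rightDer_single]
  simp

@[simp]
theorem rightDer_oddGen (g : OddGen n m q r) : rightDer vo ve (oddGen g) = vo g := by
  rw [oddGen, rightDer_single]
  simp only [oddMono, Finset.sum_singleton, Finsupp.support_zero, Finset.sum_empty, add_zero]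
  rw [Finset.filter_singleton, if_neg (lt_irrefl g)]
  simpa [ofFun] using wedge_ofFun_one (vo g)

@[simp]
theorem rightDer_evenGen (g : EvenGen n q r) : rightDer vo ve (evenGen g) = ve g := by
  rw [evenGen, rightDer_single]
  simp only [evenMono, Finset.sum_empty, zero_add]
  rw [(Finsupp.support_single (a := g) (b := 1) one_ne_zero), Finset.sum_singleton]
  simpa [ofFun] using wedge_ofFun_one (ve g)

variable {vo ve}

theorem rightDer_wedge_evenGen {ε : ℕ} (hvo : ∀ g, vo g ∈ parityPiece n m q r (ε + 1))
    (hve : ∀ g, ve g ∈ parityPiece n m q r ε) (a : Form n m q r) (g : EvenGen n q r) :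
    rightDer vo ve (wedge a (evenGen g)) =
      wedge a (ve g) + wedge (rightDer vo ve a) (evenGen g) := by
  classical
  induction a using Finsupp.induction_linear with
  | zero => simp
  | add x y hx hy => simp only [wedge_add_left, map_add, hx, hy]; abel
  | single M f =>
  have comm : ∀ p (b : Form n m q r), b ∈ parityPiece n m q r p →
      wedge b (evenGen g) = wedge (evenGen g) b := fun p b hb => by
    rw [wedge_comm_of_parity hb (evenGen_mem_parityPiece g), mul_zero, pow_zero, one_smul]
  rw [single_wedge_evenGen, rightDer_single, rightDer_single, wedge_add_left, wedge_sum_left,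
    wedge_sum_left]
  have key : ∑ h ∈ (M.even + Finsupp.single g 1).support,
      (M.even + Finsupp.single g 1 : EvenGen n q r →₀ ℕ) h •
      wedge (Finsupp.single
        (⟨M.odd, M.even + Finsupp.single g 1 - Finsupp.single h 1⟩ : Mono n m q r) f) (ve h) =
      wedge (Finsupp.single M f) (ve g) + ∑ h ∈ M.even.support, wedge (M.even h •
        wedge (Finsupp.single ⟨M.odd, M.even - Finsupp.single h 1⟩ f) (ve h)) (evenGen g) := by
    have e1 : ∀ h, wedge (M.even h •
        wedge (Finsupp.single ⟨M.odd, M.even - Finsupp.single h 1⟩ f) (ve h)) (evenGen g) =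
        M.even h • wedge (Finsupp.single
          (⟨M.odd, M.even + Finsupp.single g 1 - Finsupp.single h 1⟩ : Mono n m q r) f)
          (ve h) := by
      intro h
      by_cases hh : M.even h = 0
      · simp [hh]
      · rw [wedge_nsmul_left, wedge_assoc, comm _ _ (hve h), ← wedge_assoc, single_wedge_evenGen]
        simp only
        rw [tsub_add_eq_add_tsub]
        exact Finsupp.single_le_iff.2 (Nat.one_le_iff_ne_zero.2 hh)
    simp only [e1]
    rw [Finset.sum_subset (s₂ := insert g M.even.support), Finset.sum_subset
      (s₁ := M.even.support) (s₂ := insert g M.even.support) (Finset.subset_insert _ _)]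
    · simp only [Finsupp.add_apply, add_smul, Finset.sum_add_distrib]
      rw [add_comm]
      congr 1
      rw [Finset.sum_eq_single g]
      · simp
      · intro h _ hh
        rw [Finsupp.single_eq_of_ne hh, zero_smul]
      · simp
    · intro h _ hh
      rw [Finsupp.notMem_support_iff.1 hh, zero_smul]
    · intro h hh
      rw [Finsupp.mem_support_iff, Finsupp.add_apply] at hh
      rw [Finset.mem_insert, Finsupp.mem_support_iff]
      by_contra hc
      push Not at hc
      rw [Finsupp.single_eq_of_ne hc.1, hc.2] at hh
      exact hh rfl
    · intro h _ hh
      rw [Finsupp.notMem_support_iff.1 hh, zero_smul]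
  simp only at key ⊢
  rw [key, ← add_assoc, ← add_assoc, add_comm (wedge _ (ve g))]
  congr 2
  refine Finset.sum_congr rfl fun h _ => ?_
  rw [wedge_zsmul_left, wedge_assoc, comm _ _ (hvo h), ← wedge_assoc, single_wedge_evenGen]

theorem rightDer_wedge_oddGen {ε : ℕ} (hvo : ∀ g, vo g ∈ parityPiece n m q r (ε + 1))
    (hve : ∀ g, ve g ∈ parityPiece n m q r ε) (a : Form n m q r) (g : OddGen n m q r) :
    rightDer vo ve (wedge a (oddGen g)) =
      wedge a (vo g) + (-1 : ℤ) ^ ε • wedge (rightDer vo ve a) (oddGen g) := by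
  induction a using Finsupp.induction_linear with
  | zero => simp
  | add x y hx hy => simp only [wedge_add_left, map_add, hx, hy, smul_add]; abel
  | single M f =>
  have hε : (-1 : ℤ) ^ ε * (-1) ^ ε = 1 := by rw [← mul_pow]; simp
  have commo : ∀ (b : Form n m q r) h, wedge (wedge b (vo h)) (oddGen g) =
      (-1 : ℤ) ^ (ε + 1) • wedge (wedge b (oddGen g)) (vo h) := fun b h => by
    rw [wedge_assoc, wedge_comm_of_parity (hvo h) (oddGen_mem_parityPiece g), mul_one,
      wedge_zsmul_right, wedge_assoc]
  have comme : ∀ (b : Form n m q r) h, wedge (wedge b (ve h)) (oddGen g) =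
      (-1 : ℤ) ^ ε • wedge (wedge b (oddGen g)) (ve h) := fun b h => by
    rw [wedge_assoc, wedge_comm_of_parity (hve h) (oddGen_mem_parityPiece g), mul_one,
      wedge_zsmul_right, wedge_assoc]
  rw [rightDer_single, wedge_add_left, wedge_sum_left, wedge_sum_left]
  simp only [wedge_zsmul_left, wedge_nsmul_left, commo, comme]
  by_cases hg : g ∈ M.odd
  · rw [single_wedge_oddGen_of_mem f hg, map_zero, Finset.sum_eq_single g]
    · rw [single_wedge_oddGen_of_notMem f (M := ⟨M.odd.erase g, M.even⟩)
        (Finset.notMem_erase g M.odd)]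
      have e : ((M.odd.erase g).filter fun h => g < h) = M.odd.filter fun h => g < h := by
        ext h
        simp only [Finset.mem_filter, Finset.mem_erase]
        exact ⟨fun ⟨⟨_, h1⟩, h2⟩ => ⟨h1, h2⟩, fun ⟨h1, h2⟩ => ⟨⟨h2.ne', h1⟩, h2⟩⟩
      simp only [e, Finset.insert_erase hg]
      rw [Finset.sum_eq_zero, add_zero, wedge_zsmul_left, smul_smul, smul_smul, smul_smul]
      · have : ∀ k : ℕ, (-1 : ℤ) ^ ε * ((-1) ^ k * ((-1) ^ (ε + 1) * (-1) ^ k)) = -1 := by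
          intro k
          have hk : (-1 : ℤ) ^ k * (-1) ^ k = 1 := by rw [← mul_pow]; simp
          rw [pow_succ]
          linear_combination (-1 : ℤ) ^ k * (-1) ^ k * (-1) * hε - hk
        rw [mul_assoc, mul_assoc, this, neg_one_smul, add_neg_cancel]
      · intro h _
        rw [single_wedge_oddGen_of_mem f (M := ⟨M.odd, M.even - Finsupp.single h 1⟩) hg]
        simp
    · intro h _ hh
      rw [single_wedge_oddGen_of_mem f (M := ⟨M.odd.erase h, M.even⟩)
        (Finset.mem_erase.2 ⟨hh.symm, hg⟩)]
      simp
    · exact fun h => absurd hg h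
  · rw [single_wedge_oddGen_of_notMem f hg, map_zsmul, rightDer_single]
    simp only
    rw [Finset.sum_insert hg, Finset.erase_insert hg, Finset.filter_insert, if_neg (lt_irrefl g)]
    have ht : ∀ k : ℕ, (-1 : ℤ) ^ k * (-1) ^ k = 1 := fun k => by rw [← mul_pow]; simp
    rw [smul_add, smul_add, smul_smul, ht, one_smul, smul_add, add_assoc, Finset.smul_sum,
      Finset.smul_sum, Finset.smul_sum, Finset.smul_sum]
    congr 1
    congr 1
    · refine Finset.sum_congr rfl fun h hh => ?_
      have hgh : g ≠ h := fun e => hg (e ▸ hh)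
      rw [single_wedge_oddGen_of_notMem f (M := ⟨M.odd.erase h, M.even⟩)
        fun h' => hg (Finset.mem_of_mem_erase h')]
      simp only
      rw [wedge_zsmul_left, smul_smul, smul_smul, smul_smul, smul_smul,
        Finset.erase_insert_of_ne hgh]
      congr 1
      rw [Finset.filter_insert]
      have e2 : (M.odd.filter fun k => g < k).card =
          ((M.odd.erase h).filter fun k => g < k).card + if g < h then 1 else 0 := by
        conv_lhs => rw [← Finset.insert_erase hh, Finset.filter_insert]
        split_ifs
        · rw [Finset.card_insert_of_notMem (by simp)]
        · rfl
      rw [e2]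
      have : ¬ g ∈ M.odd.filter fun k => h < k := fun h' => hg (Finset.mem_filter.1 h').1
      rcases lt_or_gt_of_ne hgh with hlt | hlt
      · rw [if_pos hlt, if_neg hlt.not_gt, pow_succ, pow_succ]
        generalize (-1 : ℤ) ^ ((M.odd.erase h).filter fun k => g < k).card = A
        generalize (-1 : ℤ) ^ (M.odd.filter fun k => h < k).card = B
        linear_combination A * B * hε
      · rw [if_neg hlt.not_gt, if_pos hlt, Finset.card_insert_of_notMem this, pow_succ, pow_succ,
          add_zero]
        generalize (-1 : ℤ) ^ ((M.odd.erase h).filter fun k => g < k).card = A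
        generalize (-1 : ℤ) ^ (M.odd.filter fun k => h < k).card = B
        linear_combination A * B * hε
    · refine Finset.sum_congr rfl fun h hh => ?_
      rw [single_wedge_oddGen_of_notMem f (M := ⟨M.odd, M.even - Finsupp.single h 1⟩) hg]
      simp only
      rw [wedge_zsmul_left, smul_comm ((-1 : ℤ) ^ ε), smul_smul ((-1 : ℤ) ^ ε), hε, one_smul,
        smul_comm]

/-- A derivation of parity `ε` that is given on generators is a right derivation. -/
theorem isRightDer_rightDer {ε : ℕ} (hvo : ∀ g, vo g ∈ parityPiece n m q r (ε + 1))
    (hve : ∀ g, ve g ∈ parityPiece n m q r ε) :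
    IsRightDer ε ((rightDer vo ve).restrictScalars ℝ) where
  leibniz p a b hb := by
    simp only [LinearMap.restrictScalars_apply]
    have key : ∀ (N : Mono n m q r) a f, rightDer vo ve (wedge a (Finsupp.single N f)) =
        wedge a (rightDer vo ve (Finsupp.single N f)) +
          (-1 : ℤ) ^ (ε * N.odd.card) • wedge (rightDer vo ve a) (Finsupp.single N f) := by
      intro N
      induction N using mono_induction with
      | one =>
        intro a f
        have := rightDer_ofFun vo ve f
        rw [ofFun] at this
        rw [this]
        change rightDer vo ve (wedge a (ofFun f)) = _ + _ • wedge _ (ofFun f)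
        simp [wedge_ofFun_right]
      | odd M g hg ih =>
        intro a f
        have hn : g ∉ M.odd := fun h => lt_irrefl g (hg g h)
        rw [single_insert_eq_wedge f hg, ← wedge_assoc, rightDer_wedge_oddGen hvo hve, ih,
          rightDer_wedge_oddGen hvo hve]
        simp only [wedge_add_left, wedge_add_right, smul_add, wedge_assoc, wedge_zsmul_left,
          wedge_zsmul_right, smul_smul]
        rw [Finset.card_insert_of_notMem hn, mul_add, pow_add, mul_one, mul_comm ((-1 : ℤ) ^ ε)]
        abel
      | even M g ih =>
        intro a f
        have e : (Finsupp.single ⟨M.odd, M.even + Finsupp.single g 1⟩ f : Form n m q r) =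
          wedge (Finsupp.single M f) (evenGen g) := (single_wedge_evenGen M f g).symm
        rw [e, ← wedge_assoc, rightDer_wedge_evenGen hvo hve, ih,
          rightDer_wedge_evenGen hvo hve]
        simp only [wedge_add_left, wedge_add_right, wedge_assoc, wedge_zsmul_left]
        abel
    refine supported_induction (P := fun b => rightDer vo ve (wedge a b) =
      wedge a (rightDer vo ve b) + (-1 : ℤ) ^ (ε * p) • wedge (rightDer vo ve a) b) (by simp)
      (fun x y hx hy => ?_) (fun N hN f => ?_) b hb
    · simp only [wedge_add_right, map_add, hx, hy, smul_add]; abel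
    · rw [key N a f]
      congr 2
      refine neg_one_pow_congr_mod ?_
      rw [Nat.mul_mod, hN, ← Nat.mul_mod]
  parity p a ha := by
    simp only [LinearMap.restrictScalars_apply]
    refine supported_induction (P := fun b => rightDer vo ve b ∈ parityPiece n m q r (p + ε))
      (by simp) (fun x y hx hy => ?_) (fun N hN f => ?_) a ha
    · rw [map_add]; exact add_mem hx hy
    have hN' : N.odd.card % 2 = p % 2 := hN
    rw [rightDer_single]
    refine add_mem (sum_mem fun g hg => zsmul_mem ?_ _) (sum_mem fun g hg => nsmul_mem ?_ _)
    · have := wedge_mem_parityPiece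
        (single_mem_parityPiece (⟨N.odd.erase g, N.even⟩ : Mono n m q r) f) (hvo g)
      rw [parityPiece_congr (p' := p + ε)] at this
      · exact this
      · have : N.odd.card ≠ 0 := Finset.card_ne_zero_of_mem hg
        simp only [Finset.card_erase_of_mem hg]
        omega
    · have := wedge_mem_parityPiece
        (single_mem_parityPiece (⟨N.odd, N.even - Finsupp.single g 1⟩ : Mono n m q r) f) (hve g)
      rw [parityPiece_congr (p' := p + ε)] at this
      · exact this
      · simp only
        omega

end RightDer

end RightDerivations

/-! ### Calculus of local functions -/

section LocalCalculus

variable {n m : ℕ}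

@[ext]
theorem LocFun.ext {f g : LocFun n m} (h : ∀ u, f.eval u = g.eval u) : f = g :=
  Subtype.ext (funext h)

@[simp]
theorem LocFun.eval_mul (f g : LocFun n m) (u : Jet n m) :
    (f * g).eval u = f.eval u * g.eval u := rfl

@[simp]
theorem LocFun.eval_zero (u : Jet n m) : (0 : LocFun n m).eval u = 0 := rfl

@[simp]
theorem LocFun.eval_one (u : Jet n m) : (1 : LocFun n m).eval u = 1 := rfl

/-- Evaluation of local functions at a jet, as a ring homomorphism. -/
def LocFun.evalHom (u : Jet n m) : LocFun n m →+* ℝ where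
  toFun f := f.eval u
  map_one' := rfl
  map_mul' _ _ := rfl
  map_zero' := rfl
  map_add' _ _ := rfl

theorem LocFun.eval_sum {ι : Type*} (s : Finset ι) (f : ι → LocFun n m) (u : Jet n m) :
    (∑ i ∈ s, f i).eval u = ∑ i ∈ s, (f i).eval u :=
  map_sum (LocFun.evalHom u) f s

theorem LocFun.eval_prod {ι : Type*} (s : Finset ι) (f : ι → LocFun n m) (u : Jet n m) :
    (∏ i ∈ s, f i).eval u = ∏ i ∈ s, (f i).eval u :=
  map_prod (LocFun.evalHom u) f s

theorem pd_mul (c : Coord n m) (f g : LocFun n m) : pd c (f * g) = f * pd c g + g * pd c f := by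
  refine Subtype.ext (funext fun u => ?_)
  refine (deriv_mul (differentiableAt_slice f.2 c u) (differentiableAt_slice g.2 c u)).trans ?_
  simp only [Function.update_eq_self]
  change pdFun c f.1 u * g.1 u + f.1 u * pdFun c g.1 u =
    f.1 u * pdFun c g.1 u + g.1 u * pdFun c f.1 u
  ring

theorem pd_coord (c c' : Coord n m) : pd c (coord c') = if c = c' then 1 else 0 := by
  classical
  refine Subtype.ext (funext fun u => ?_)
  change deriv (fun t => Function.update u c t c') (u c) = _
  split_ifs with h
  · subst h
    simp only [Function.update_self]
    exact deriv_id _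
  · simp only [Function.update_of_ne (Ne.symm h)]
    exact deriv_const _ _

/-- Partial derivatives in terms of a function of finitely many coordinates. -/
theorem pd_eval_of_mem {f : LocFun n m} {T : Finset (Coord n m)} {g : (T → ℝ) → ℝ}
    (hg : ContDiff ℝ ∞ g) (hf : ∀ u, f.eval u = g fun c => u c) {c : Coord n m} (hc : c ∈ T)
    (u : Jet n m) :
    (pd c f).eval u = fderiv ℝ g (fun a => u a) (Pi.single ⟨c, hc⟩ 1) :=
  (hasDerivAt_slice hg hf hc u).deriv

theorem pd_eq_zero_of_notMem {f : LocFun n m} {T : Finset (Coord n m)} {g : (T → ℝ) → ℝ}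
    (hf : ∀ u, f.eval u = g fun c => u c) {c : Coord n m} (hc : c ∉ T) : pd c f = 0 := by
  refine Subtype.ext (funext fun u => ?_)
  have h (t : ℝ) : f.1 (Function.update u c t) = f.1 u := slice_const hf hc u t
  change deriv (fun t => f.1 (Function.update u c t)) (u c) = 0
  simp only [h]
  exact deriv_const _ _

theorem contDiff_fderiv_apply_const {T : Finset (Coord n m)} {g : (T → ℝ) → ℝ}
    (hg : ContDiff ℝ ∞ g) (v : T → ℝ) : ContDiff ℝ ∞ fun w => fderiv ℝ g w v :=
  (hg.fderiv_right (m := ∞) (by simp)).clm_apply contDiff_const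

theorem pd_comm (c c' : Coord n m) (f : LocFun n m) : pd c (pd c' f) = pd c' (pd c f) := by
  obtain ⟨T, g, hg, hfg⟩ := f.2
  have hz : ∀ {a b : Coord n m}, a ∉ T → pd a (pd b f) = 0 := by
    intro a b ha
    by_cases hb : b ∈ T
    · exact pd_eq_zero_of_notMem (g := fun w => fderiv ℝ g w (Pi.single ⟨b, hb⟩ 1))
        (fun u => pd_eval_of_mem hg hfg hb u) ha
    · rw [pd_eq_zero_of_notMem hfg hb, map_zero]
  by_cases hc : c ∈ T
  · by_cases hc' : c' ∈ T
    · ext u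
      rw [pd_eval_of_mem (contDiff_fderiv_apply_const hg _)
          (fun u => pd_eval_of_mem hg hfg hc' u) hc,
        pd_eval_of_mem (contDiff_fderiv_apply_const hg _)
          (fun u => pd_eval_of_mem hg hfg hc u) hc']
      have hd : DifferentiableAt ℝ (fderiv ℝ g) (fun a => u a) :=
        ((hg.fderiv_right (m := ∞) (by simp)).differentiable (by simp)).differentiableAt
      rw [fderiv_clm_apply hd (differentiableAt_const _),
        fderiv_clm_apply hd (differentiableAt_const _)]
      simp only [fderiv_fun_const, Pi.zero_apply, ContinuousLinearMap.comp_zero, zero_add,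
        ContinuousLinearMap.flip_apply]
      exact (hg.contDiffAt.isSymmSndFDerivAt (by
        rw [minSmoothness_of_isRCLikeNormedField]
        exact WithTop.coe_le_coe.2 (le_top (a := (2 : ℕ∞))))) _ _
    · rw [hz hc', pd_eq_zero_of_notMem hfg hc', map_zero]
  · rw [hz hc, pd_eq_zero_of_notMem hfg hc, map_zero]

/-- The coefficients of the vector field `∂_μ` on jet space. -/
def totalDCoeff (μ : Fin n) : Coord n m → LocFun n m
  | .inl ν => if ν = μ then 1 else 0
  | .inr c => coord (Sum.inr (c.1, c.2.shift μ))

/-- The total derivative as a finite sum over a set of coordinates containing those on which the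
function depends. -/
theorem totalD_eq_sum (μ : Fin n) {f : LocFun n m} {T : Finset (Coord n m)}
    (hT : ∀ c ∉ T, pd c f = 0) : totalD μ f = ∑ c ∈ T, totalDCoeff μ c * pd c f := by
  classical
  have e0 : totalD μ f = pd (Sum.inl μ) f +
    ∑ᶠ c : Fin m × MIdx n, coord (Sum.inr (c.1, c.2.shift μ)) * pd (Sum.inr c) f := rfl
  rw [e0, finsum_eq_sum_of_support_subset (s := T.toRight), Finset.sum_sum_eq_sum_toLeft_add_sum_toRight]
  · simp only [totalDCoeff]
    congr 1
    by_cases h : Sum.inl μ ∈ T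
    · rw [Finset.sum_eq_single μ]
      · simp
      · intro ν _ hν
        simp [hν]
      · intro h'
        exact absurd (Finset.mem_toLeft.2 h) h'
    · rw [hT _ h, Finset.sum_eq_zero]
      intro ν hν
      rw [if_neg, zero_mul]
      rintro rfl
      exact h (Finset.mem_toLeft.1 hν)
  · intro c hc
    rw [Finset.mem_coe, Finset.mem_toRight]
    by_contra h
    exact hc (by simp [hT _ h])

theorem exists_finset_pd (f : LocFun n m) : ∃ T : Finset (Coord n m), ∀ c ∉ T, pd c f = 0 := by
  refine ⟨(finite_pd f).toFinset, fun c hc => ?_⟩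
  simpa using hc

theorem totalD_mul (μ : Fin n) (f g : LocFun n m) :
    totalD μ (f * g) = f * totalD μ g + g * totalD μ f := by
  classical
  obtain ⟨S, hS⟩ := exists_finset_pd f
  obtain ⟨T, hT⟩ := exists_finset_pd g
  have h1 : ∀ c ∉ S ∪ T, pd c f = 0 := fun c hc => hS c (by simp at hc; tauto)
  have h2 : ∀ c ∉ S ∪ T, pd c g = 0 := fun c hc => hT c (by simp at hc; tauto)
  rw [totalD_eq_sum μ h1, totalD_eq_sum μ h2, totalD_eq_sum μ (T := S ∪ T), Finset.mul_sum,
    Finset.mul_sum, ← Finset.sum_add_distrib]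
  · refine Finset.sum_congr rfl fun c _ => ?_
    rw [pd_mul]; ring
  · intro c hc
    rw [pd_mul, h1 c hc, h2 c hc]; simp

theorem totalD_one (μ : Fin n) : totalD μ (1 : LocFun n m) = 0 := by
  have := totalD_mul μ (1 : LocFun n m) 1
  simpa using this

theorem totalD_coord (μ : Fin n) (c : Coord n m) : totalD μ (coord c) = totalDCoeff μ c := by
  classical
  rw [totalD_eq_sum μ (T := {c})]
  · simp [pd_coord]
  · intro c' hc'
    rw [pd_coord, if_neg (by simpa using hc')]

theorem MIdx.shift_comm (J : MIdx n) (μ ν : Fin n) : (J.shift μ).shift ν = (J.shift ν).shift μ := by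
  simp only [MIdx.shift]; abel

theorem totalD_comm (μ ν : Fin n) (f : LocFun n m) :
    totalD μ (totalD ν f) = totalD ν (totalD μ f) := by
  obtain ⟨T, hT⟩ := exists_finset_pd f
  have key : ∀ μ ν : Fin n, totalD μ (totalD ν f) = ∑ c ∈ T,
      totalD μ (totalDCoeff ν c) * pd c f +
        ∑ c ∈ T, ∑ c' ∈ T, totalDCoeff ν c * totalDCoeff μ c' * pd c' (pd c f) := by
    intro μ ν
    rw [totalD_eq_sum ν hT, map_sum, ← Finset.sum_add_distrib]
    refine Finset.sum_congr rfl fun c _ => ?_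
    rw [totalD_mul, totalD_eq_sum μ (f := pd c f) (T := T), Finset.mul_sum, add_comm,
      mul_comm (pd c f)]
    · simp only [mul_assoc]
    · intro c' hc'
      rw [pd_comm, hT _ hc', map_zero]
  rw [key, key]
  congr 1
  · refine Finset.sum_congr rfl fun c _ => ?_
    congr 1
    cases c with
    | inl κ =>
      simp only [totalDCoeff]
      split_ifs <;> simp [totalD_one]
    | inr c => simp only [totalDCoeff, totalD_coord, MIdx.shift_comm]
  · rw [Finset.sum_comm]
    refine Finset.sum_congr rfl fun c _ => Finset.sum_congr rfl fun c' _ => ?_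
    rw [pd_comm c c']
    ring

end LocalCalculus

/-! ### The total derivatives of local forms -/

section FormDerivatives

variable {n m q r : ℕ}

theorem formD_apply (μ : Fin n) (a : Form n m q r) :
    formD μ a = Finsupp.mapRange.linearMap (totalD μ) a + rightDer (shiftOdd μ) (shiftEven μ) a :=
  rfl

theorem shiftOdd_mem_parityPiece (μ : Fin n) (g : OddGen n m q r) :
    shiftOdd μ g ∈ parityPiece n m q r (0 + 1) := by
  cases g <;> simp only [shiftOdd]
  · exact zero_mem _
  all_goals exact oddGen_mem_parityPiece _

theorem shiftEven_mem_parityPiece (μ : Fin n) (g : EvenGen n q r) :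
    (shiftEven μ g : Form n m q r) ∈ parityPiece n m q r 0 := by
  cases g <;> exact evenGen_mem_parityPiece _

@[simp]
theorem formD_ofFun (μ : Fin n) (f : LocFun n m) :
    formD μ (ofFun f : Form n m q r) = ofFun (totalD μ f) := by
  rw [formD_apply, rightDer_ofFun, add_zero, ofFun, Finsupp.mapRange.linearMap_apply,
    Finsupp.mapRange_single]
  rfl

@[simp]
theorem formD_oddGen (μ : Fin n) (g : OddGen n m q r) :
    formD μ (oddGen g : Form n m q r) = shiftOdd μ g := by
  rw [formD_apply, rightDer_oddGen, oddGen, Finsupp.mapRange.linearMap_apply,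
    Finsupp.mapRange_single, totalD_one, Finsupp.single_zero, zero_add]

@[simp]
theorem formD_evenGen (μ : Fin n) (g : EvenGen n q r) :
    formD μ (evenGen g : Form n m q r) = shiftEven μ g := by
  rw [formD_apply, rightDer_evenGen, evenGen, Finsupp.mapRange.linearMap_apply,
    Finsupp.mapRange_single, totalD_one, Finsupp.single_zero, zero_add]

theorem isRightDer_formD (μ : Fin n) :
    IsRightDer 0 (formD μ : Form n m q r →ₗ[ℝ] Form n m q r) := by
  refine IsRightDer.add ?_ (isRightDer_rightDer (shiftOdd_mem_parityPiece μ)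
    (shiftEven_mem_parityPiece μ))
  constructor
  · intro p a b hb
    clear hb
    rw [zero_mul, pow_zero, one_smul]
    induction a using Finsupp.induction_linear with
    | zero => simp
    | add x y hx hy => simp only [wedge_add_left, map_add, hx, hy]; abel
    | single M f =>
    induction b using Finsupp.induction_linear with
    | zero => simp
    | add x y hx hy => 
      rw [wedge_add_right, map_add, map_add, wedge_add_right, hx, hy, wedge_add_right]
      abel
    | single N g =>
    simp only [wedge_single, Finsupp.mapRange.linearMap_apply, Finsupp.mapRange_single]
    split_ifs
    · rw [Finsupp.mapRange_single, ← Finsupp.single_add]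
      congr 1
      have h : ∀ (k : ℕ) (x : LocFun n m), totalD μ ((-1) ^ k * x) = (-1) ^ k * totalD μ x := by
        intro k x
        rcases neg_one_pow_eq_or (LocFun n m) k with h | h <;> simp [h]
      rw [h, totalD_mul]
      ring
    · simp
  · intro p a ha
    exact subset_trans (Finset.coe_subset.2 (Finsupp.support_mapRange (hf := map_zero _))) ha

theorem formD_comm (μ ν : Fin n) (a : Form n m q r) :
    formD μ (formD ν a) = formD ν (formD μ a) := by
  have h := (isRightDer_formD μ).commutator (isRightDer_formD (m := m) (q := q) (r := r) ν)
  have := h.ext (isRightDer_zero _) ?_ ?_ ?_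
  · simpa [sub_eq_zero] using LinearMap.congr_fun this a
  · intro f
    simp [totalD_comm μ ν]
  · intro g
    cases g <;> simp [shiftOdd, MIdx.shift_comm _ μ ν]
  · intro g
    cases g <;> simp [shiftEven, MIdx.shift_comm _ μ ν]

theorem prod_ofFn_pow_shift {M : Type*} [Monoid M] {n : ℕ} (D : Fin n → M)
    (hD : ∀ μ ν, Commute (D μ) (D ν)) (J : MIdx n) (μ : Fin n) :
    (List.ofFn fun ν => D ν ^ J.shift μ ν).prod = D μ * (List.ofFn fun ν => D ν ^ J ν).prod := by
  induction n with
  | zero => exact μ.elim0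
  | succ n ih =>
    rw [List.ofFn_succ, List.ofFn_succ, List.prod_cons, List.prod_cons]
    cases μ using Fin.cases with
    | zero =>
      simp only [MIdx.shift, Pi.add_apply, Pi.single_eq_same, pow_succ', mul_assoc,
        Pi.single_eq_of_ne (Fin.succ_ne_zero _), add_zero]
    | succ μ =>
      have h0 : J.shift μ.succ 0 = J 0 := by
        simp [MIdx.shift]
      have h1 : ∀ ν : Fin n, J.shift μ.succ ν.succ = MIdx.shift (fun κ => J κ.succ) μ ν := by
        intro ν
        simp [MIdx.shift, Pi.single_apply]
      have := ih (fun ν => D ν.succ) (fun _ _ => hD _ _) (fun κ => J κ.succ) μ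
      simp only [h0, h1, this]
      rw [← mul_assoc, ← mul_assoc, ((hD 0 μ.succ).pow_left _).eq]

theorem MIdx.induction {n : ℕ} {P : MIdx n → Prop} (zero : P 0)
    (shift : ∀ J μ, P J → P (J.shift μ)) (J : MIdx n) : P J := by
  induction h : J.order generalizing J with
  | zero =>
    have : J = 0 := funext fun μ => Finset.sum_eq_zero_iff.1 h μ (Finset.mem_univ μ)
    exact this ▸ zero
  | succ k ih =>
    obtain ⟨μ, hμ⟩ : ∃ μ, J μ ≠ 0 := by
      by_contra hc
      push Not at hc
      rw [MIdx.order, Finset.sum_eq_zero fun μ _ => hc μ] at h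
      omega
    have e : J = MIdx.shift (J - Pi.single μ 1) μ := by
      funext ν
      by_cases hν : ν = μ
      · subst hν; simp [MIdx.shift]; omega
      · simp [MIdx.shift, Pi.single_eq_of_ne hν]
    rw [e]
    refine shift _ _ (ih _ ?_)
    have h2 : J.order = MIdx.order (J - Pi.single μ 1) + 1 := by
      conv_lhs => rw [e]
      simp [MIdx.order, MIdx.shift, Finset.sum_add_distrib]
    omega

theorem formDs_zero : (formDs 0 : Module.End ℝ (Form n m q r)) = 1 := by
  simp [formDs]

theorem formDs_shift (J : MIdx n) (μ : Fin n) (a : Form n m q r) :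
    formDs (J.shift μ) a = formD μ (formDs J a) := by
  rw [formDs, prod_ofFn_pow_shift _ fun μ ν => LinearMap.ext fun a => formD_comm μ ν a]
  rfl

theorem totalDs_shift (J : MIdx n) (μ : Fin n) (f : LocFun n m) :
    totalDs (J.shift μ) f = totalD μ (totalDs J f) := by
  rw [totalDs, prod_ofFn_pow_shift _ fun μ ν => LinearMap.ext fun a => totalD_comm μ ν a]
  rfl

theorem formDs_ofFun (J : MIdx n) (f : LocFun n m) :
    formDs J (ofFun f : Form n m q r) = ofFun (totalDs J f) := by
  induction J using MIdx.induction with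
  | zero => simp [formDs, totalDs]
  | shift J μ ih => rw [formDs_shift, totalDs_shift, ih, formD_ofFun]

theorem formDs_formD (J : MIdx n) (μ : Fin n) (a : Form n m q r) :
    formDs J (formD μ a) = formD μ (formDs J a) := by
  induction J using MIdx.induction with
  | zero => simp [formDs_zero]
  | shift J ν ih => rw [formDs_shift, formDs_shift, ih, formD_comm]

end FormDerivatives

/-! ### Division of smooth functions by independent functions -/

section Division

open MeasureTheory

theorem hasFDerivAt_integral_of_contDiff {V E : Type} [NormedAddCommGroup V] [NormedSpace ℝ V]
    [FiniteDimensional ℝ V] [NormedAddCommGroup E] [NormedSpace ℝ E] {F : V × ℝ → E}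
    (hF : ContDiff ℝ 1 F) (v : V) :
    HasFDerivAt (fun v => ∫ t in (0 : ℝ)..1, F (v, t))
      (∫ t in (0 : ℝ)..1, (fderiv ℝ F (v, t)).comp (ContinuousLinearMap.inl ℝ V ℝ)) v := by
  have hc : Continuous fun z : V × ℝ =>
      (fderiv ℝ F z).comp (ContinuousLinearMap.inl ℝ V ℝ) :=
    (hF.continuous_fderiv (by simp)).clm_comp continuous_const
  obtain ⟨C, hC⟩ := ((isCompact_closedBall v 1).prod
    (isCompact_Icc (a := (0 : ℝ)) (b := 1))).exists_bound_of_continuousOn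
    hc.continuousOn
  have hFc := hF.continuous
  refine (intervalIntegral.hasFDerivAt_integral_of_dominated_of_fderiv_le (μ := volume)
    (F := fun v t => F (v, t))
    (F' := fun v t => (fderiv ℝ F (v, t)).comp (ContinuousLinearMap.inl ℝ V ℝ))
    (bound := fun _ => C) (Metric.ball_mem_nhds v one_pos) ?_ ?_ ?_ ?_ ?_ ?_)
  · exact Filter.Eventually.of_forall fun x => by
      exact (by fun_prop : Continuous fun t => F (x, t)).aestronglyMeasurable
  · exact (by fun_prop : Continuous fun t => F (v, t)).intervalIntegrable _ _
  · exact (hc.comp (by fun_prop : Continuous fun t : ℝ => (v, t))).aestronglyMeasurable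
  · refine Filter.Eventually.of_forall fun t ht x hx => hC (x, t) ⟨?_, ?_⟩
    · exact Metric.ball_subset_closedBall hx
    · rw [Set.uIoc_of_le zero_le_one] at ht
      exact ⟨ht.1.le, ht.2⟩
  · exact intervalIntegrable_const
  · refine Filter.Eventually.of_forall fun t ht x hx => ?_
    have h1 : HasFDerivAt F (fderiv ℝ F (x, t)) (x, t) :=
      (hF.differentiable (by simp)).differentiableAt.hasFDerivAt
    exact h1.comp x (hasFDerivAt_prodMk_left x t)

theorem contDiff_integral_nat (k : ℕ) {V E : Type} [NormedAddCommGroup V] [NormedSpace ℝ V]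
    [FiniteDimensional ℝ V] [NormedAddCommGroup E] [NormedSpace ℝ E] {F : V × ℝ → E}
    (hF : ContDiff ℝ ∞ F) : ContDiff ℝ k fun v => ∫ t in (0 : ℝ)..1, F (v, t) := by
  have h1 : ContDiff ℝ 1 F := hF.of_le (by simp)
  induction k generalizing E with
  | zero =>
    refine contDiff_zero.2 (continuous_iff_continuousAt.2 fun v => ?_)
    exact (hasFDerivAt_integral_of_contDiff h1 v).continuousAt
  | succ k ih =>
    push_cast
    rw [contDiff_succ_iff_fderiv]
    refine ⟨fun v => (hasFDerivAt_integral_of_contDiff h1 v).differentiableAt, by simp, ?_⟩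
    have hd : ContDiff ℝ ∞ fun z : V × ℝ =>
        (fderiv ℝ F z).comp (ContinuousLinearMap.inl ℝ V ℝ) :=
      (hF.fderiv_right (m := ∞) (by simp)).clm_comp contDiff_const
    convert ih hd (hd.of_le (by simp)) using 1
    funext v
    exact (hasFDerivAt_integral_of_contDiff h1 v).fderiv

/-- Integrals of smooth functions depend smoothly on parameters. -/
theorem contDiff_integral {V E : Type} [NormedAddCommGroup V] [NormedSpace ℝ V]
    [FiniteDimensional ℝ V] [NormedAddCommGroup E] [NormedSpace ℝ E] {F : V × ℝ → E}
    (hF : ContDiff ℝ ∞ F) : ContDiff ℝ ∞ fun v => ∫ t in (0 : ℝ)..1, F (v, t) :=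
  contDiff_infty.2 fun k => contDiff_integral_nat k hF

/-- Hadamard's lemma: a smooth function of `(y, z)` that vanishes if only `z` and one of the
components of `y` are nonzero is a combination of the other components of `y`. -/
theorem hadamard {ι K : Type} [Fintype ι] [DecidableEq ι] [NormedAddCommGroup K] [NormedSpace ℝ K]
    [FiniteDimensional ℝ K] {G : (ι → ℝ) × K → ℝ} (hG : ContDiff ℝ ∞ G) (k : ι)
    (h0 : ∀ s z, G (Pi.single k s, z) = 0) :
    ∃ H : ι → (ι → ℝ) × K → ℝ, (∀ i, ContDiff ℝ ∞ (H i)) ∧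
      ∀ y, G y = ∑ i ∈ Finset.univ.erase k, y.1 i * H i y := by
  -- integrate the derivative of `G` along the segment from `A y` to `y`, where `A y` has, among the
  -- first components, only that of index `k`
  let A : (ι → ℝ) × K → (ι → ℝ) × K := fun y => (Pi.single k (y.1 k), y.2)
  have hA : ContDiff ℝ ∞ A := by
    refine ContDiff.prodMk (contDiff_pi.2 fun i => ?_) contDiff_snd
    by_cases h : i = k
    · subst h
      simp only [Pi.single_eq_same]
      exact (contDiff_apply ℝ ℝ i).comp contDiff_fst
    · simpa [Pi.single_eq_of_ne h] using contDiff_const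
  let γ : ((ι → ℝ) × K) × ℝ → (ι → ℝ) × K := fun p => A p.1 + p.2 • (p.1 - A p.1)
  have hγ : ContDiff ℝ ∞ γ := (hA.comp contDiff_fst).add
    (contDiff_snd.smul (contDiff_fst.sub (hA.comp contDiff_fst)))
  have hdG : ContDiff ℝ ∞ (fderiv ℝ G) := hG.fderiv_right (by simp)
  refine ⟨fun i y => ∫ t in (0 : ℝ)..1, fderiv ℝ G (γ (y, t)) (Pi.single i 1, 0), fun i => ?_,
    fun y => ?_⟩
  · exact contDiff_integral (F := fun p => fderiv ℝ G (γ p) (Pi.single i 1, 0))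
      ((hdG.comp hγ).clm_apply contDiff_const)
  · have hd : ∀ t : ℝ, HasDerivAt (fun t => G (γ (y, t))) (fderiv ℝ G (γ (y, t)) (y - A y)) t := by
      intro t
      have h1 : HasFDerivAt G (fderiv ℝ G (γ (y, t))) (γ (y, t)) :=
        (hG.differentiable (by simp)).differentiableAt.hasFDerivAt
      refine h1.comp_hasDerivAt t ?_
      have h5 := ((hasDerivAt_id t).smul_const (y - A y)).const_add (A y)
      rw [one_smul] at h5
      exact h5
    have hci : ∀ v, Continuous fun t => fderiv ℝ G (γ (y, t)) v := fun v =>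
      ((hdG.comp (hγ.comp (contDiff_const.prodMk contDiff_id))).clm_apply
        contDiff_const).continuous
    have h2 := intervalIntegral.integral_eq_sub_of_hasDerivAt (fun t _ => hd t)
      ((hci _).intervalIntegrable 0 1)
    have e1 : γ (y, 1) = y := by simp [γ]
    have e0 : G (γ (y, 0)) = 0 := by simpa [γ, A] using h0 (y.1 k) y.2
    rw [e1, e0, sub_zero] at h2
    rw [← h2]
    have e : y - A y = ∑ i ∈ Finset.univ.erase k, y.1 i • ((Pi.single i 1, 0) : (ι → ℝ) × K) := by
      refine Prod.ext ?_ ?_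
      · funext j
        rw [Prod.fst_sum, Finset.sum_apply]
        simp only [Prod.smul_fst, Pi.smul_apply, Pi.single_apply, smul_eq_mul, mul_ite, mul_one,
          mul_zero, Prod.fst_sub, Pi.sub_apply, A]
        rw [Finset.sum_ite_eq]
        by_cases h : j = k <;> simp [h]
      · rw [Prod.snd_sum]
        simp [A]
    simp only [e, map_sum, map_smul, smul_eq_mul]
    rw [intervalIntegral.integral_finsetSum]
    · simp only [intervalIntegral.integral_const_mul]
    · intro i _
      exact ((hci _).const_mul _).intervalIntegrable 0 1

/-- Let `f i` be functions with independent differentials at `x₀`, and let `g` be a function that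
vanishes at the points where all the `f i` with `i ≠ k` vanish but `f k` does not. Then near `x₀`
the function `g` lies in the ideal generated by the `f i` with `i ≠ k`. -/
theorem exists_mul_mem_ideal {X ι : Type} [NormedAddCommGroup X] [NormedSpace ℝ X]
    [FiniteDimensional ℝ X] [Fintype ι] [DecidableEq ι] {f : ι → X → ℝ}
    (hf : ∀ i, ContDiff ℝ ∞ (f i)) {x₀ : X}
    (hind : LinearIndependent ℝ fun i => fderiv ℝ (f i) x₀) (k : ι) {g : X → ℝ}
    (hg : ContDiff ℝ ∞ g) (hgf : ∀ x, (∀ i, i ≠ k → f i x = 0) → f k x ≠ 0 → g x = 0) :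
    ∃ χ : X → ℝ, ContDiff ℝ ∞ χ ∧ χ x₀ ≠ 0 ∧ ∃ h : ι → X → ℝ, (∀ i, ContDiff ℝ ∞ (h i)) ∧
      ∀ x, χ x * g x = ∑ i ∈ Finset.univ.erase k, f i x * h i x := by
  let F : X → ι → ℝ := fun x i => f i x
  have hF : ContDiff ℝ ∞ F := contDiff_pi.2 hf
  set F' : X →L[ℝ] ι → ℝ := fderiv ℝ F x₀ with hF'
  have hF'i : ∀ i v, F' v i = fderiv ℝ (f i) x₀ v := fun i v => by
    rw [hF', fderiv_pi fun i => ((hf i).differentiable (by simp)).differentiableAt]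
    rfl
  have hsurj : F'.range = ⊤ := by
    by_contra hne
    obtain ⟨φ, hφ, hle⟩ := Submodule.exists_le_ker_of_lt_top _ (lt_top_iff_ne_top.2 hne)
    refine hφ ?_
    have h1 : ∑ i, φ (Pi.single i 1) • fderiv ℝ (f i) x₀ = 0 := by
      ext v
      have h2 : φ (F' v) = 0 := hle ⟨v, rfl⟩
      rw [LinearMap.pi_apply_eq_sum_univ φ] at h2
      simp only [sum_apply, smul_apply, smul_eq_mul,
        zero_apply]
      rw [← h2]
      refine Finset.sum_congr rfl fun i _ => ?_
      rw [hF'i, smul_eq_mul, mul_comm]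
      congr 2
      funext j
      simp [Pi.single_apply, eq_comm]
    have h3 := Fintype.linearIndependent_iff.1 hind _ h1
    refine LinearMap.pi_ext' fun i => LinearMap.ext_ring ?_
    simpa using h3 i
  -- the `f i`, completed by a projection `π` to the kernel of their differentials, are coordinates
  -- `Φ` near `x₀`
  let K := F'.ker
  obtain ⟨π, hπ⟩ : ∃ π : X →L[ℝ] K, ∀ x : K, π x = x := by
    obtain ⟨π, hπ⟩ := Submodule.ClosedComplemented.of_finiteDimensional K
    exact ⟨π, hπ⟩
  let Φ : X → (ι → ℝ) × K := fun x => (F x, π x)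
  have hΦ : ContDiff ℝ ∞ Φ := hF.prodMk π.contDiff
  have hΦ' : HasFDerivAt Φ (F'.prod π) x₀ :=
    (hF.differentiable (by simp)).differentiableAt.hasFDerivAt.prodMk π.hasFDerivAt
  have hbij : Function.Bijective (F'.prod π) := by
    constructor
    · rw [injective_iff_map_eq_zero]
      intro v hv
      have hv1 : F' v = 0 := congrArg Prod.fst hv
      have hv2 : π v = 0 := congrArg Prod.snd hv
      have := hπ ⟨v, hv1⟩
      rw [hv2] at this
      exact congrArg Subtype.val this.symm
    · rintro ⟨y, z⟩
      obtain ⟨v, hv⟩ : ∃ v, F' v = y := LinearMap.range_eq_top.1 hsurj y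
      refine ⟨v - π v + z, Prod.ext ?_ ?_⟩
      · have h1 : F' (π v) = 0 := (π v).2
        have h2 : F' z = 0 := z.2
        simp [hv, h1, h2]
      · simp [hπ]
  let Φ' : X ≃L[ℝ] (ι → ℝ) × K := ContinuousLinearEquiv.ofBijective (F'.prod π)
    (LinearMap.ker_eq_bot.2 hbij.1) (LinearMap.range_eq_top.2 hbij.2)
  have hΦ'' : HasFDerivAt Φ (Φ' : X →L[ℝ] (ι → ℝ) × K) x₀ := by
    convert hΦ' using 1
    exact ContinuousLinearMap.ext fun _ => rfl
  let e := (hΦ.contDiffAt (x := x₀)).toOpenPartialHomeomorph Φ hΦ'' (by simp)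
  have hx₀ : x₀ ∈ e.source :=
    (hΦ.contDiffAt (x := x₀)).mem_toOpenPartialHomeomorph_source hΦ'' (by simp)
  have he : ∀ x, e x = Φ x := fun x => rfl
  -- the inverse of the chart is smooth where the differential of `Φ` is invertible
  have hopen : IsOpen {x | fderiv ℝ Φ x ∈ Set.range
      ((↑) : (X ≃L[ℝ] (ι → ℝ) × K) → X →L[ℝ] (ι → ℝ) × K)} :=
    ContinuousLinearEquiv.isOpen.preimage (hΦ.continuous_fderiv (by simp))
  set N := {x | fderiv ℝ Φ x ∈ Set.range
      ((↑) : (X ≃L[ℝ] (ι → ℝ) × K) → X →L[ℝ] (ι → ℝ) × K)} with hN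
  have hx₀N : x₀ ∈ N := ⟨Φ', hΦ''.fderiv.symm⟩
  let W := e.target ∩ e.symm ⁻¹' N
  have hW : IsOpen W := e.isOpen_inter_preimage_symm hopen
  have hWsymm : ∀ y ∈ W, ContDiffAt ℝ ∞ e.symm y := by
    rintro y ⟨hy1, A, hA⟩
    refine e.contDiffAt_symm (f₀' := A) hy1 ?_ hΦ.contDiffAt
    rw [hA]
    exact (hΦ.differentiable (by simp)).differentiableAt.hasFDerivAt
  have hy₀ : Φ x₀ ∈ W := by
    refine ⟨e.map_source hx₀, ?_⟩
    change e.symm (e x₀) ∈ N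
    rwa [e.left_inv hx₀]
  -- a cutoff makes of `g`, in these coordinates, a smooth function on the whole space
  obtain ⟨ρ, hρs, -, hρ, -, hρ1⟩ := exists_contDiff_tsupport_subset (n := ⊤) (hW.mem_nhds hy₀)
  let G : (ι → ℝ) × K → ℝ := fun y => ρ y * g (e.symm y)
  have hG : ContDiff ℝ ∞ G := by
    refine contDiff_iff_contDiffAt.2 fun y => ?_
    by_cases hy : y ∈ tsupport ρ
    · exact hρ.contDiffAt.mul (hg.contDiffAt.comp y (hWsymm y (hρs hy)))
    · refine (contDiffAt_const (c := (0 : ℝ))).congr_of_eventuallyEq ?_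
      have := notMem_tsupport_iff_eventuallyEq.1 hy
      filter_upwards [this] with z hz
      simp [G, hz]
  have hG1 : ∀ s z, s ≠ 0 → G (Pi.single k s, z) = 0 := by
    intro s z hs
    by_cases hy : (Pi.single k s, z) ∈ tsupport ρ
    · have hy' := (hρs hy).1
      have h1 : Φ (e.symm (Pi.single k s, z)) = (Pi.single k s, z) := e.right_inv hy'
      have h2 : F (e.symm (Pi.single k s, z)) = Pi.single k s := congrArg Prod.fst h1
      have h3 : ∀ i, f i (e.symm (Pi.single k s, z)) = (Pi.single k s : ι → ℝ) i :=
        fun i => congrFun h2 i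
      have := hgf (e.symm (Pi.single k s, z))
        (fun i hi => by rw [h3, Pi.single_eq_of_ne hi]) (by rw [h3, Pi.single_eq_same]; exact hs)
      simp [G, this]
    · have : ρ (Pi.single k s, z) = 0 := image_eq_zero_of_notMem_tsupport hy
      simp [G, this]
  -- the condition `f k ≠ 0` is removed by continuity
  have hG0 : ∀ s z, G (Pi.single k s, z) = 0 := by
    intro s z
    have hcont : Continuous fun s : ℝ => G (Pi.single k s, z) :=
      hG.continuous.comp (by
        refine Continuous.prodMk (continuous_pi fun i => ?_) continuous_const
        by_cases h : i = k
        · subst h; simp only [Pi.single_eq_same]; exact continuous_id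
        · simpa [Pi.single_eq_of_ne h] using continuous_const)
    have hd : Dense {s : ℝ | s ≠ 0} := dense_compl_singleton 0
    exact congrFun (hcont.ext_on hd continuous_const fun s hs => hG1 s z hs) s
  obtain ⟨H, hH, hGH⟩ := hadamard hG k hG0
  -- away from `x₀` the map `Φ` need not be injective, whence a second cutoff
  obtain ⟨ψ, hψs, -, hψ, -, hψ1⟩ := exists_contDiff_tsupport_subset (n := ⊤)
    (e.open_source.mem_nhds hx₀)
  refine ⟨fun x => ψ x * ρ (Φ x), hψ.mul (hρ.comp hΦ), by simp [hψ1, hρ1],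
    fun i x => ψ x * H i (Φ x), fun i => hψ.mul ((hH i).comp hΦ), fun x => ?_⟩
  by_cases hx : x ∈ e.source
  · have h1 : e.symm (Φ x) = x := e.left_inv hx
    have h2 := hGH (Φ x)
    simp only [G, h1] at h2
    rw [mul_assoc, h2, Finset.mul_sum]
    refine Finset.sum_congr rfl fun i _ => ?_
    simp only [Φ, F]
    ring
  · have : ψ x = 0 := image_eq_zero_of_notMem_tsupport fun h => hx (hψs h)
    simp [this]

end Division

section LocalDivision

variable {n m : ℕ}

/-- The jet with given coordinates in `T` and other coordinates zero. -/
def extendJet (T : Finset (Coord n m)) (x : T → ℝ) : Jet n m := by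
  classical
  exact fun c => if h : c ∈ T then x ⟨c, h⟩ else 0

/-- The local function given by a smooth function of finitely many coordinates. -/
def LocFun.ofSmooth {T : Finset (Coord n m)} {g : (T → ℝ) → ℝ} (hg : ContDiff ℝ ∞ g) :
    LocFun n m :=
  ⟨fun u => g fun c => u c, T, g, hg, fun _ => rfl⟩

theorem LocFun.eval_ofSmooth {T : Finset (Coord n m)} {g : (T → ℝ) → ℝ} (hg : ContDiff ℝ ∞ g)
    (u : Jet n m) : (LocFun.ofSmooth hg).eval u = g fun c => u c :=
  rfl

theorem LocFun.contDiff_eval_extendJet (f : LocFun n m) (T : Finset (Coord n m)) :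
    ContDiff ℝ ∞ fun x => f.eval (extendJet T x) := by
  obtain ⟨S, g, hg, hfg⟩ := f.2
  have : (fun x => f.eval (extendJet T x)) = fun x => g fun c => extendJet T x c :=
    funext fun x => hfg _
  rw [this]
  refine hg.comp (contDiff_pi.2 fun c => ?_)
  by_cases h : (c : Coord n m) ∈ T
  · simp only [extendJet, dif_pos h]
    exact contDiff_apply ℝ ℝ _
  · simp only [extendJet, dif_neg h]
    exact contDiff_const

/-- Finitely many local functions depend on finitely many coordinates. -/
theorem exists_common_coords {ι : Type*} [Finite ι] (f : ι → LocFun n m) :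
    ∃ T : Finset (Coord n m), ∀ i u, (f i).eval (extendJet T fun c => u c) = (f i).eval u := by
  classical
  have := Fintype.ofFinite ι
  choose S g hg hfg using fun i => (f i).2
  refine ⟨Finset.univ.biUnion S, fun i u => ?_⟩
  refine (hfg i _).trans (Eq.trans ?_ (hfg i u).symm)
  congr 1
  funext c
  have : (c : Coord n m) ∈ Finset.univ.biUnion S :=
    Finset.mem_biUnion.2 ⟨i, Finset.mem_univ i, c.2⟩
  simp [extendJet, this]

/-- If local functions `f i` have independent differentials at the jet `u`, then near `u` the
function `f k` is not a zero divisor modulo the ideal generated by the others. -/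
theorem LocFun.exists_mul_mem_ideal {ι : Type} [Fintype ι] [DecidableEq ι] {f : ι → LocFun n m}
    {u : Jet n m} (hind : LinearIndependent ℝ fun (i : ι) (c : Coord n m) => (pd c (f i)).eval u)
    (k : ι) {g : LocFun n m} {h : ι → LocFun n m}
    (hgf : f k * g = ∑ i ∈ Finset.univ.erase k, f i * h i) :
    ∃ χ : LocFun n m, χ.eval u ≠ 0 ∧ ∃ h' : ι → LocFun n m,
      χ * g = ∑ i ∈ Finset.univ.erase k, f i * h' i := by
  obtain ⟨T, hT⟩ := exists_common_coords fun o : Option ι => o.elim g f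
  have hTf : ∀ i u, (f i).eval u = (f i).eval (extendJet T fun c => u c) :=
    fun i u => (hT (some i) u).symm
  have hTg : ∀ u, g.eval u = g.eval (extendJet T fun c => u c) := fun u => (hT none u).symm
  have hsm : ∀ i, ContDiff ℝ ∞ fun x => (f i).eval (extendJet T x) :=
    fun i => (f i).contDiff_eval_extendJet T
  have hind' : LinearIndependent ℝ
      fun i => fderiv ℝ (fun x => (f i).eval (extendJet T x)) (fun c => u c) := by
    rw [Fintype.linearIndependent_iff] at hind ⊢
    intro a ha
    refine hind a (funext fun c => ?_)
    rw [Finset.sum_apply]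
    simp only [Pi.smul_apply, smul_eq_mul, Pi.zero_apply]
    by_cases hc : c ∈ T
    · have := congrArg (fun L => L (Pi.single ⟨c, hc⟩ 1)) ha
      simp only [sum_apply, smul_apply, smul_eq_mul, zero_apply] at this
      rw [← this]
      exact Finset.sum_congr rfl fun i _ => by rw [pd_eval_of_mem (hsm i) (hTf i) hc]
    · refine Finset.sum_eq_zero fun i _ => ?_
      rw [pd_eq_zero_of_notMem (g := fun x => (f i).eval (extendJet T x)) (hTf i) hc,
        LocFun.eval_zero, mul_zero]
  -- at the zeros of the `f i` with `i ≠ k` the relation reads `f k * g = 0`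
  obtain ⟨χ, hχ, hχ0, h', hh', H⟩ := LocalBRST.exists_mul_mem_ideal hsm hind' k
    (g.contDiff_eval_extendJet T) (fun x hx hk => by
      have h1 := congrArg (fun F => LocFun.eval F (extendJet T x)) hgf
      simp only [LocFun.eval_mul, LocFun.eval_sum] at h1
      rw [Finset.sum_eq_zero] at h1
      · exact (mul_eq_zero.1 h1).resolve_left hk
      · intro i hi
        rw [hx i (Finset.ne_of_mem_erase hi), zero_mul])
  refine ⟨LocFun.ofSmooth hχ, hχ0, fun i => LocFun.ofSmooth (hh' i), ?_⟩
  ext v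
  simp only [LocFun.eval_mul, LocFun.eval_sum, LocFun.eval_ofSmooth]
  rw [hTg, H]
  exact Finset.sum_congr rfl fun i _ => by rw [hTf i v]

open scoped Manifold in
/-- A finite system of linear equations over the local functions has a solution if it has one, up
to a local function that does not vanish at the point, around each point of jet space. -/
theorem exists_solution_of_local {κ ι : Type} [Finite κ] [Fintype ι] (A : κ → ι → LocFun n m)
    (a : κ → LocFun n m)
    (H : ∀ u, ∃ χ : LocFun n m, χ.eval u ≠ 0 ∧ ∃ b : ι → LocFun n m,
      ∀ i, χ * a i = ∑ j, A i j * b j) :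
    ∃ b : ι → LocFun n m, ∀ i, a i = ∑ j, A i j * b j := by
  obtain ⟨T, hT⟩ := exists_common_coords fun o : κ ⊕ κ × ι => o.elim a fun x => A x.1 x.2
  have hTa : ∀ i u, (a i).eval (extendJet T fun c => u c) = (a i).eval u := fun i => hT (.inl i)
  have hTA : ∀ i j u, (A i j).eval (extendJet T fun c => u c) = (A i j).eval u :=
    fun i j => hT (.inr (i, j))
  -- the solutions at a point form a convex set, so that a partition of unity glues local solutions
  let t : (T → ℝ) → Set (ι → ℝ) := fun x =>
    {b | ∀ i, (a i).eval (extendJet T x) = ∑ j, (A i j).eval (extendJet T x) * b j}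
  have ht : ∀ x, Convex ℝ (t x) := by
    intro x b hb b' hb' p q _ _ hpq i
    simp only [Pi.add_apply, Pi.smul_apply, smul_eq_mul, mul_add, Finset.sum_add_distrib]
    have e1 : ∑ j, (A i j).eval (extendJet T x) * (p * b j) =
        p * ∑ j, (A i j).eval (extendJet T x) * b j := by
      rw [Finset.mul_sum]; exact Finset.sum_congr rfl fun j _ => by ring
    have e2 : ∑ j, (A i j).eval (extendJet T x) * (q * b' j) =
        q * ∑ j, (A i j).eval (extendJet T x) * b' j := by
      rw [Finset.mul_sum]; exact Finset.sum_congr rfl fun j _ => by ring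
    rw [e1, e2, ← hb i, ← hb' i, ← add_mul, hpq, one_mul]
  obtain ⟨b, hb⟩ := exists_contMDiffMap_forall_mem_convex_of_local (n := ⊤) 𝓘(ℝ, T → ℝ) ht
    (fun x => by
      obtain ⟨χ, hχ, b, hb⟩ := H (extendJet T x)
      have hχs := χ.contDiff_eval_extendJet T
      refine ⟨{y | χ.eval (extendJet T y) ≠ 0},
        (isOpen_ne_fun hχs.continuous continuous_const).mem_nhds hχ,
        fun y j => (b j).eval (extendJet T y) / χ.eval (extendJet T y), ?_, ?_⟩
      · refine ContDiffOn.contMDiffOn (contDiffOn_pi.2 fun j => ?_)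
        exact ((b j).contDiff_eval_extendJet T).contDiffOn.div hχs.contDiffOn fun y hy => hy
      · intro y hy i
        have h1 := congrArg (fun F => LocFun.eval F (extendJet T y)) (hb i)
        simp only [LocFun.eval_mul, LocFun.eval_sum] at h1
        simp only [mul_div_assoc']
        rw [← Finset.sum_div, ← h1, mul_div_cancel_left₀ _ hy])
  have hbs : ContDiff ℝ ∞ b := b.contMDiff.contDiff
  refine ⟨fun j => LocFun.ofSmooth (contDiff_pi.1 hbs j), fun i => ?_⟩
  ext v
  have := hb (fun c => v c) i
  rw [hTa] at this
  simp only [LocFun.eval_mul, LocFun.eval_sum, LocFun.eval_ofSmooth]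
  rw [this]
  exact Finset.sum_congr rfl fun j _ => by rw [hTA]

end LocalDivision

/-! ### Weights of monomials -/

section Weights

variable {n m q r : ℕ} {R : Type*} [CommSemiring R]

/-- The weight of a monomial, for given weights of the generators. -/
def Mono.weight (wo : OddGen n m q r → R) (we : EvenGen n q r → R) (M : Mono n m q r) : R :=
  ∑ g ∈ M.odd, wo g + M.even.sum fun g e => e * we g

variable (wo : OddGen n m q r → R) (we : EvenGen n q r → R)

theorem Mono.antigh_eq_weight (M : Mono n m q r) :
    M.antigh = M.weight OddGen.antigh EvenGen.antigh := rfl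

theorem Mono.puregh_eq_weight (M : Mono n m q r) :
    M.puregh = M.weight OddGen.puregh EvenGen.puregh := rfl

theorem Mono.formDeg_eq_weight (M : Mono n m q r) :
    M.formDeg = M.weight OddGen.formDeg 0 := by
  simp [Mono.weight, Mono.formDeg, Finsupp.sum]

theorem Mono.weight_mul {M N : Mono n m q r} (h : Disjoint M.odd N.odd) :
    Mono.weight wo we ⟨M.odd ∪ N.odd, M.even + N.even⟩ = M.weight wo we + N.weight wo we := by
  classical
  simp only [Mono.weight]
  rw [Finset.sum_union h, Finsupp.sum_add_index (by simp) (by intros; push_cast; ring)]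
  ring

theorem Mono.weight_erase {M : Mono n m q r} {g : OddGen n m q r} (hg : g ∈ M.odd) :
    Mono.weight wo we ⟨M.odd.erase g, M.even⟩ + wo g = M.weight wo we := by
  simp only [Mono.weight]
  rw [← Finset.sum_erase_add _ _ hg]
  ring

theorem Mono.weight_sub {M : Mono n m q r} {g : EvenGen n q r} (hg : g ∈ M.even.support) :
    Mono.weight wo we ⟨M.odd, M.even - Finsupp.single g 1⟩ + we g = M.weight wo we := by
  classical
  simp only [Mono.weight]
  have h1 : M.even = (M.even - Finsupp.single g 1) + Finsupp.single g 1 := by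
    refine (tsub_add_cancel_of_le (Finsupp.single_le_iff.2 ?_)).symm
    exact Nat.one_le_iff_ne_zero.2 (Finsupp.mem_support_iff.1 hg)
  conv_rhs => rw [h1]
  rw [Finsupp.sum_add_index (by simp) (by intros; push_cast; ring), Finsupp.sum_single_index (by simp)]
  push_cast
  ring

theorem weight_oddMono (g : OddGen n m q r) : (oddMono g).weight wo we = wo g := by
  simp [Mono.weight, oddMono]

theorem weight_evenMono (g : EvenGen n q r) :
    (evenMono g : Mono n m q r).weight wo we = we g := by
  simp [Mono.weight, evenMono]

/-- The monomials which are products of generators subject to given conditions. -/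
def Mono.Uses (P : OddGen n m q r → Prop) (Q : EvenGen n q r → Prop) (M : Mono n m q r) : Prop :=
  (∀ g ∈ M.odd, P g) ∧ ∀ g ∈ M.even.support, Q g

variable {P : OddGen n m q r → Prop} {Q : EvenGen n q r → Prop}

theorem Mono.Uses.mul {M N : Mono n m q r} (hM : M.Uses P Q) (hN : N.Uses P Q) :
    Mono.Uses P Q ⟨M.odd ∪ N.odd, M.even + N.even⟩ := by
  classical
  refine ⟨fun g hg => ?_, fun g hg => ?_⟩
  · rcases Finset.mem_union.1 hg with h | h
    exacts [hM.1 g h, hN.1 g h]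
  · rcases Finset.mem_union.1 (Finsupp.support_add hg) with h | h
    exacts [hM.2 g h, hN.2 g h]

theorem Mono.Uses.erase {M : Mono n m q r} (hM : M.Uses P Q) (g : OddGen n m q r) :
    Mono.Uses P Q ⟨M.odd.erase g, M.even⟩ :=
  ⟨fun h hh => hM.1 h (Finset.mem_of_mem_erase hh), hM.2⟩

theorem Mono.Uses.sub {M : Mono n m q r} (hM : M.Uses P Q) (E : EvenGen n q r →₀ ℕ) :
    Mono.Uses P Q ⟨M.odd, M.even - E⟩ := by
  refine ⟨hM.1, fun g hg => hM.2 g ?_⟩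
  simp only [Finsupp.mem_support_iff, Finsupp.tsub_apply] at hg ⊢
  omega

theorem uses_oddMono {g : OddGen n m q r} (hg : P g) : (oddMono g).Uses P Q := by
  refine ⟨fun h hh => ?_, fun h hh => ?_⟩
  · rw [oddMono, Finset.mem_singleton] at hh
    exact hh ▸ hg
  · simp [oddMono] at hh

theorem uses_evenMono {g : EvenGen n q r} (hg : Q g) : (evenMono g : Mono n m q r).Uses P Q := by
  classical
  refine ⟨fun h hh => ?_, fun h hh => ?_⟩
  · simp [evenMono] at hh
  · have := Finsupp.support_single_subset hh
    rw [Finset.mem_singleton] at this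
    exact this ▸ hg

variable (n m q r) in
/-- The local forms supported on a set of monomials, as a module over the local functions. -/
abbrev formsOn (S : Set (Mono n m q r)) : Submodule (LocFun n m) (Form n m q r) :=
  Finsupp.supported (LocFun n m) (LocFun n m) S

theorem single_mem_formsOn {S : Set (Mono n m q r)} {M : Mono n m q r} (hM : M ∈ S)
    (f : LocFun n m) : Finsupp.single M f ∈ formsOn n m q r S :=
  Finsupp.single_mem_supported _ _ hM

theorem formsOn_mono {S S' : Set (Mono n m q r)} (h : S ⊆ S') :
    formsOn n m q r S ≤ formsOn n m q r S' :=
  Finsupp.supported_mono h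

theorem mem_formsOn {S : Set (Mono n m q r)} {a : Form n m q r} :
    a ∈ formsOn n m q r S ↔ ∀ M, a M ≠ 0 → M ∈ S :=
  ⟨fun h _ hM => h (Finset.mem_coe.2 (Finsupp.mem_support_iff.2 hM)),
    fun h M hM => h M (Finsupp.mem_support_iff.1 (Finset.mem_coe.1 hM))⟩

theorem real_smul_mem_formsOn {S : Set (Mono n m q r)} {a : Form n m q r}
    (ha : a ∈ formsOn n m q r S) (t : ℝ) : t • a ∈ formsOn n m q r S := by
  rw [← algebraMap_smul (LocFun n m)]
  exact Submodule.smul_mem _ _ ha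

/-- A linear map of local forms maps forms on `S` to forms on `S'` if it does so for monomials. -/
theorem map_mem_formsOn {S S' : Set (Mono n m q r)} {X : Form n m q r →+ Form n m q r}
    (h : ∀ M ∈ S, ∀ f, X (Finsupp.single M f) ∈ formsOn n m q r S') {a : Form n m q r}
    (ha : a ∈ formsOn n m q r S) : X a ∈ formsOn n m q r S' :=
  supported_induction (P := fun a => X a ∈ formsOn n m q r S') (by simp)
    (fun x y hx hy => by rw [map_add]; exact add_mem hx hy) h a ha

variable (n m q r) in
/-- The algebra generated, over the local functions, by the generators subject to given
conditions. -/
abbrev genAlg (P : OddGen n m q r → Prop) (Q : EvenGen n q r → Prop) :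
    Submodule (LocFun n m) (Form n m q r) :=
  formsOn n m q r {M | M.Uses P Q}

theorem wedge_mem_genAlg {a b : Form n m q r} (ha : a ∈ genAlg n m q r P Q)
    (hb : b ∈ genAlg n m q r P Q) : wedge a b ∈ genAlg n m q r P Q :=
  wedge_mem_supported (fun _ hM _ hN _ => Mono.Uses.mul hM hN) ha hb

theorem rightDer_single_mem {S : Set (Mono n m q r)} {vo : OddGen n m q r → Form n m q r}
    {ve : EvenGen n q r → Form n m q r} {M : Mono n m q r}
    (ho : ∀ g ∈ M.odd, ∀ f, wedge (Finsupp.single ⟨M.odd.erase g, M.even⟩ f) (vo g) ∈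
      formsOn n m q r S)
    (he : ∀ g ∈ M.even.support, ∀ f,
      wedge (Finsupp.single ⟨M.odd, M.even - Finsupp.single g 1⟩ f) (ve g) ∈ formsOn n m q r S)
    (f : LocFun n m) : rightDer vo ve (Finsupp.single M f) ∈ formsOn n m q r S := by
  rw [rightDer_single]
  exact add_mem (sum_mem fun g hg => zsmul_mem (ho g hg f) _)
    (sum_mem fun g hg => nsmul_mem (he g hg f) _)

theorem rightDer_mem_genAlg {vo : OddGen n m q r → Form n m q r}
    {ve : EvenGen n q r → Form n m q r} (ho : ∀ g, P g → vo g ∈ genAlg n m q r P Q)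
    (he : ∀ g, Q g → ve g ∈ genAlg n m q r P Q) {a : Form n m q r}
    (ha : a ∈ genAlg n m q r P Q) : rightDer vo ve a ∈ genAlg n m q r P Q := by
  refine map_mem_formsOn (X := (rightDer vo ve).toAddMonoidHom) (fun M hM f => ?_) ha
  refine rightDer_single_mem (fun g hg f => ?_) (fun g hg f => ?_) f
  · exact wedge_mem_genAlg (single_mem_formsOn (Mono.Uses.erase hM g) f) (ho g (hM.1 g hg))
  · exact wedge_mem_genAlg (single_mem_formsOn (Mono.Uses.sub hM _) f) (he g (hM.2 g hg))

theorem rightDer_add (vo vo' : OddGen n m q r → Form n m q r)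
    (ve ve' : EvenGen n q r → Form n m q r) (a : Form n m q r) :
    rightDer (fun g => vo g + vo' g) (fun g => ve g + ve' g) a =
      rightDer vo ve a + rightDer vo' ve' a := by
  induction a using Finsupp.induction_linear with
  | zero => simp
  | add x y hx hy => simp only [map_add, hx, hy]; abel
  | single M f =>
    simp only [rightDer_single, wedge_add_right, smul_add, Finset.sum_add_distrib]
    abel

/-- The derivations that are diagonal on the generators are diagonal on the monomials. -/
theorem rightDer_diagonal (co : OddGen n m q r → LocFun n m) (ce : EvenGen n q r → LocFun n m)
    (M : Mono n m q r) (f : LocFun n m) :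
    rightDer (fun g => co g • oddGen g) (fun g => ce g • evenGen g) (Finsupp.single M f) =
      M.weight co ce • Finsupp.single M f := by
  rw [rightDer_single, Mono.weight, add_smul, Finset.sum_smul, Finsupp.sum, Finset.sum_smul]
  congr 1
  · refine Finset.sum_congr rfl fun g hg => ?_
    have e : ((M.odd.erase g).filter fun h => g < h) = M.odd.filter fun h => g < h := by
      ext h
      simp only [Finset.mem_filter, Finset.mem_erase]
      exact ⟨fun ⟨⟨_, h1⟩, h2⟩ => ⟨h1, h2⟩, fun ⟨h1, h2⟩ => ⟨⟨h2.ne', h1⟩, h2⟩⟩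
    rw [wedge_smul_right, single_wedge_oddGen_of_notMem (M := ⟨M.odd.erase g, M.even⟩) f
      (Finset.notMem_erase g M.odd), smul_comm, smul_smul]
    simp only [e, Finset.insert_erase hg]
    rw [← mul_pow]
    simp
  · refine Finset.sum_congr rfl fun g hg => ?_
    rw [wedge_smul_right, single_wedge_evenGen, mul_smul]
    have : M.even - Finsupp.single g 1 + Finsupp.single g 1 = M.even := by
      refine tsub_add_cancel_of_le (Finsupp.single_le_iff.2 ?_)
      exact Nat.one_le_iff_ne_zero.2 (Finsupp.mem_support_iff.1 hg)
    simp only [this, Nat.cast_smul_eq_nsmul]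

/-- A right derivation that annihilates the local functions is given by its values on the
generators. -/
theorem IsRightDer.eq_rightDer {ε : ℕ} {X : Form n m q r →ₗ[ℝ] Form n m q r}
    (hX : IsRightDer ε X) (h0 : ∀ f, X (ofFun f) = 0) (a : Form n m q r) :
    X a = rightDer (fun g => X (LocalBRST.oddGen g)) (fun g => X (LocalBRST.evenGen g)) a := by
  have h := isRightDer_rightDer (ε := ε) (vo := fun g => X (LocalBRST.oddGen g))
    (ve := fun g => X (LocalBRST.evenGen g))
    (fun g => add_comm 1 ε ▸ hX.parity 1 _ (oddGen_mem_parityPiece g))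
    (fun g => zero_add ε ▸ hX.parity 0 _ (evenGen_mem_parityPiece g))
  exact LinearMap.congr_fun (hX.ext h (fun f => by simp [h0]) (fun g => by simp)
    (fun g => by simp)) a

end Weights

/-! ### Contraction of pairs of generators -/

section Contraction

variable {n m q r : ℕ}

/-- Let `σ` be a derivation such that, up to terms of lower weight, the derivation `δ σ + σ δ`
multiplies the generators of positive weight by `f` and annihilates the others. Then,
up to powers of `f`, each `δ`-cycle is homologous to a cycle of weight zero. -/
theorem exists_homologous_weight_zero {δ : Form n m q r →ₗ[LocFun n m] Form n m q r}
    (hδ : IsRightDer 1 (δ.restrictScalars ℝ)) (hδδ : ∀ a, δ (δ a) = 0)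
    (hδ0 : ∀ f, δ (ofFun f) = 0) {σ : Form n m q r →ₗ[LocFun n m] Form n m q r}
    (hσ : IsRightDer 1 (σ.restrictScalars ℝ)) (hσ0 : ∀ f, σ (ofFun f) = 0)
    {P : OddGen n m q r → Prop} {Q : EvenGen n q r → Prop}
    (hσPQ : ∀ a ∈ genAlg n m q r P Q, σ a ∈ genAlg n m q r P Q)
    (wo : OddGen n m q r → ℕ) (we : EvenGen n q r → ℕ) (f : LocFun n m)
    (ho : ∀ g, P g → δ (σ (oddGen g)) + σ (δ (oddGen g)) -
      (if wo g = 0 then 0 else f) • oddGen g ∈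
        formsOn n m q r {M | M.Uses P Q ∧ M.weight wo we + 1 ≤ wo g})
    (he : ∀ g, Q g → δ (σ (evenGen g)) + σ (δ (evenGen g)) -
      (if we g = 0 then 0 else f) • evenGen g ∈
        formsOn n m q r {M | M.Uses P Q ∧ M.weight wo we + 1 ≤ we g})
    {a : Form n m q r} (ha : a ∈ genAlg n m q r P Q) (hδa : δ a = 0) :
    ∃ (K : ℕ) (c : Form n m q r), c ∈ genAlg n m q r P Q ∧
      f ^ K • a - δ c ∈ formsOn n m q r {M | M.Uses P Q ∧ M.weight wo we = 0} := by
  -- the number of generators of positive weight in a monomial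
  let N : Mono n m q r → ℕ := Mono.weight (fun g => if wo g = 0 then 0 else 1)
    (fun g => if we g = 0 then 0 else 1)
  have hN : ∀ M, N M ≤ M.weight wo we := by
    intro M
    refine add_le_add (Finset.sum_le_sum fun g _ => ?_) (Finset.sum_le_sum fun g _ => ?_)
    · split_ifs <;> omega
    · refine Nat.mul_le_mul_left _ ?_
      dsimp only
      split_ifs <;> omega
  have hN0 : ∀ M, N M = 0 → M.weight wo we = 0 := by
    intro M hM
    simp only [N, Mono.weight, Finsupp.sum, Nat.add_eq_zero_iff, Finset.sum_eq_zero_iff] at hM ⊢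
    refine ⟨fun g hg => ?_, fun g hg => ?_⟩
    · by_contra h
      have := hM.1 g hg
      simp [h] at this
    · by_contra h
      have h1 := hM.2 g hg
      have h2 : we g ≠ 0 := fun h' => h (by simp [h'])
      simp only [h2, if_false, mul_one] at h1
      exact h (by simp [h1])
  let Δ : Form n m q r →ₗ[LocFun n m] Form n m q r := δ ∘ₗ σ + σ ∘ₗ δ
  have hΔ : IsRightDer 2 (Δ.restrictScalars ℝ) := by
    have := hδ.commutator hσ
    convert this using 1
    ext1 a
    simp [Δ]
  have hΔM : ∀ M, M.Uses P Q → ∀ h, Δ (Finsupp.single M h) - ((N M : LocFun n m) * f) •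
      Finsupp.single M h ∈
        formsOn n m q r {M' | M'.Uses P Q ∧ M'.weight wo we + 1 ≤ M.weight wo we} := by
    intro M hM h
    have e1 : Δ (Finsupp.single M h) = rightDer
        (fun g => (if wo g = 0 then 0 else f) • oddGen g +
          (Δ (oddGen g) - (if wo g = 0 then 0 else f) • oddGen g))
        (fun g => (if we g = 0 then 0 else f) • evenGen g +
          (Δ (evenGen g) - (if we g = 0 then 0 else f) • evenGen g)) (Finsupp.single M h) := by
      simp only [add_sub_cancel]
      exact hΔ.eq_rightDer (fun f => by simp [Δ, hδ0, hσ0]) _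
    have e2 : M.weight (fun g => if wo g = 0 then 0 else f) (fun g => if we g = 0 then 0 else f) =
        (N M : LocFun n m) * f := by
      simp only [N, Mono.weight, Finsupp.sum]
      push_cast
      rw [add_mul, Finset.sum_mul, Finset.sum_mul]
      congr 1
      · exact Finset.sum_congr rfl fun g _ => by split_ifs <;> simp
      · exact Finset.sum_congr rfl fun g _ => by split_ifs <;> simp
    rw [e1, rightDer_add, rightDer_diagonal, e2, add_sub_cancel_left]
    refine rightDer_single_mem (fun g hg f' => ?_) (fun g hg f' => ?_) h
    · refine wedge_mem_supported (A := {⟨M.odd.erase g, M.even⟩}) ?_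
        (Finsupp.single_mem_supported _ _ rfl) (ho g (hM.1 g hg))
      rintro _ rfl N' ⟨hN', hw⟩ hd
      refine ⟨(hM.erase g).mul hN', ?_⟩
      rw [Mono.weight_mul wo we hd, ← Mono.weight_erase wo we hg]
      omega
    · refine wedge_mem_supported (A := {⟨M.odd, M.even - Finsupp.single g 1⟩}) ?_
        (Finsupp.single_mem_supported _ _ rfl) (he g (hM.2 g hg))
      rintro _ rfl N' ⟨hN', hw⟩ hd
      refine ⟨(hM.sub _).mul hN', ?_⟩
      rw [Mono.weight_mul wo we hd, ← Mono.weight_sub wo we hg]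
      omega
  have main : ∀ (w : ℕ) (a : Form n m q r), δ a = 0 →
      a ∈ formsOn n m q r {M | M.Uses P Q ∧ M.weight wo we ≤ w} →
      ∃ (K : ℕ) (c : Form n m q r), c ∈ genAlg n m q r P Q ∧
        f ^ K • a - δ c ∈ formsOn n m q r {M | M.Uses P Q ∧ M.weight wo we = 0} := by
    intro w
    induction w with
    | zero =>
      intro a _ ha
      refine ⟨0, 0, zero_mem _, ?_⟩
      simpa using ha
    | succ w ih =>
      intro a hδa ha
      -- eliminate the terms of top weight with `1`, `2`, … generators of positive weight
      have inner : ∀ i : ℕ, ∃ (K : ℕ) (c : Form n m q r), c ∈ genAlg n m q r P Q ∧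
          f ^ K • a - δ c ∈ formsOn n m q r {M | M.Uses P Q ∧ M.weight wo we ≤ w + 1 ∧
            (M.weight wo we = w + 1 → i < N M)} := by
        intro i
        induction i with
        | zero =>
          refine ⟨0, 0, zero_mem _, ?_⟩
          simp only [pow_zero, one_smul, map_zero, sub_zero]
          refine formsOn_mono ?_ ha
          rintro M ⟨h1, h2⟩
          refine ⟨h1, h2, fun h3 => Nat.pos_of_ne_zero fun h4 => ?_⟩
          have := hN0 M h4
          omega
        | succ i ihi =>
          obtain ⟨K, c, hc, hb⟩ := ihi
          set b := f ^ K • a - δ c with hbdef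
          have hδb : δ b = 0 := by simp [hbdef, hδa, hδδ]
          have hbPQ : b ∈ genAlg n m q r P Q := formsOn_mono (fun M hM => hM.1) hb
          have hΔb : Δ b = δ (σ b) := by simp [Δ, hδb]
          refine ⟨K + 1, f • c + (1 / (i + 1 : ℝ)) • σ b, ?_, ?_⟩
          · exact add_mem (Submodule.smul_mem _ _ hc) (real_smul_mem_formsOn (hσPQ b hbPQ) _)
          have e : f ^ (K + 1) • a - δ (f • c + (1 / (i + 1 : ℝ)) • σ b) =
              f • b - (1 / (i + 1 : ℝ)) • Δ b := by
            rw [map_add, map_smul, hΔb, hbdef, smul_sub, pow_succ', mul_smul]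
            have : δ ((1 / (i + 1 : ℝ)) • σ b) = (1 / (i + 1 : ℝ)) • δ (σ b) :=
              map_smul (δ.restrictScalars ℝ) _ _
            rw [← hbdef, this]
            abel
          rw [e]
          let X : Form n m q r →+ Form n m q r :=
            (f • LinearMap.id - (1 / (i + 1 : ℝ)) • Δ).toAddMonoidHom
          refine map_mem_formsOn (X := X) (fun M hM h => ?_) hb
          obtain ⟨hMu, hMw, hMN⟩ := hM
          change f • Finsupp.single M h - (1 / (i + 1 : ℝ)) • Δ (Finsupp.single M h) ∈ _
          have e3 : f • Finsupp.single M h - (1 / (i + 1 : ℝ)) • Δ (Finsupp.single M h) =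
              (1 - (N M : ℝ) / (i + 1 : ℝ)) • f • Finsupp.single M h -
              (1 / (i + 1 : ℝ)) • (Δ (Finsupp.single M h) - ((N M : LocFun n m) * f) •
                Finsupp.single M h) := by
            have : ((N M : LocFun n m) * f) • (Finsupp.single M h : Form n m q r) =
                (N M : ℝ) • f • Finsupp.single M h := by
              rw [mul_smul, Nat.cast_smul_eq_nsmul, Nat.cast_smul_eq_nsmul]
            rw [this]
            generalize f • (Finsupp.single M h : Form n m q r) = y
            module
          rw [e3]
          refine sub_mem ?_ (real_smul_mem_formsOn (formsOn_mono ?_ (hΔM M hMu h)) _)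
          · by_cases hlt : M.weight wo we = w + 1 ∧ N M = i + 1
            · have : (1 - (N M : ℝ) / (i + 1 : ℝ)) = 0 := by
                rw [hlt.2]; push_cast; rw [div_self (by positivity), sub_self]
              rw [this, zero_smul]
              exact zero_mem _
            · refine real_smul_mem_formsOn (Submodule.smul_mem _ _ (single_mem_formsOn ?_ _)) _
              refine ⟨hMu, hMw, fun h5 => ?_⟩
              have := hMN h5
              have : N M ≠ i + 1 := fun h6 => hlt ⟨h5, h6⟩
              omega
          · rintro M' ⟨h1, h2⟩
            exact ⟨h1, by omega, fun h3 => by omega⟩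
      obtain ⟨K, c, hc, hb⟩ := inner (w + 1)
      obtain ⟨K', c', hc', hb'⟩ := ih (f ^ K • a - δ c) (by simp [hδa, hδδ])
        (formsOn_mono (by
          rintro M ⟨h1, h2, h3⟩
          refine ⟨h1, ?_⟩
          have := hN M
          by_contra h4
          have := h3 (by omega)
          omega) hb)
      refine ⟨K' + K, f ^ K' • c + c', add_mem (Submodule.smul_mem _ _ hc) hc', ?_⟩
      convert hb' using 1
      rw [map_add, map_smul, pow_add, mul_smul, smul_sub, sub_sub]
  obtain ⟨w, hw⟩ : ∃ w, ∀ M ∈ a.support, M.weight wo we ≤ w :=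
    ⟨a.support.sup fun M => M.weight wo we, fun M hM => Finset.le_sup (f := fun M => M.weight wo we) hM⟩
  exact main w a hδa fun M hM => ⟨ha hM, hw M hM⟩

end Contraction

/-! ### Gradings and projections -/

section Gradings

variable {n m q r : ℕ}

theorem OddGen.antigh_nonneg (g : OddGen n m q r) : 0 ≤ g.antigh := by
  cases g <;> simp [OddGen.antigh]

theorem EvenGen.antigh_nonneg (g : EvenGen n q r) : 0 ≤ g.antigh := by
  cases g <;> simp [EvenGen.antigh]

theorem OddGen.puregh_nonneg (g : OddGen n m q r) : 0 ≤ g.puregh := by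
  cases g <;> simp [OddGen.puregh]

theorem EvenGen.puregh_nonneg (g : EvenGen n q r) : 0 ≤ g.puregh := by
  cases g <;> simp [EvenGen.puregh]

theorem OddGen.formDeg_nonneg (g : OddGen n m q r) : 0 ≤ g.formDeg := by
  cases g <;> simp [OddGen.formDeg]

section

variable {wo : OddGen n m q r → ℤ} {we : EvenGen n q r → ℤ} (ho : ∀ g, 0 ≤ wo g)
  (he : ∀ g, 0 ≤ we g) (M : Mono n m q r)
include ho he

theorem Mono.weight_nonneg : 0 ≤ M.weight wo we :=
  add_nonneg (Finset.sum_nonneg fun g _ => ho g)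
    (Finset.sum_nonneg fun g _ => mul_nonneg (Nat.cast_nonneg _) (he g))

theorem Mono.le_weight_of_mem_odd {g : OddGen n m q r} (hg : g ∈ M.odd) :
    wo g ≤ M.weight wo we := by
  rw [← Mono.weight_erase wo we hg]
  have := Mono.weight_nonneg ho he ⟨M.odd.erase g, M.even⟩
  omega

theorem Mono.mul_le_weight (g : EvenGen n q r) : M.even g * we g ≤ M.weight wo we := by
  by_cases hg : g ∈ M.even.support
  · have h1 : M.even g * we g ≤ M.even.sum fun g e => (e : ℤ) * we g :=
      Finset.single_le_sum (f := fun g => (M.even g : ℤ) * we g)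
        (fun g _ => mul_nonneg (Nat.cast_nonneg _) (he g)) hg
    have h2 : 0 ≤ ∑ g ∈ M.odd, wo g := Finset.sum_nonneg fun g _ => ho g
    rw [Mono.weight]
    omega
  · rw [Finsupp.notMem_support_iff.1 hg]
    simpa using M.weight_nonneg ho he

end

theorem Mono.antigh_nonneg (M : Mono n m q r) : 0 ≤ M.antigh :=
  M.weight_nonneg OddGen.antigh_nonneg EvenGen.antigh_nonneg

theorem Mono.puregh_nonneg (M : Mono n m q r) : 0 ≤ M.puregh :=
  M.weight_nonneg OddGen.puregh_nonneg EvenGen.puregh_nonneg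

theorem Mono.formDeg_nonneg (M : Mono n m q r) : 0 ≤ M.formDeg :=
  Finset.sum_nonneg fun g _ => g.formDeg_nonneg

theorem Mono.antigh_le_of_mem_odd {M : Mono n m q r} {g : OddGen n m q r} (hg : g ∈ M.odd) :
    g.antigh ≤ M.antigh :=
  M.le_weight_of_mem_odd OddGen.antigh_nonneg EvenGen.antigh_nonneg hg

theorem Mono.puregh_le_of_mem_odd {M : Mono n m q r} {g : OddGen n m q r} (hg : g ∈ M.odd) :
    g.puregh ≤ M.puregh :=
  M.le_weight_of_mem_odd OddGen.puregh_nonneg EvenGen.puregh_nonneg hg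

theorem Mono.formDeg_le_of_mem_odd {M : Mono n m q r} {g : OddGen n m q r} (hg : g ∈ M.odd) :
    g.formDeg ≤ M.formDeg :=
  Finset.single_le_sum (fun g _ => g.formDeg_nonneg) hg

theorem Mono.mul_antigh_le (M : Mono n m q r) (g : EvenGen n q r) :
    M.even g * g.antigh ≤ M.antigh :=
  M.mul_le_weight OddGen.antigh_nonneg EvenGen.antigh_nonneg g

theorem Mono.mul_puregh_le (M : Mono n m q r) (g : EvenGen n q r) :
    M.even g * g.puregh ≤ M.puregh :=
  M.mul_le_weight OddGen.puregh_nonneg EvenGen.puregh_nonneg g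

/-- A monomial without ghosts, `dx` and with antighost number at most two is a product of antifields
`φ*_i` and `C*_α`. -/
theorem Mono.uses_of_antigh_le_two {M : Mono n m q r} (h1 : M.antigh ≤ 2) (h2 : M.puregh = 0)
    (h3 : M.formDeg = 0) :
    M.Uses (fun g => ∃ i J, g = .antifield i J) (fun g => ∃ α J, g = .antighost α J) := by
  refine ⟨fun g hg => ?_, fun g hg => ?_⟩
  · have a1 := Mono.antigh_le_of_mem_odd hg
    have a2 := Mono.puregh_le_of_mem_odd hg
    have a3 := Mono.formDeg_le_of_mem_odd hg
    cases g <;> simp only [OddGen.antigh, OddGen.puregh, OddGen.formDeg] at a1 a2 a3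
    · omega
    · omega
    · exact ⟨_, _, rfl⟩
    · omega
  · have a2 := M.mul_puregh_le g
    have : M.even g ≠ 0 := Finsupp.mem_support_iff.1 hg
    cases g <;> simp only [EvenGen.puregh] at a2
    · omega
    · exact ⟨_, _, rfl⟩

theorem Mono.antigh_eq_of_uses {M : Mono n m q r}
    (hM : M.Uses (fun g => ∃ i J, g = .antifield i J) (fun g => ∃ α J, g = .antighost α J)) :
    M.antigh = M.odd.card + 2 * ∑ g ∈ M.even.support, (M.even g : ℤ) := by
  rw [Mono.antigh, Finsupp.sum, Finset.mul_sum, Finset.card_eq_sum_ones]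
  push_cast
  congr 1
  · refine Finset.sum_congr rfl fun g hg => ?_
    obtain ⟨i, J, rfl⟩ := hM.1 g hg
    rfl
  · refine Finset.sum_congr rfl fun g hg => ?_
    obtain ⟨i, J, rfl⟩ := hM.2 g hg
    simp [EvenGen.antigh, mul_comm]

theorem Mono.even_eq_zero_of_sum {M : Mono n m q r}
    (h : ∑ g ∈ M.even.support, (M.even g : ℤ) = 0) : M.even = 0 := by
  ext g
  by_contra hg
  have h1 : g ∈ M.even.support := Finsupp.mem_support_iff.2 hg
  have := Finset.single_le_sum (f := fun g => (M.even g : ℤ)) (fun g _ => Nat.cast_nonneg _) h1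
  simp only [Finsupp.coe_zero, Pi.zero_apply] at hg
  omega

theorem Mono.eq_of_antigh_one {M : Mono n m q r} (h1 : M.antigh = 1) (h2 : M.puregh = 0)
    (h3 : M.formDeg = 0) : ∃ i J, M = oddMono (.antifield i J) := by
  have hu := Mono.uses_of_antigh_le_two (by omega) h2 h3
  have h := Mono.antigh_eq_of_uses hu
  have hs : 0 ≤ ∑ g ∈ M.even.support, (M.even g : ℤ) :=
    Finset.sum_nonneg fun g _ => Nat.cast_nonneg _
  have hc : M.odd.card = 1 := by omega
  obtain ⟨g, hg⟩ := Finset.card_eq_one.1 hc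
  obtain ⟨i, J, rfl⟩ := hu.1 g (by simp [hg])
  exact ⟨i, J, Mono.ext hg (Mono.even_eq_zero_of_sum (by omega))⟩

theorem Mono.eq_of_antigh_two {M : Mono n m q r} (h1 : M.antigh = 2) (h2 : M.puregh = 0)
    (h3 : M.formDeg = 0) : (∃ α J, M = evenMono (.antighost α J)) ∨
      (∀ g ∈ M.odd, ∃ i J, g = .antifield i J) ∧ M.odd.card = 2 ∧ M.even = 0 := by
  have hu := Mono.uses_of_antigh_le_two h1.le h2 h3
  have h := Mono.antigh_eq_of_uses hu
  have hs : 0 ≤ ∑ g ∈ M.even.support, (M.even g : ℤ) :=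
    Finset.sum_nonneg fun g _ => Nat.cast_nonneg _
  by_cases h0 : ∑ g ∈ M.even.support, (M.even g : ℤ) = 0
  · exact Or.inr ⟨hu.1, by omega, Mono.even_eq_zero_of_sum h0⟩
  · refine Or.inl ?_
    have hc : M.odd = ∅ := Finset.card_eq_zero.1 (by omega)
    have h1 : ∑ g ∈ M.even.support, (M.even g : ℤ) = 1 := by omega
    obtain ⟨g, hg⟩ : ∃ g, g ∈ M.even.support := by
      by_contra hne
      push Not at hne
      rw [Finset.eq_empty_of_forall_notMem hne] at h0
      simp at h0
    obtain ⟨α, J, rfl⟩ := hu.2 g hg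
    refine ⟨α, J, Mono.ext hc (Finsupp.ext fun g' => ?_)⟩
    classical
    rw [← Finset.add_sum_erase _ _ hg] at h1
    have hpos : M.even (.antighost α J) ≠ 0 := Finsupp.mem_support_iff.1 hg
    have hs' : 0 ≤ ∑ g ∈ M.even.support.erase (.antighost α J), (M.even g : ℤ) :=
      Finset.sum_nonneg fun g _ => Nat.cast_nonneg _
    by_cases hg' : g' = .antighost α J
    · subst hg'
      simp only [evenMono, Finsupp.single_eq_same]
      omega
    · simp only [evenMono, Finsupp.single_eq_of_ne hg']
      by_contra hne
      have hmem : g' ∈ M.even.support.erase (.antighost α J) :=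
        Finset.mem_erase.2 ⟨hg', Finsupp.mem_support_iff.2 hne⟩
      have := Finset.single_le_sum (f := fun g => (M.even g : ℤ))
        (fun g _ => Nat.cast_nonneg _) hmem
      omega

theorem mem_piece {j g p : ℤ} {a : Form n m q r} : a ∈ piece n m q r j g p ↔
    a ∈ formsOn n m q r {M | M.antigh = j ∧ M.puregh = g ∧ M.formDeg = p} :=
  Iff.rfl

theorem single_mem_piece (M : Mono n m q r) (f : LocFun n m) :
    Finsupp.single M f ∈ piece n m q r M.antigh M.puregh M.formDeg :=
  mem_piece.2 (single_mem_formsOn (S := {N | N.antigh = M.antigh ∧ N.puregh = M.puregh ∧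
    N.formDeg = M.formDeg}) ⟨rfl, rfl, rfl⟩ f)

theorem oddGen_mem_piece (g : OddGen n m q r) :
    (oddGen g : Form n m q r) ∈ piece n m q r g.antigh g.puregh g.formDeg := by
  have := single_mem_piece (oddMono g) (1 : LocFun n m)
  rwa [Mono.antigh_eq_weight, Mono.puregh_eq_weight, Mono.formDeg_eq_weight, weight_oddMono,
    weight_oddMono, weight_oddMono] at this

theorem evenGen_mem_piece (g : EvenGen n q r) :
    (evenGen g : Form n m q r) ∈ piece n m q r g.antigh g.puregh 0 := by
  have := single_mem_piece (evenMono g : Mono n m q r) (1 : LocFun n m)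
  rwa [Mono.antigh_eq_weight, Mono.puregh_eq_weight, Mono.formDeg_eq_weight, weight_evenMono,
    weight_evenMono, weight_evenMono] at this

theorem wedge_mem_piece {j g p j' g' p' : ℤ} {a b : Form n m q r} (ha : a ∈ piece n m q r j g p)
    (hb : b ∈ piece n m q r j' g' p') : wedge a b ∈ piece n m q r (j + j') (g + g') (p + p') := by
  refine mem_piece.2 (wedge_mem_supported ?_ ha hb)
  rintro M ⟨h1, h2, h3⟩ N ⟨h4, h5, h6⟩ hd
  refine ⟨?_, ?_, ?_⟩
  · rw [Mono.antigh_eq_weight, Mono.weight_mul _ _ hd, ← h1, ← h4]; rfl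
  · rw [Mono.puregh_eq_weight, Mono.weight_mul _ _ hd, ← h2, ← h5]; rfl
  · rw [Mono.formDeg_eq_weight, Mono.weight_mul _ _ hd, ← h3, ← h6, Mono.formDeg_eq_weight,
      Mono.formDeg_eq_weight]

theorem eq_zero_of_mem_piece_neg {j g p : ℤ} (h : j < 0 ∨ g < 0 ∨ p < 0) {a : Form n m q r}
    (ha : a ∈ piece n m q r j g p) : a = 0 := by
  refine Finsupp.ext fun M => ?_
  by_contra hM
  obtain ⟨h1, h2, h3⟩ := mem_formsOn.1 (mem_piece.1 ha) M hM
  have := M.antigh_nonneg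
  have := M.puregh_nonneg
  have := M.formDeg_nonneg
  omega

/-- The parity of a monomial is that of its total degree. -/
theorem Mono.card_odd_emod_two (M : Mono n m q r) :
    (M.odd.card : ℤ) % 2 = (M.antigh + M.puregh + M.formDeg) % 2 := by
  have h1 : M.antigh + M.puregh + M.formDeg = ∑ g ∈ M.odd, (g.antigh + g.puregh + g.formDeg) +
      ∑ g ∈ M.even.support, (M.even g : ℤ) * (g.antigh + g.puregh) := by
    rw [Mono.antigh, Mono.puregh, Mono.formDeg, Finsupp.sum, Finsupp.sum]
    simp only [Finset.sum_add_distrib, mul_add]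
    ring
  have h2 : (2 : ℤ) ∣ ∑ g ∈ M.even.support, (M.even g : ℤ) * (g.antigh + g.puregh) := by
    refine Finset.dvd_sum fun g _ => Dvd.dvd.mul_left ?_ _
    cases g <;> simp [EvenGen.antigh, EvenGen.puregh]
  have h3 : (2 : ℤ) ∣ ∑ g ∈ M.odd, (g.antigh + g.puregh + g.formDeg) - M.odd.card := by
    rw [Finset.card_eq_sum_ones]
    push_cast
    rw [← Finset.sum_sub_distrib]
    refine Finset.dvd_sum fun g _ => ?_
    cases g <;> simp [OddGen.antigh, OddGen.puregh, OddGen.formDeg]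
  rw [h1]
  omega

open Classical in
/-- The projection of local forms to those supported on a set of monomials. -/
def proj (S : Set (Mono n m q r)) (a : Form n m q r) : Form n m q r := a.filter (· ∈ S)

theorem proj_mem (S : Set (Mono n m q r)) (a : Form n m q r) : proj S a ∈ formsOn n m q r S := by
  classical
  rw [mem_formsOn]
  intro M hM
  by_contra h
  exact hM (Finsupp.filter_apply_neg _ _ h)

theorem proj_mem_of_mem {S S' : Set (Mono n m q r)} {a : Form n m q r}
    (ha : a ∈ formsOn n m q r S') : proj S a ∈ formsOn n m q r S' := by
  classical
  rw [mem_formsOn] at ha ⊢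
  intro M hM
  refine ha M fun h0 => hM ?_
  rw [proj, Finsupp.filter_apply]
  split_ifs
  exacts [h0, rfl]

theorem proj_add (S : Set (Mono n m q r)) (a b : Form n m q r) :
    proj S (a + b) = proj S a + proj S b := by
  classical exact Finsupp.filter_add

@[simp]
theorem proj_zero (S : Set (Mono n m q r)) : proj S (0 : Form n m q r) = 0 := by
  classical exact Finsupp.filter_zero _

theorem proj_eq_self {S : Set (Mono n m q r)} {a : Form n m q r} (ha : a ∈ formsOn n m q r S) :
    proj S a = a := by
  classical exact (Finsupp.filter_eq_self_iff _ _).2 fun M hM => mem_formsOn.1 ha M hM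

theorem proj_eq_zero {S : Set (Mono n m q r)} {a : Form n m q r} (ha : a ∈ formsOn n m q r Sᶜ) :
    proj S a = 0 := by
  classical
  refine (Finsupp.filter_eq_zero_iff _ _).2 fun M hM => ?_
  by_contra h
  exact mem_formsOn.1 ha M h hM

/-- Projections to homogeneous components commute with homogeneous operators. -/
theorem map_proj {S S' : Set (Mono n m q r)} (X : Form n m q r →+ Form n m q r)
    (h : ∀ M ∈ S, ∀ f, X (Finsupp.single M f) ∈ formsOn n m q r S')
    (h' : ∀ M ∉ S, ∀ f, X (Finsupp.single M f) ∈ formsOn n m q r S'ᶜ) (a : Form n m q r) :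
    X (proj S a) = proj S' (X a) := by
  induction a using Finsupp.induction_linear with
  | zero => simp
  | add x y hx hy => rw [proj_add, map_add, hx, hy, map_add, proj_add]
  | single M f =>
    by_cases hM : M ∈ S
    · rw [proj_eq_self (single_mem_formsOn hM f), proj_eq_self (h M hM f)]
    · rw [proj_eq_zero (single_mem_formsOn hM f), proj_eq_zero (h' M hM f), map_zero]

/-- Operators of definite degrees commute with the projections to homogeneous components. -/
theorem map_proj_of_degree {X : Form n m q r →+ Form n m q r} {dj dg dp : ℤ}
    (hX : ∀ j g p, ∀ a ∈ piece n m q r j g p, X a ∈ piece n m q r (j + dj) (g + dg) (p + dp))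
    (R : ℤ → ℤ → ℤ → Prop) (a : Form n m q r) :
    X (proj {M | R M.antigh M.puregh M.formDeg} a) =
      proj {M | R (M.antigh - dj) (M.puregh - dg) (M.formDeg - dp)} (X a) := by
  refine map_proj X (fun M hM f => ?_) (fun M hM f => ?_) a
  · refine formsOn_mono ?_ (hX _ _ _ _ (single_mem_piece M f))
    rintro N ⟨h1, h2, h3⟩
    have : R M.antigh M.puregh M.formDeg := hM
    change R (N.antigh - dj) (N.puregh - dg) (N.formDeg - dp)
    rwa [h1, h2, h3, add_sub_cancel_right, add_sub_cancel_right, add_sub_cancel_right]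
  · refine formsOn_mono ?_ (hX _ _ _ _ (single_mem_piece M f))
    rintro N ⟨h1, h2, h3⟩
    have : ¬ R M.antigh M.puregh M.formDeg := hM
    change ¬ R (N.antigh - dj) (N.puregh - dg) (N.formDeg - dp)
    rwa [h1, h2, h3, add_sub_cancel_right, add_sub_cancel_right, add_sub_cancel_right]

end Gradings

/-! ### Basic properties of the Koszul-Tate differential -/

section KoszulTate

variable {n m q r : ℕ} {T : GaugeTheory n m q r}

namespace GaugeTheory.BRSTDifferential

variable (s : T.BRSTDifferential)
include s

theorem delta_piece {j g p : ℤ} {a : Form n m q r} (ha : a ∈ piece n m q r j g p) :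
    T.delta a ∈ piece n m q r (j - 1) g p := by
  have := s.degree 0 j g p a ha
  rw [s.comp_zero] at this
  simp only [Nat.cast_zero, add_zero] at this
  exact this

/-- `δ² = 0` is the part of lowest antighost number of `s² = 0`. -/
theorem delta_delta (a : Form n m q r) : T.delta (T.delta a) = 0 := by
  have := s.nilpotent 0 a
  simp only [Finset.Nat.antidiagonal_zero, Finset.sum_singleton, s.comp_zero] at this
  exact this

theorem delta_formD (μ : Fin n) (a : Form n m q r) :
    T.delta (formD μ a) = formD μ (T.delta a) := by
  have := s.comm 0 μ a
  rwa [s.comp_zero] at this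

theorem comp_parity (k p : ℕ) (a : Form n m q r) (ha : a ∈ parityPiece n m q r p) :
    s.comp k a ∈ parityPiece n m q r (p + 1) := by
  refine map_mem_formsOn (X := (s.comp k).toAddMonoidHom) (fun M hM f => ?_) ha
  refine formsOn_mono ?_ (s.degree k _ _ _ _ (single_mem_piece M f))
  rintro N ⟨h1, h2, h3⟩
  have e1 := M.card_odd_emod_two
  have e2 := N.card_odd_emod_two
  have hM' : M.odd.card % 2 = p % 2 := hM
  change N.odd.card % 2 = (p + 1) % 2
  rw [h1, h2, h3] at e2
  omega

theorem isRightDer_comp (k : ℕ) : IsRightDer 1 (s.comp k) where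
  leibniz p a b hb := by
    refine supported_induction (P := fun b => s.comp k (wedge a b) = wedge a (s.comp k b) +
      (-1 : ℤ) ^ (1 * p) • wedge (s.comp k a) b) (by simp) (fun x y hx hy => ?_)
      (fun M hM f => ?_) b hb
    · simp only [wedge_add_right, map_add, hx, hy, smul_add]; abel
    · rw [s.leibniz, one_mul, neg_one_pow_congr_mod hM]
  parity p a ha := s.comp_parity k p a ha

theorem isRightDer_delta : IsRightDer 1 (T.delta.restrictScalars ℝ) := by
  have := s.isRightDer_comp 0
  rwa [s.comp_zero] at this

theorem delta_wedge_oddGen (a : Form n m q r) (g : OddGen n m q r) :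
    T.delta (wedge a (oddGen g)) = wedge a (T.deltaOdd g) - wedge (T.delta a) (oddGen g) := by
  have := s.isRightDer_delta.oddGen a g
  simp only [LinearMap.restrictScalars_apply, pow_one, neg_smul, one_smul] at this
  rw [this, GaugeTheory.delta, rightDer_oddGen, sub_eq_add_neg]

theorem delta_antigh {S : Set (Mono n m q r)} {j : ℤ} (hS : ∀ M ∈ S, M.antigh = j)
    {a : Form n m q r} (ha : a ∈ formsOn n m q r S) :
    T.delta a ∈ formsOn n m q r {M | M.antigh = j - 1} := by
  refine map_mem_formsOn (X := T.delta.toAddMonoidHom) (fun M hM f => ?_) ha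
  refine formsOn_mono ?_ (s.delta_piece (single_mem_piece M f))
  rintro N ⟨h1, -, -⟩
  change N.antigh = _
  rw [h1, hS M hM]

theorem deltaEven_antighost_mem (α : Fin q) (J : MIdx n) :
    T.deltaEven (.antighost α J) ∈ piece n m q r 1 0 0 := by
  have := s.delta_piece (evenGen_mem_piece (m := m) (.antighost α J : EvenGen n q r))
  rwa [GaugeTheory.delta, rightDer_evenGen] at this

theorem deltaOdd_antighost2_mem (Δ : Fin r) (J : MIdx n) :
    T.deltaOdd (.antighost2 Δ J) ∈ piece n m q r 2 0 0 := by
  have := s.delta_piece (oddGen_mem_piece (.antighost2 Δ J : OddGen n m q r))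
  rwa [GaugeTheory.delta, rightDer_oddGen] at this

/-- `δ` of the antifields of the ghosts is given by the Noether identities. -/
theorem deltaEven_antighost {E : Finset (Fin m × MIdx n)} {a : Fin q × MIdx n}
    (hE : ∀ e ∉ E, T.noetherCoeff a e = 0) :
    T.deltaEven (.antighost a.1 a.2) =
      ∑ e ∈ E, T.noetherCoeff a e • (oddGen (.antifield e.1 e.2) : Form n m q r) := by
  classical
  ext1 M
  rw [Finsupp.finsetSum_apply]
  simp only [oddGen, Finsupp.smul_single, smul_eq_mul, mul_one, Finsupp.single_apply]
  by_cases hM : ∃ i J, M = oddMono (.antifield i J)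
  · obtain ⟨i, J, rfl⟩ := hM
    have hinj : ∀ e : Fin m × MIdx n, (oddMono (.antifield e.1 e.2) : Mono n m q r) =
        oddMono (.antifield i J) ↔ e = (i, J) := by
      intro e
      simp [oddMono, Mono.ext_iff, Prod.ext_iff]
    simp only [hinj, Finset.sum_ite_eq']
    split_ifs with h
    · rfl
    · exact hE _ h
  · rw [Finset.sum_eq_zero]
    · by_contra h
      obtain ⟨h1, h2, h3⟩ := mem_formsOn.1 (s.deltaEven_antighost_mem a.1 a.2) M h
      exact hM (Mono.eq_of_antigh_one h1 h2 h3)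
    · intro e _
      rw [if_neg]
      rintro rfl
      exact hM ⟨_, _, rfl⟩

/-- `δ` of the antifields of the ghosts of ghosts is given by the reducibility identities, up to
terms quadratic in the antifields `φ*_i`. -/
theorem deltaOdd_antighost2 {E : Finset (Fin m × MIdx n)} {G : Finset (Fin q × MIdx n)}
    {b : Fin r × MIdx n} (hG : ∀ a ∉ G, T.reducibilityCoeff b a = 0)
    (hE : ∀ M, T.deltaOdd (.antighost2 b.1 b.2) M ≠ 0 →
      ∀ i J, OddGen.antifield i J ∈ M.odd → (i, J) ∈ E) :
    ∃ Q ∈ formsOn n m q r {M | (∀ g ∈ M.odd, ∃ e ∈ E, g = .antifield e.1 e.2) ∧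
        M.odd.card = 2 ∧ M.even = 0},
      T.deltaOdd (.antighost2 b.1 b.2) =
        ∑ a ∈ G, T.reducibilityCoeff b a • (evenGen (.antighost a.1 a.2) : Form n m q r) + Q := by
  classical
  refine ⟨T.deltaOdd (.antighost2 b.1 b.2) -
    ∑ a ∈ G, T.reducibilityCoeff b a • (evenGen (.antighost a.1 a.2) : Form n m q r), ?_,
    by abel⟩
  rw [mem_formsOn]
  intro M hM
  rw [Finsupp.sub_apply, Finsupp.finsetSum_apply] at hM
  simp only [evenGen, Finsupp.smul_single, smul_eq_mul, mul_one, Finsupp.single_apply] at hM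
  by_cases hMe : ∃ α J, M = evenMono (.antighost α J)
  · exfalso
    obtain ⟨α, J, rfl⟩ := hMe
    have hinj : ∀ e : Fin q × MIdx n, (evenMono (.antighost e.1 e.2) : Mono n m q r) =
        evenMono (.antighost α J) ↔ e = (α, J) := by
      intro e
      simp [evenMono, Mono.ext_iff, Prod.ext_iff, Finsupp.single_left_inj]
    simp only [hinj, Finset.sum_ite_eq'] at hM
    split_ifs at hM with h
    · exact hM (sub_self _)
    · rw [sub_zero] at hM
      exact hM (hG _ h)
  · rw [Finset.sum_eq_zero, sub_zero] at hM
    · obtain ⟨h1, h2, h3⟩ := mem_formsOn.1 (s.deltaOdd_antighost2_mem b.1 b.2) M hM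
      rcases Mono.eq_of_antigh_two h1 h2 h3 with h | ⟨h, hc, h0⟩
      · exact absurd h hMe
      · refine ⟨fun g hg => ?_, hc, h0⟩
        obtain ⟨i, J, rfl⟩ := h g hg
        exact ⟨(i, J), hE M hM i J hg, rfl⟩
    · intro e _
      rw [if_neg]
      rintro rfl
      exact hMe ⟨_, _, rfl⟩

omit s in
theorem _root_.LocalBRST.GaugeTheory.deltaOdd_antifield (e : Fin m × MIdx n) :
    T.deltaOdd (.antifield e.1 e.2) = ofFun (-T.eqJet e) := by
  rw [GaugeTheory.deltaOdd, formDs_ofFun, GaugeTheory.eqJet, ofFun, ofFun, Finsupp.single_neg]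

end GaugeTheory.BRSTDifferential

end KoszulTate

/-! ### Derivatives with respect to anticommuting generators -/

section Contr

variable {n m q r : ℕ}

/-- The right derivative with respect to an anticommuting generator. -/
def contrOdd (g : OddGen n m q r) : Form n m q r →ₗ[LocFun n m] Form n m q r :=
  rightDer (fun h => if h = g then ofFun 1 else 0) 0

theorem isRightDer_contrOdd (g : OddGen n m q r) :
    IsRightDer 1 ((contrOdd g).restrictScalars ℝ) := by
  refine isRightDer_rightDer (fun h => ?_) fun h => zero_mem _
  split_ifs
  · rw [parityPiece_congr (p := 1 + 1) (p' := 0) rfl]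
    exact ofFun_mem_parityPiece 1
  · exact zero_mem _

theorem contrOdd_single (g : OddGen n m q r) (M : Mono n m q r) (f : LocFun n m) :
    contrOdd g (Finsupp.single M f) = if g ∈ M.odd then
      (-1 : ℤ) ^ (M.odd.filter fun h => g < h).card • Finsupp.single ⟨M.odd.erase g, M.even⟩ f
      else 0 := by
  rw [contrOdd, rightDer_single]
  simp only [Pi.zero_apply, wedge_zero_right, smul_zero, Finset.sum_const_zero, add_zero]
  split_ifs with hg
  · rw [Finset.sum_eq_single g]
    · rw [if_pos rfl, wedge_ofFun_right, one_smul]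
    · intro h _ hh
      rw [if_neg hh, wedge_zero_right, smul_zero]
    · exact fun h => absurd hg h
  · refine Finset.sum_eq_zero fun h hh => ?_
    rw [if_neg fun e : h = g => hg (e ▸ hh), wedge_zero_right, smul_zero]

@[simp]
theorem contrOdd_ofFun (g : OddGen n m q r) (f : LocFun n m) : contrOdd g (ofFun f) = 0 :=
  rightDer_ofFun _ _ f

@[simp]
theorem contrOdd_oddGen (g h : OddGen n m q r) :
    contrOdd g (oddGen h) = if h = g then ofFun 1 else 0 :=
  rightDer_oddGen _ _ h

@[simp]
theorem contrOdd_evenGen (g : OddGen n m q r) (h : EvenGen n q r) :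
    contrOdd g (evenGen h) = 0 :=
  rightDer_evenGen _ _ h

theorem contrOdd_eq_zero {g : OddGen n m q r} {a : Form n m q r}
    (ha : a ∈ formsOn n m q r {M | g ∉ M.odd}) : contrOdd g a = 0 := by
  refine supported_induction (P := fun a => contrOdd g a = 0) (by simp)
    (fun x y hx hy => by rw [map_add, hx, hy, add_zero]) (fun M hM f => ?_) a ha
  rw [contrOdd_single, if_neg hM]

theorem contrOdd_wedge_oddGen (g h : OddGen n m q r) (a : Form n m q r) :
    contrOdd g (wedge a (oddGen h)) =
      (if h = g then a else 0) - wedge (contrOdd g a) (oddGen h) := by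
  have := (isRightDer_contrOdd g).oddGen a h
  simp only [LinearMap.restrictScalars_apply, pow_one, neg_smul, one_smul] at this
  rw [this, contrOdd_oddGen, sub_eq_add_neg]
  split_ifs
  · rw [wedge_ofFun_right, one_smul]
  · rw [wedge_zero_right]

theorem contrOdd_mem {S S' : Set (Mono n m q r)} {g : OddGen n m q r}
    (h : ∀ M ∈ S, g ∈ M.odd → ⟨M.odd.erase g, M.even⟩ ∈ S') {a : Form n m q r}
    (ha : a ∈ formsOn n m q r S) : contrOdd g a ∈ formsOn n m q r S' := by
  refine map_mem_formsOn (X := (contrOdd g).toAddMonoidHom) (fun M hM f => ?_) ha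
  change contrOdd g _ ∈ _
  rw [contrOdd_single]
  split_ifs with hg
  · exact zsmul_mem (single_mem_formsOn (h M hM hg) f) _
  · exact zero_mem _

/-- The part of a form that does not contain the generator `g`. -/
theorem sub_contrOdd_mem {S : Set (Mono n m q r)} {g : OddGen n m q r} {a : Form n m q r}
    (ha : a ∈ formsOn n m q r S) :
    a - wedge (contrOdd g a) (oddGen g) ∈ formsOn n m q r {M | M ∈ S ∧ g ∉ M.odd} := by
  refine supported_induction (P := fun a => a - wedge (contrOdd g a) (oddGen g) ∈
    formsOn n m q r {M | M ∈ S ∧ g ∉ M.odd}) (by simp) (fun x y hx hy => ?_)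
    (fun M hM f => ?_) a ha
  · rw [map_add, wedge_add_left, add_sub_add_comm]
    exact add_mem hx hy
  · rw [contrOdd_single]
    split_ifs with hg
    · have e : ((M.odd.erase g).filter fun h => g < h) = M.odd.filter fun h => g < h := by
        ext h
        simp only [Finset.mem_filter, Finset.mem_erase]
        exact ⟨fun ⟨⟨_, h1⟩, h2⟩ => ⟨h1, h2⟩, fun ⟨h1, h2⟩ => ⟨⟨h2.ne', h1⟩, h2⟩⟩
      rw [wedge_zsmul_left, single_wedge_oddGen_of_notMem (M := ⟨M.odd.erase g, M.even⟩) f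
        (Finset.notMem_erase g M.odd), smul_smul]
      simp only [e, Finset.insert_erase hg]
      rw [← mul_pow]
      simp
    · rw [wedge_zero_left, sub_zero]
      exact single_mem_formsOn (S := {M | M ∈ S ∧ g ∉ M.odd}) ⟨hM, hg⟩ f

end Contr

/-! ### Local acyclicity: independent equations -/

section Koszul

variable {n m q r : ℕ}

/-- Division by independent functions, in terms of ideals. -/
theorem exists_mul_mem_span {κ : Type} [DecidableEq κ] {F : Finset κ} {k : κ} (hk : k ∉ F)
    {L : κ → LocFun n m} {u : Jet n m}
    (hind : LinearIndependent ℝ fun (e : (insert k F : Finset κ)) (c : Coord n m) =>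
      (pd c (L e)).eval u) {g : LocFun n m} (hg : L k * g ∈ Ideal.span (L '' F)) :
    ∃ χ : LocFun n m, χ.eval u ≠ 0 ∧ χ * g ∈ Ideal.span (L '' F) := by
  obtain ⟨c, hc⟩ := (Submodule.mem_span_image_finset_iff_exists_fun' _).1 hg
  have hk' : k ∈ insert k F := Finset.mem_insert_self k F
  obtain ⟨χ, hχ, h', H⟩ := LocFun.exists_mul_mem_ideal
    (f := fun e : (insert k F : Finset κ) => L e) hind ⟨k, hk'⟩ (g := g) (h := fun e => c e) (by
      simp only
      rw [← hc, Finset.sum_erase_eq_sub (Finset.mem_univ _),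
        Finset.sum_coe_sort (insert k F) (fun e => L e * c e), Finset.sum_insert hk,
        add_sub_cancel_left]
      exact Finset.sum_congr rfl fun e _ => by rw [smul_eq_mul, mul_comm])
  refine ⟨χ, hχ, H ▸ sum_mem fun e he => ?_⟩
  have hne : (e : κ) ≠ k := fun h => Finset.ne_of_mem_erase he (Subtype.ext h)
  exact Ideal.mul_mem_right _ _
    (Ideal.subset_span ⟨e, (Finset.mem_insert.1 e.2).resolve_left hne, rfl⟩)

/-- The anticommuting generators `dx` and those of given finite families of ghosts `C^α`, antifields
`φ*_i` and antifields `C*_Δ`. -/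
def oddIn (C : Finset (Fin q × MIdx n)) (E : Finset (Fin m × MIdx n))
    (H : Finset (Fin r × MIdx n)) : OddGen n m q r → Prop
  | .dx _ => True
  | .ghost α J => (α, J) ∈ C
  | .antifield i J => (i, J) ∈ E
  | .antighost2 Δ J => (Δ, J) ∈ H

/-- The commuting generators of given finite families of ghosts of ghosts `C^Δ` and antifields
`C*_α`. -/
def evenIn (C : Finset (Fin r × MIdx n)) (G : Finset (Fin q × MIdx n)) : EvenGen n q r → Prop
  | .ghost2 Δ J => (Δ, J) ∈ C
  | .antighost α J => (α, J) ∈ G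

theorem ofFun_mem_genAlg (P : OddGen n m q r → Prop) (Q : EvenGen n q r → Prop)
    (f : LocFun n m) : (ofFun f : Form n m q r) ∈ genAlg n m q r P Q :=
  single_mem_formsOn (S := {M | M.Uses P Q}) ⟨by simp, by simp⟩ f

variable {T : GaugeTheory n m q r}

theorem delta_mem_genAlg_equations {C : Finset (Fin q × MIdx n)} {E : Finset (Fin m × MIdx n)}
    {C' : Finset (Fin r × MIdx n)} {a : Form n m q r}
    (ha : a ∈ genAlg n m q r (oddIn C E ∅) (evenIn C' ∅)) :
    T.delta a ∈ genAlg n m q r (oddIn C E ∅) (evenIn C' ∅) := by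
  refine rightDer_mem_genAlg (fun g hg => ?_) (fun g hg => ?_) ha
  · cases g with
    | dx μ => exact zero_mem _
    | ghost α J => exact zero_mem _
    | antifield i J => exact T.deltaOdd_antifield (i, J) ▸ ofFun_mem_genAlg _ _ _
    | antighost2 Δ J => simp [oddIn] at hg
  · cases g with
    | ghost2 Δ J => exact zero_mem _
    | antighost α J => simp [evenIn] at hg

/-- If only the antifields `φ*_i` in `E` are present, then `δ` takes values in the ideal generated
by the equations of motion in `E`. -/
theorem delta_apply_mem_span {C : Finset (Fin q × MIdx n)} {E : Finset (Fin m × MIdx n)}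
    {C' : Finset (Fin r × MIdx n)} {a : Form n m q r}
    (ha : a ∈ genAlg n m q r (oddIn C E ∅) (evenIn C' ∅)) (N : Mono n m q r) :
    T.delta a N ∈ Ideal.span (T.eqJet '' E) := by
  let I : Submodule (LocFun n m) (Form n m q r) :=
    { carrier := {x | ∀ N, x N ∈ Ideal.span (T.eqJet '' E)}
      zero_mem' := fun N => zero_mem _
      add_mem' := fun hx hy N => add_mem (hx N) (hy N)
      smul_mem' := fun f x hx N => Ideal.mul_mem_left _ f (hx N) }
  suffices T.delta a ∈ I from this N
  refine supported_induction (P := fun a => T.delta a ∈ I) (by simp)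
    (fun x y hx hy => by rw [map_add]; exact add_mem hx hy) (fun M hM f => ?_) a ha
  rw [GaugeTheory.delta, rightDer_single]
  refine add_mem (sum_mem fun g hg => zsmul_mem ?_ _) (sum_mem fun g hg => nsmul_mem ?_ _)
  · have hg' := hM.1 g hg
    cases g with
    | dx μ => simp [GaugeTheory.deltaOdd]
    | ghost α J => simp [GaugeTheory.deltaOdd]
    | antifield i J =>
      rw [T.deltaOdd_antifield (i, J), wedge_ofFun_right]
      intro N
      rw [Finsupp.smul_apply, smul_eq_mul]
      exact Ideal.mul_mem_right _ _ (neg_mem (Ideal.subset_span ⟨(i, J), hg', rfl⟩))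
    | antighost2 Δ J => simp [oddIn] at hg'
  · have hg' := hM.2 g hg
    cases g with
    | ghost2 Δ J => simp [GaugeTheory.deltaEven]
    | antighost α J => simp [evenIn] at hg'

/-- Finitely many local conditions on multiples hold for a common multiple. -/
theorem exists_common_multiple {ι : Type*} (s : Finset ι) (I : ι → Ideal (LocFun n m))
    (g : ι → LocFun n m) (u : Jet n m)
    (h : ∀ i ∈ s, ∃ χ : LocFun n m, χ.eval u ≠ 0 ∧ χ * g i ∈ I i) :
    ∃ χ : LocFun n m, χ.eval u ≠ 0 ∧ ∀ i ∈ s, χ * g i ∈ I i := by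
  classical
  choose! χ hχ hI using h
  refine ⟨∏ i ∈ s, χ i, ?_, fun i hi => ?_⟩
  · rw [LocFun.eval_prod, Finset.prod_ne_zero_iff]
    exact hχ
  · rw [← Finset.mul_prod_erase s χ hi, mul_comm (χ i), mul_assoc]
    exact Ideal.mul_mem_left _ _ (hI i hi)

/-- Acyclicity of the Koszul complex of equations of motion with independent differentials. -/
theorem GaugeTheory.BRSTDifferential.exists_koszul (s : T.BRSTDifferential)
    (C : Finset (Fin q × MIdx n)) (C' : Finset (Fin r × MIdx n)) {u : Jet n m}
    {F : Finset (Fin m × MIdx n)}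
    (hind : LinearIndependent ℝ fun (e : F) (c : Coord n m) => (pd c (T.eqJet e)).eval u) {j : ℤ}
    (hj : 1 ≤ j) {a : Form n m q r}
    (ha : a ∈ formsOn n m q r {M | M.Uses (oddIn C F ∅) (evenIn C' ∅) ∧ M.antigh = j})
    (hδa : T.delta a = 0) :
    ∃ χ : LocFun n m, χ.eval u ≠ 0 ∧
      ∃ b ∈ formsOn n m q r {M | M.Uses (oddIn C F ∅) (evenIn C' ∅) ∧ M.antigh = j + 1},
        T.delta b = χ • a := by
  classical
  induction F using Finset.induction_on generalizing j a with
  | empty =>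
    have : a = 0 := by
      refine Finsupp.ext fun M => ?_
      by_contra hM
      obtain ⟨h1, h2⟩ := mem_formsOn.1 ha M hM
      have : M.antigh = 0 := by
        rw [Mono.antigh, Finsupp.sum, Finset.sum_eq_zero, Finset.sum_eq_zero, add_zero]
        · intro g hg
          have := h1.2 g hg
          cases g <;> simp_all [evenIn, EvenGen.antigh]
        · intro g hg
          have := h1.1 g hg
          cases g <;> simp_all [oddIn, OddGen.antigh]
      omega
    exact ⟨1, by simp, 0, zero_mem _, by simp [this]⟩
  | insert k F hk ih =>
    have hindF : LinearIndependent ℝ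
        fun (e : F) (c : Coord n m) => (pd c (T.eqJet e)).eval u :=
      hind.comp (fun e : F => (⟨e, Finset.mem_insert_of_mem e.2⟩ : (insert k F : Finset _)))
        fun e e' h => Subtype.ext (Subtype.ext_iff.1 h :)
    let φ : OddGen n m q r := .antifield k.1 k.2
    -- the forms of antighost number `j` without the antifield `φ*_k`
    let S : ℤ → Set (Mono n m q r) :=
      fun j => {M | M.Uses (oddIn C F ∅) (evenIn C' ∅) ∧ M.antigh = j}
    have hSsub : ∀ j, S j ⊆
        {M | M.Uses (oddIn C (insert k F) ∅) (evenIn C' ∅) ∧ M.antigh = j} := by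
      rintro j M ⟨h1, h2⟩
      refine ⟨⟨fun g hg => ?_, h1.2⟩, h2⟩
      have := h1.1 g hg
      cases g with
      | antifield i J => exact Finset.mem_insert_of_mem this
      | _ => exact this
    have hSφ : ∀ j, S j ⊆ {M | φ ∉ M.odd} := by
      rintro j M ⟨h1, -⟩ hφ
      exact hk (h1.1 _ hφ)
    have hwφ : ∀ j, ∀ x ∈ formsOn n m q r (S j), wedge x (oddGen φ) ∈ formsOn n m q r
        {M | M.Uses (oddIn C (insert k F) ∅) (evenIn C' ∅) ∧ M.antigh = j + 1} := by
      intro j x hx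
      refine wedge_mem_supported (B := {oddMono φ}) ?_ (formsOn_mono (hSsub j) hx)
        (Finsupp.single_mem_supported _ _ rfl)
      rintro M ⟨h1, h2⟩ _ rfl hd
      refine ⟨h1.mul (uses_oddMono (Finset.mem_insert_self k F)), ?_⟩
      rw [Mono.antigh_eq_weight, Mono.weight_mul _ _ hd, weight_oddMono, ← h2]
      rfl
    have hδS : ∀ j, ∀ x ∈ formsOn n m q r (S j), T.delta x ∈ formsOn n m q r (S (j - 1)) := by
      intro j x hx
      have h1 := delta_mem_genAlg_equations (T := T) (formsOn_mono (fun M hM => hM.1) hx)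
      have h2 := s.delta_antigh (fun M hM => hM.2) hx
      rw [mem_formsOn] at h1 h2 ⊢
      exact fun M hM => ⟨h1 M hM, h2 M hM⟩
    -- `a = a₀ + a₁ φ*_k`
    obtain ⟨a₁, ha₁⟩ : ∃ a₁, a₁ = contrOdd φ a := ⟨_, rfl⟩
    obtain ⟨a₀, ha₀⟩ : ∃ a₀, a₀ = a - wedge a₁ (oddGen φ) := ⟨_, rfl⟩
    have hdec : a = a₀ + wedge a₁ (oddGen φ) := by rw [ha₀]; abel
    have hS' : ∀ M : Mono n m q r, M.Uses (oddIn C (insert k F) ∅) (evenIn C' ∅) → φ ∉ M.odd →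
        M.Uses (oddIn C F ∅) (evenIn C' ∅) := by
      rintro M h1 h2
      refine ⟨fun g hg => ?_, h1.2⟩
      have := h1.1 g hg
      cases g with
      | antifield i J =>
        refine (Finset.mem_insert.1 this).resolve_left ?_
        rintro rfl
        exact h2 hg
      | _ => exact this
    have ha₁S : a₁ ∈ formsOn n m q r (S (j - 1)) := by
      rw [ha₁]
      refine contrOdd_mem ?_ ha
      rintro M ⟨h1, h2⟩ hφ
      refine ⟨hS' _ (h1.erase φ) (Finset.notMem_erase φ M.odd), ?_⟩
      have := Mono.weight_erase OddGen.antigh EvenGen.antigh hφ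
      rw [← Mono.antigh_eq_weight, ← Mono.antigh_eq_weight, h2] at this
      rw [← this]
      exact (add_sub_cancel_right _ (1 : ℤ)).symm
    have ha₀S : a₀ ∈ formsOn n m q r (S j) := by
      rw [ha₀, ha₁]
      refine formsOn_mono ?_ (sub_contrOdd_mem ha)
      rintro M ⟨⟨h1, h2⟩, h3⟩
      exact ⟨hS' M h1 h3, h2⟩
    have hδφ : ∀ x, T.delta (wedge x (oddGen φ)) =
        -(T.eqJet k • x) - wedge (T.delta x) (oddGen φ) := by
      intro x
      rw [s.delta_wedge_oddGen, T.deltaOdd_antifield, wedge_ofFun_right, neg_smul]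
    have hsplit : (T.delta a₀ - T.eqJet k • a₁) - wedge (T.delta a₁) (oddGen φ) = 0 := by
      rw [← hδa, hdec, map_add, hδφ]
      abel
    have h0S : T.delta a₀ - T.eqJet k • a₁ ∈ formsOn n m q r (S (j - 1)) :=
      sub_mem (hδS _ _ ha₀S) (Submodule.smul_mem _ _ ha₁S)
    have hδa₁ : T.delta a₁ = 0 := by
      have := congrArg (contrOdd φ) hsplit
      rw [map_sub, contrOdd_eq_zero (formsOn_mono (hSφ _) h0S), contrOdd_wedge_oddGen, if_pos rfl,
        contrOdd_eq_zero (formsOn_mono (hSφ _) (hδS _ _ ha₁S)), wedge_zero_left, map_zero] at this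
      simpa using this
    have hδa₀ : T.delta a₀ = T.eqJet k • a₁ := by
      rw [hδa₁, wedge_zero_left, sub_zero, sub_eq_zero] at hsplit
      exact hsplit
    -- the coefficient `a₁` is locally exact
    obtain ⟨χ, hχ, b₁, hb₁, hδb₁⟩ : ∃ χ : LocFun n m, χ.eval u ≠ 0 ∧
        ∃ b ∈ formsOn n m q r (S j), T.delta b = χ • a₁ := by
      -- for `j = 1` the coefficients of `a₁` times the equation `k` lie in the ideal generated by
      -- the equations in `F`, modulo which the equation `k` is not a zero divisor
      by_cases hj1 : j = 1
      · obtain ⟨χ, hχ, hI⟩ := exists_common_multiple a₁.support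
          (fun _ => Ideal.span (T.eqJet '' F)) (fun M => a₁ M) u (fun M _ => by
            refine exists_mul_mem_span hk hind ?_
            have h1 := delta_apply_mem_span (T := T)
              (formsOn_mono (fun M hM => hM.1) ha₀S) M
            rwa [hδa₀] at h1)
        refine ⟨χ, hχ, ?_⟩
        have key : ∀ M ∈ S 0, ∀ f ∈ Ideal.span (T.eqJet '' F),
            ∃ b ∈ formsOn n m q r (S 1), T.delta b = Finsupp.single M f := by
          intro M hM f hf
          refine Submodule.span_induction (p := fun f _ => ∃ b ∈ formsOn n m q r (S 1),
            T.delta b = Finsupp.single M f) ?_ ⟨0, zero_mem _, by simp⟩ ?_ ?_ hf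
          · rintro _ ⟨e, he, rfl⟩
            refine ⟨-wedge (Finsupp.single M 1) (oddGen (.antifield e.1 e.2)), neg_mem ?_, ?_⟩
            · refine wedge_mem_supported (A := {M}) (B := {oddMono (.antifield e.1 e.2)}) ?_
                (Finsupp.single_mem_supported _ _ rfl) (Finsupp.single_mem_supported _ _ rfl)
              rintro _ rfl _ rfl hd
              refine ⟨hM.1.mul (uses_oddMono he), ?_⟩
              rw [Mono.antigh_eq_weight, Mono.weight_mul _ _ hd, weight_oddMono,
                ← Mono.antigh_eq_weight, hM.2]
              rfl
            · have h0 : T.delta (Finsupp.single M 1) = 0 := by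
                refine eq_zero_of_mem_piece_neg (j := M.antigh - 1) (Or.inl ?_)
                  (s.delta_piece (single_mem_piece M 1))
                rw [hM.2]; norm_num
              rw [map_neg, s.delta_wedge_oddGen, h0, T.deltaOdd_antifield, wedge_ofFun_right]
              simp
          · rintro f f' - - ⟨b, hb, h⟩ ⟨b', hb', h'⟩
            exact ⟨b + b', add_mem hb hb', by rw [map_add, h, h', Finsupp.single_add]⟩
          · rintro c f - ⟨b, hb, h⟩
            exact ⟨c • b, Submodule.smul_mem _ _ hb, by rw [map_smul, h, Finsupp.smul_single]⟩
        subst hj1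
        have hk2 : ∀ M ∈ a₁.support, ∃ b ∈ formsOn n m q r (S 1),
            T.delta b = Finsupp.single M (χ * a₁ M) := fun M hM =>
          key M (by simpa using ha₁S hM) _ (hI M hM)
        choose! b hb hδb using hk2
        refine ⟨∑ M ∈ a₁.support, b M, sum_mem hb, ?_⟩
        rw [map_sum, Finset.sum_congr rfl hδb]
        conv_rhs => rw [← Finsupp.sum_single a₁]
        rw [Finsupp.sum, Finset.smul_sum]
        exact Finset.sum_congr rfl fun M _ => by rw [Finsupp.smul_single, smul_eq_mul]
      · obtain ⟨χ, hχ, b, hb, h⟩ := ih hindF (by omega : 1 ≤ j - 1) ha₁S hδa₁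
        exact ⟨χ, hχ, b, by rwa [sub_add_cancel] at hb, h⟩
    -- subtracting `δ (b₁ φ*_k)` removes `a₁`, and leaves a cycle without `φ*_k`
    obtain ⟨χ', hχ', b₂, hb₂, hδb₂⟩ := ih hindF hj (a := χ • a₀ - T.eqJet k • b₁)
      (sub_mem (Submodule.smul_mem _ _ ha₀S) (Submodule.smul_mem _ _ hb₁)) (by
        rw [map_sub, map_smul, map_smul, hδb₁, hδa₀, smul_comm, sub_self])
    refine ⟨χ' * χ, by simp [hχ, hχ'], b₂ - χ' • wedge b₁ (oddGen φ),
      sub_mem (formsOn_mono (hSsub _) hb₂) (Submodule.smul_mem _ _ (hwφ _ _ hb₁)), ?_⟩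
    rw [map_sub, map_smul, hδb₂, hδφ, hδb₁, hdec, wedge_smul_left, mul_smul, smul_add,
      smul_add, smul_sub, smul_sub, smul_neg]
    abel

end Koszul

/-! ### Local acyclicity: dependent equations and identities -/

section Pairs

variable {n m q r : ℕ}

/-- A matrix of local functions which is invertible at `u` has an inverse up to a factor that does
not vanish at `u`: its determinant. -/
theorem exists_adjugate {κ ι : Type*} [DecidableEq κ] [DecidableEq ι] (A : Finset κ) (B : Finset ι)
    (N : κ → ι → LocFun n m) {u : Jet n m}
    (h : Function.Bijective fun (v : B → ℝ) (a : A) => ∑ b : B, (N a b).eval u * v b) :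
    ∃ d : LocFun n m, d.eval u ≠ 0 ∧ ∃ N' : ι → κ → LocFun n m,
      (∀ b ∈ B, ∀ b' ∈ B, ∑ a ∈ A, N' b a * N a b' = if b = b' then d else 0) ∧
      ∀ a ∈ A, ∀ a' ∈ A, ∑ b ∈ B, N a b * N' b a' = if a = a' then d else 0 := by
  let L : (B → ℝ) →ₗ[ℝ] A → ℝ :=
    { toFun := fun v a => ∑ b : B, (N a b).eval u * v b
      map_add' := fun v w => by
        funext a
        simp only [Pi.add_apply, mul_add, Finset.sum_add_distrib]
      map_smul' := fun t v => by
        funext a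
        simp only [Pi.smul_apply, smul_eq_mul, RingHom.id_apply, Finset.mul_sum]
        exact Finset.sum_congr rfl fun b _ => by ring }
  have hcard : Fintype.card A = Fintype.card B := by
    have := (LinearEquiv.ofBijective L h).finrank_eq
    simpa using this.symm
  let e : A ≃ B := Fintype.equivOfCardEq hcard
  let M : Matrix A A (LocFun n m) := Matrix.of fun a a' => N a (e a')
  refine ⟨M.det, ?_, fun b a => if hb : b ∈ B then if ha : a ∈ A then
    M.adjugate (e.symm ⟨b, hb⟩) ⟨a, ha⟩ else 0 else 0, ?_, ?_⟩
  · have h1 : M.det.eval u = (M.map (LocFun.evalHom u)).det :=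
      RingHom.map_det (LocFun.evalHom u) M
    rw [h1]
    refine IsUnit.ne_zero ((Matrix.isUnit_iff_isUnit_det _).1 ?_)
    rw [← Matrix.mulVec_injective_iff_isUnit]
    intro v w hvw
    have h2 : ∀ v : A → ℝ, (M.map (LocFun.evalHom u)).mulVec v = L (v ∘ e.symm) := by
      intro v
      funext a
      simp only [Matrix.mulVec, dotProduct, Matrix.map_apply, M, Matrix.of_apply]
      exact Fintype.sum_equiv e _ _ fun a' => by
        rw [Function.comp_apply, Equiv.symm_apply_apply]
        rfl
    rw [h2, h2] at hvw
    have := h.1 hvw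
    funext a
    simpa using congrFun this (e a)
  · intro b hb b' hb'
    rw [← Finset.sum_coe_sort A]
    have := congrFun (congrFun (Matrix.adjugate_mul M) (e.symm ⟨b, hb⟩)) (e.symm ⟨b', hb'⟩)
    rw [Matrix.mul_apply, Matrix.smul_apply, Matrix.one_apply] at this
    simp only [e.symm.injective.eq_iff, Subtype.mk.injEq, M, Matrix.of_apply,
      Equiv.apply_symm_apply, smul_eq_mul, mul_ite, mul_one, mul_zero] at this
    simpa [hb] using this
  · intro a ha a' ha'
    rw [← Finset.sum_coe_sort B, ← Fintype.sum_equiv e (fun c : A => N a (e c) *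
      M.adjugate c ⟨a', ha'⟩)]
    · have := congrFun (congrFun (Matrix.mul_adjugate M) ⟨a, ha⟩) ⟨a', ha'⟩
      rw [Matrix.mul_apply, Matrix.smul_apply, Matrix.one_apply] at this
      simpa [M] using this
    · intro c
      simp [ha']

/-- The values on the anticommuting generators of a derivation that maps antifields `φ*_i` to
antifields `C*_α`. -/
def contractingOdd (B : Finset (Fin m × MIdx n)) (A : Finset (Fin q × MIdx n))
    (N : Fin m × MIdx n → Fin q × MIdx n → LocFun n m) : OddGen n m q r → Form n m q r
  | .antifield i J =>
    if (i, J) ∈ B then ∑ a ∈ A, N (i, J) a • evenGen (.antighost a.1 a.2) else 0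
  | _ => 0

/-- The values on the commuting generators of a derivation that maps antifields `C*_α` to
antifields `C*_Δ`. -/
def contractingEven (A : Finset (Fin q × MIdx n)) (H : Finset (Fin r × MIdx n))
    (N : Fin q × MIdx n → Fin r × MIdx n → LocFun n m) : EvenGen n q r → Form n m q r
  | .antighost α J =>
    if (α, J) ∈ A then ∑ b ∈ H, N (α, J) b • oddGen (.antighost2 b.1 b.2) else 0
  | .ghost2 _ _ => 0

/-- Weights of the anticommuting generators. The antifields `φ*_i` of independent equations have
weight zero, and that of `C*_Δ` exceeds that of the products `φ*_i C*_α` for independent identities. -/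
def weightOdd (E₁ : Finset (Fin m × MIdx n)) : OddGen n m q r → ℕ
  | .antifield i J => if (i, J) ∈ E₁ then 0 else 1
  | .antighost2 _ _ => 4
  | _ => 0

/-- Weights of the commuting generators. That of the `C*_α` for dependent identities exceeds that of
the products `φ*_i φ*_j` and of the `C*_α` for independent identities. -/
def weightEven (G₁ : Finset (Fin q × MIdx n)) : EvenGen n q r → ℕ
  | .antighost α J => if (α, J) ∈ G₁ then 2 else 3
  | .ghost2 _ _ => 0

variable {T : GaugeTheory n m q r}

theorem oddGen_mem_formsOn {S : Set (Mono n m q r)} {g : OddGen n m q r} (hg : oddMono g ∈ S) :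
    (oddGen g : Form n m q r) ∈ formsOn n m q r S :=
  single_mem_formsOn hg 1

theorem evenGen_mem_formsOn {S : Set (Mono n m q r)} {g : EvenGen n q r} (hg : evenMono g ∈ S) :
    (evenGen g : Form n m q r) ∈ formsOn n m q r S :=
  single_mem_formsOn hg 1

/-- Around the points of the surface defined by the equations of motion, each `δ`-cycle is
homologous to one that contains, among the antifields, only the `φ*_i` of independent equations. -/
theorem GaugeTheory.BRSTDifferential.exists_homologous_independent (s : T.BRSTDifferential)
    (C : Finset (Fin q × MIdx n)) (C' : Finset (Fin r × MIdx n)) {E E₁ : Finset (Fin m × MIdx n)}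
    {G G₁ : Finset (Fin q × MIdx n)} {H : Finset (Fin r × MIdx n)} (hcl : T.Closed E G H)
    (hE₁ : E₁ ⊆ E) (hG₁ : G₁ ⊆ G) {u : Jet n m}
    (hN : Function.Bijective fun (v : (E \ E₁ : Finset _) → ℝ) (a : G₁) =>
      ∑ e : (E \ E₁ : Finset _), (T.noetherCoeff a e).eval u * v e)
    (hR : Function.Bijective fun (v : (G \ G₁ : Finset _) → ℝ) (b : H) =>
      ∑ a : (G \ G₁ : Finset _), (T.reducibilityCoeff b a).eval u * v a)
    {a : Form n m q r} (ha : a ∈ genAlg n m q r (oddIn C E H) (evenIn C' G))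
    (hδa : T.delta a = 0) :
    ∃ χ : LocFun n m, χ.eval u ≠ 0 ∧ ∃ c ∈ genAlg n m q r (oddIn C E H) (evenIn C' G),
      χ • a - T.delta c ∈ genAlg n m q r (oddIn C E₁ ∅) (evenIn C' ∅) := by
  obtain ⟨d, hd, B, hB, hB'⟩ := exists_adjugate G₁ (E \ E₁) T.noetherCoeff hN
  obtain ⟨d', hd', D, hD, hD'⟩ := exists_adjugate H (G \ G₁) T.reducibilityCoeff hR
  -- a common factor for both inverses
  obtain ⟨f, hf⟩ : ∃ f, f = d * d' := ⟨_, rfl⟩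
  obtain ⟨N, hNdef⟩ : ∃ N : Fin m × MIdx n → Fin q × MIdx n → LocFun n m,
    N = fun e a => d' * B e a := ⟨_, rfl⟩
  obtain ⟨N', hN'def⟩ : ∃ N' : Fin q × MIdx n → Fin r × MIdx n → LocFun n m,
    N' = fun a b => d * D a b := ⟨_, rfl⟩
  have hNl : ∀ e ∈ E \ E₁, ∀ e' ∈ E \ E₁, ∑ a ∈ G₁, N e a * T.noetherCoeff a e' =
      if e = e' then f else 0 := by
    intro e he e' he'
    simp only [hNdef, mul_assoc, ← Finset.mul_sum, hB e he e' he', hf]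
    split_ifs <;> ring
  have hNr : ∀ a ∈ G₁, ∀ a' ∈ G₁, ∑ e ∈ E \ E₁, T.noetherCoeff a e * N e a' =
      if a = a' then f else 0 := by
    intro a ha a' ha'
    simp only [hNdef, mul_left_comm _ d', ← Finset.mul_sum, hB' a ha a' ha', hf]
    split_ifs <;> ring
  have hN'l : ∀ a ∈ G \ G₁, ∀ a' ∈ G \ G₁, ∑ b ∈ H, N' a b * T.reducibilityCoeff b a' =
      if a = a' then f else 0 := by
    intro a ha a' ha'
    simp only [hN'def, mul_assoc, ← Finset.mul_sum, hD a ha a' ha', hf]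
    split_ifs <;> ring
  have hN'r : ∀ b ∈ H, ∀ b' ∈ H, ∑ a ∈ G \ G₁, T.reducibilityCoeff b a * N' a b' =
      if b = b' then f else 0 := by
    intro b hb b' hb'
    simp only [hN'def, mul_left_comm _ d, ← Finset.mul_sum, hD' b hb b' hb', hf]
    split_ifs <;> ring
  let P := oddIn C E H
  let Q := evenIn C' G
  let wo : OddGen n m q r → ℕ := weightOdd E₁
  let we : EvenGen n q r → ℕ := weightEven G₁
  -- up to the factor `f`, the derivation `σ` inverts the part of `δ` that maps the `C*_α` of
  -- independent identities to the `φ*_i` of dependent equations, and the `C*_Δ` to the `C*_α` of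
  -- dependent identities
  let σ : Form n m q r →ₗ[LocFun n m] Form n m q r :=
    rightDer (contractingOdd (E \ E₁) G₁ N) (contractingEven (G \ G₁) H N')
  have hσ : IsRightDer 1 (σ.restrictScalars ℝ) := by
    refine isRightDer_rightDer (fun g => ?_) fun g => ?_
    · cases g with
      | antifield i J =>
        simp only [contractingOdd]
        split_ifs
        · rw [parityPiece_congr (p := 1 + 1) (p' := 0) rfl]
          exact sum_mem fun a _ => Submodule.smul_mem _ _ (evenGen_mem_parityPiece _)
        · exact zero_mem _
      | _ => exact zero_mem _
    · cases g with
      | antighost α J =>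
        simp only [contractingEven]
        split_ifs
        · exact sum_mem fun a _ => Submodule.smul_mem _ _ (oddGen_mem_parityPiece _)
        · exact zero_mem _
      | _ => exact zero_mem _
  have hσo : ∀ g, σ (oddGen g) = contractingOdd (E \ E₁) G₁ N g := fun g => rightDer_oddGen _ _ g
  have hσe : ∀ g, σ (evenGen g) = contractingEven (G \ G₁) H N' g :=
    fun g => rightDer_evenGen _ _ g
  have hδo : ∀ g, T.delta (oddGen g) = T.deltaOdd g := fun g => rightDer_oddGen _ _ g
  have hδe : ∀ g, T.delta (evenGen g) = T.deltaEven g := fun g => rightDer_evenGen _ _ g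
  have hσφ : ∀ e ∈ E \ E₁, σ (oddGen (.antifield e.1 e.2)) =
      ∑ a ∈ G₁, N e a • evenGen (.antighost a.1 a.2) := by
    intro e he
    rw [hσo, contractingOdd, if_pos he]
  have hσφ' : ∀ e ∈ E₁, σ (oddGen (.antifield e.1 e.2)) = 0 := by
    intro e he
    rw [hσo, contractingOdd, if_neg]
    exact fun h => (Finset.mem_sdiff.1 h).2 he
  have hσC : ∀ a ∈ G \ G₁, σ (evenGen (.antighost a.1 a.2)) =
      ∑ b ∈ H, N' a b • oddGen (.antighost2 b.1 b.2) := by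
    intro a ha
    rw [hσe, contractingEven, if_pos ha]
  have hσC' : ∀ a ∈ G₁, σ (evenGen (.antighost a.1 a.2)) = 0 := by
    intro a ha
    rw [hσe, contractingEven, if_neg]
    exact fun h => (Finset.mem_sdiff.1 h).2 ha
  have hδC : ∀ a ∈ G, T.deltaEven (.antighost a.1 a.2) =
      ∑ e ∈ E, T.noetherCoeff a e • (oddGen (.antifield e.1 e.2) : Form n m q r) :=
    fun a ha => s.deltaEven_antighost (hcl.noether a ha)
  have hσδC : ∀ a ∈ G, σ (T.delta (evenGen (.antighost a.1 a.2))) =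
      ∑ a' ∈ G₁, (∑ e ∈ E \ E₁, T.noetherCoeff a e * N e a') • evenGen (.antighost a'.1 a'.2) := by
    intro a ha
    rw [hδe, hδC a ha, map_sum, ← Finset.sum_sdiff hE₁]
    rw [Finset.sum_eq_zero (s := E₁) fun e he => by rw [map_smul, hσφ' e he, smul_zero], add_zero]
    simp only [Finset.sum_smul, mul_smul]
    rw [Finset.sum_comm]
    refine Finset.sum_congr rfl fun e he => ?_
    rw [map_smul, hσφ e he, Finset.smul_sum]
  -- the part of `δ C*_Δ` quadratic in the `φ*_i`
  have hQ : ∀ b ∈ H, ∃ Q' ∈ formsOn n m q r {M | (∀ g ∈ M.odd, ∃ e ∈ E,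
      g = .antifield e.1 e.2) ∧ M.odd.card = 2 ∧ M.even = 0},
      T.deltaOdd (.antighost2 b.1 b.2) =
        ∑ a ∈ G, T.reducibilityCoeff b a • (evenGen (.antighost a.1 a.2) : Form n m q r) + Q' :=
    fun b hb => s.deltaOdd_antighost2 (hcl.reducibility b hb) (hcl.quadratic b hb)
  choose! Q' hQ'mem hQ' using hQ
  have huseφ : ∀ e ∈ E, (oddMono (.antifield e.1 e.2) : Mono n m q r).Uses P Q :=
    fun e he => uses_oddMono he
  have huseC : ∀ a ∈ G, (evenMono (.antighost a.1 a.2) : Mono n m q r).Uses P Q :=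
    fun a ha => uses_evenMono ha
  have hwφ : ∀ e : Fin m × MIdx n, wo (.antifield e.1 e.2) ≤ 1 := by
    intro e
    simp only [wo, weightOdd]
    split_ifs <;> omega
  have hwC : ∀ a ∈ G₁, we (.antighost a.1 a.2) = 2 := fun a ha => by
    simp only [we, weightEven, if_pos ha]
  have hσPQ : ∀ a ∈ genAlg n m q r P Q, σ a ∈ genAlg n m q r P Q := by
    intro a ha
    refine rightDer_mem_genAlg (fun g hg => ?_) (fun g hg => ?_) ha
    · cases g with
      | antifield i J =>
        simp only [contractingOdd]
        split_ifs
        · exact sum_mem fun a ha => Submodule.smul_mem _ _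
            (evenGen_mem_formsOn (huseC a (hG₁ ha)))
        · exact zero_mem _
      | _ => exact zero_mem _
    · cases g with
      | antighost α J =>
        simp only [contractingEven]
        split_ifs
        · exact sum_mem fun a ha => Submodule.smul_mem _ _
            (oddGen_mem_formsOn (uses_oddMono ha))
        · exact zero_mem _
      | _ => exact zero_mem _
  have ho : ∀ g, P g → T.delta (σ (oddGen g)) + σ (T.delta (oddGen g)) -
      (if wo g = 0 then 0 else f) • oddGen g ∈
        formsOn n m q r {M | M.Uses P Q ∧ M.weight wo we + 1 ≤ wo g} := by
    intro g hg
    cases g with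
    | dx μ =>
      simp [hδo, hσo, contractingOdd, GaugeTheory.deltaOdd, wo, weightOdd]
    | ghost α J =>
      simp [hδo, hσo, contractingOdd, GaugeTheory.deltaOdd, wo, weightOdd]
    | antifield i J =>
      have h0 : σ (T.delta (oddGen (.antifield i J))) = 0 := by
        rw [hδo, T.deltaOdd_antifield (i, J)]
        exact rightDer_ofFun _ _ _
      have hg' : (i, J) ∈ E := hg
      rw [h0, add_zero]
      by_cases h1 : (i, J) ∈ E₁
      · rw [hσφ' (i, J) h1, map_zero, zero_sub]
        simp [wo, weightOdd, h1]
      · have h2 : (i, J) ∈ E \ E₁ := Finset.mem_sdiff.2 ⟨hg', h1⟩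
        have h3 : wo (.antifield i J) = 1 := by simp [wo, weightOdd, h1]
        have e1 : T.delta (σ (oddGen (.antifield i J))) =
            ∑ e ∈ E, (∑ a ∈ G₁, N (i, J) a * T.noetherCoeff a e) •
              (oddGen (.antifield e.1 e.2) : Form n m q r) := by
          rw [hσφ (i, J) h2, map_sum]
          simp only [Finset.sum_smul, mul_smul]
          rw [Finset.sum_comm]
          refine Finset.sum_congr rfl fun a ha => ?_
          rw [map_smul, hδe, hδC a (hG₁ ha), Finset.smul_sum]
        rw [e1, ← Finset.sum_sdiff hE₁, Finset.sum_congr (s₁ := E \ E₁) rfl fun e he => by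
          rw [hNl (i, J) h2 e he]]
        simp only [h3, one_ne_zero, if_false, ite_smul, zero_smul]
        rw [Finset.sum_ite_eq, if_pos h2, add_sub_cancel_left]
        refine sum_mem fun e he => Submodule.smul_mem _ _ (oddGen_mem_formsOn ⟨huseφ e (hE₁ he), ?_⟩)
        rw [weight_oddMono]
        simp [wo, weightOdd, he]
    | antighost2 Δ J =>
      have hb : (Δ, J) ∈ H := hg
      have h0 : σ (oddGen (.antighost2 Δ J)) = 0 := by rw [hσo]; rfl
      have h3 : wo (.antighost2 Δ J) = 4 := rfl
      have e1 : σ (T.delta (oddGen (.antighost2 Δ J))) =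
          f • oddGen (.antighost2 Δ J) + σ (Q' (Δ, J)) := by
        rw [hδo, hQ' (Δ, J) hb, map_add, map_sum, ← Finset.sum_sdiff hG₁]
        rw [Finset.sum_eq_zero (s := G₁) fun a ha => by rw [map_smul, hσC' a ha, smul_zero],
          add_zero]
        congr 1
        have e2 : ∑ a ∈ G \ G₁, σ (T.reducibilityCoeff (Δ, J) a • evenGen (.antighost a.1 a.2)) =
            ∑ b ∈ H, (∑ a ∈ G \ G₁, T.reducibilityCoeff (Δ, J) a * N' a b) •
              (oddGen (.antighost2 b.1 b.2) : Form n m q r) := by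
          simp only [Finset.sum_smul, mul_smul]
          rw [Finset.sum_comm]
          refine Finset.sum_congr rfl fun a ha => ?_
          rw [map_smul, hσC a ha, Finset.smul_sum]
        rw [e2, Finset.sum_congr rfl fun b hb' => by rw [hN'r (Δ, J) hb b hb']]
        simp only [ite_smul, zero_smul]
        rw [Finset.sum_ite_eq, if_pos hb]
      rw [h0, map_zero, zero_add, e1, h3, if_neg (by norm_num), add_sub_cancel_left]
      refine map_mem_formsOn (X := σ.toAddMonoidHom) ?_ (hQ'mem (Δ, J) hb)
      rintro M ⟨hM1, hM2, hM3⟩ f'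
      refine rightDer_single_mem (fun g hg f'' => ?_) (fun g hg => ?_) f'
      · obtain ⟨g', hg'⟩ : ∃ g', M.odd.erase g = {g'} := by
          rw [← Finset.card_eq_one, Finset.card_erase_of_mem hg, hM2]
        obtain ⟨e', he', rfl⟩ := hM1 g' (Finset.mem_of_mem_erase (hg' ▸ Finset.mem_singleton_self g'))
        obtain ⟨e, he, rfl⟩ := hM1 g hg
        rw [hg', hM3]
        simp only [contractingOdd]
        split_ifs
        · refine wedge_mem_supported (A := {oddMono (.antifield e'.1 e'.2)})
            (B := {M | ∃ a ∈ G₁, M = evenMono (.antighost a.1 a.2)}) ?_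
            (Finsupp.single_mem_supported _ _ rfl) (sum_mem fun a ha => Submodule.smul_mem _ _
              (evenGen_mem_formsOn ⟨a, ha, rfl⟩))
          rintro _ rfl _ ⟨a, ha, rfl⟩ hd
          refine ⟨(huseφ e' he').mul (huseC a (hG₁ ha)), ?_⟩
          rw [Mono.weight_mul _ _ hd, weight_oddMono, weight_evenMono, hwC a ha]
          have := hwφ e'
          omega
        · rw [wedge_zero_right]
          exact zero_mem _
      · rw [hM3] at hg
        simp at hg
  have he : ∀ g, Q g → T.delta (σ (evenGen g)) + σ (T.delta (evenGen g)) -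
      (if we g = 0 then 0 else f) • evenGen g ∈
        formsOn n m q r {M | M.Uses P Q ∧ M.weight wo we + 1 ≤ we g} := by
    intro g hg
    cases g with
    | ghost2 Δ J =>
      simp [hδe, hσe, contractingEven, GaugeTheory.deltaEven, we, weightEven]
    | antighost α J =>
      have ha : (α, J) ∈ G := hg
      by_cases h1 : (α, J) ∈ G₁
      · have h3 : we (.antighost α J) = 2 := hwC (α, J) h1
        rw [hσδC (α, J) ha, hσC' (α, J) h1, map_zero, zero_add, h3, if_neg (by norm_num),
          Finset.sum_congr rfl fun a ha' => by rw [hNr (α, J) h1 a ha']]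
        simp only [ite_smul, zero_smul]
        rw [Finset.sum_ite_eq, if_pos h1, sub_self]
        exact zero_mem _
      · have h2 : (α, J) ∈ G \ G₁ := Finset.mem_sdiff.2 ⟨ha, h1⟩
        have h3 : we (.antighost α J) = 3 := by simp [we, weightEven, h1]
        have e1 : T.delta (σ (evenGen (.antighost α J))) =
            ∑ a ∈ G, (∑ b ∈ H, N' (α, J) b * T.reducibilityCoeff b a) •
              (evenGen (.antighost a.1 a.2) : Form n m q r) + ∑ b ∈ H, N' (α, J) b • Q' b := by
          rw [hσC (α, J) h2, map_sum]
          simp only [Finset.sum_smul, mul_smul]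
          rw [Finset.sum_comm, ← Finset.sum_add_distrib]
          refine Finset.sum_congr rfl fun b hb => ?_
          rw [map_smul, hδo, hQ' b hb, smul_add, Finset.smul_sum]
        rw [e1, ← Finset.sum_sdiff hG₁, Finset.sum_congr (s₁ := G \ G₁) rfl fun a ha => by
          rw [hN'l (α, J) h2 a ha]]
        simp only [h3, ite_smul, zero_smul]
        rw [Finset.sum_ite_eq, if_pos h2, if_neg (by norm_num), hσδC (α, J) ha]
        have hG₁mem : ∀ x : Fin q × MIdx n → LocFun n m,
            ∑ a ∈ G₁, x a • (evenGen (.antighost a.1 a.2) : Form n m q r) ∈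
              formsOn n m q r {M | M.Uses P Q ∧ M.weight wo we + 1 ≤ 3} := by
          intro x
          refine sum_mem fun a ha => Submodule.smul_mem _ _
            (evenGen_mem_formsOn ⟨huseC a (hG₁ ha), ?_⟩)
          rw [weight_evenMono, hwC a ha]
        rw [show ∀ x y z w : Form n m q r, x + y + z + w - x = y + z + w by intros; abel]
        refine add_mem (add_mem (hG₁mem _) (sum_mem fun b hb => Submodule.smul_mem _ _
          (formsOn_mono ?_ (hQ'mem b hb)))) (hG₁mem _)
        rintro M ⟨hM1, hM2, hM3⟩
        refine ⟨⟨fun g hg => ?_, fun g hg => ?_⟩, ?_⟩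
        · obtain ⟨e, he, rfl⟩ := hM1 g hg
          exact he
        · rw [hM3] at hg
          simp at hg
        · have h5 : ∑ g ∈ M.odd, wo g ≤ ∑ g ∈ M.odd, 1 := Finset.sum_le_sum fun g hg => by
            obtain ⟨e, he, rfl⟩ := hM1 g hg
            exact hwφ e
          rw [Mono.weight, hM3, Finsupp.sum_zero_index]
          rw [← Finset.card_eq_sum_ones, hM2] at h5
          omega
  obtain ⟨K, c, hc, h⟩ := exists_homologous_weight_zero s.isRightDer_delta s.delta_delta
    (fun f => rightDer_ofFun _ _ f) hσ (fun f => rightDer_ofFun _ _ f) hσPQ wo we f ho he ha hδa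
  refine ⟨f ^ K, ?_, c, hc, formsOn_mono ?_ h⟩
  · have : (f ^ K).eval u = (f.eval u) ^ K := map_pow (LocFun.evalHom u) f K
    rw [this, hf]
    exact pow_ne_zero _ (mul_ne_zero hd hd')
  · rintro M ⟨⟨h1, h2⟩, h3⟩
    rw [Mono.weight, Nat.add_eq_zero_iff, Finset.sum_eq_zero_iff, Finsupp.sum,
      Finset.sum_eq_zero_iff] at h3
    refine ⟨fun g hg => ?_, fun g hg => ?_⟩
    · have h4 := h1 g hg
      have h5 := h3.1 g hg
      cases g with
      | dx μ => trivial
      | ghost α J => exact h4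
      | antifield i J =>
        by_contra h6
        have h7 : (i, J) ∉ E₁ := h6
        simp [wo, weightOdd, h7] at h5
      | antighost2 Δ J => simp [wo, weightOdd] at h5
    · have h4 := h2 g hg
      have h5 := h3.2 g hg
      have h6 : M.even g ≠ 0 := Finsupp.mem_support_iff.1 hg
      cases g with
      | ghost2 Δ J => exact h4
      | antighost α J =>
        simp only [we, weightEven, Nat.cast_id, mul_eq_zero, h6, false_or] at h5
        split_ifs at h5

end Pairs

/-! ### Acyclicity of the Koszul-Tate differential -/

section Acyclicity

variable {n m q r : ℕ} {T : GaugeTheory n m q r}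

theorem finite_setOf_oddIn (C : Finset (Fin q × MIdx n)) (E : Finset (Fin m × MIdx n))
    (H : Finset (Fin r × MIdx n)) : {g : OddGen n m q r | oddIn C E H g}.Finite := by
  refine (((Set.finite_range (OddGen.dx : Fin n → OddGen n m q r)).union
    (C.finite_toSet.image fun a => OddGen.ghost a.1 a.2)).union
    ((E.finite_toSet.image fun a => OddGen.antifield a.1 a.2).union
      (H.finite_toSet.image fun a => OddGen.antighost2 a.1 a.2))).subset fun g hg => ?_
  cases g with
  | dx μ => exact Or.inl (Or.inl ⟨μ, rfl⟩)
  | ghost α J => exact Or.inl (Or.inr ⟨(α, J), hg, rfl⟩)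
  | antifield i J => exact Or.inr (Or.inl ⟨(i, J), hg, rfl⟩)
  | antighost2 Δ J => exact Or.inr (Or.inr ⟨(Δ, J), hg, rfl⟩)

theorem finite_setOf_evenIn (C' : Finset (Fin r × MIdx n)) (G : Finset (Fin q × MIdx n)) :
    {g : EvenGen n q r | evenIn C' G g}.Finite := by
  refine ((C'.finite_toSet.image fun a => EvenGen.ghost2 a.1 a.2).union
    (G.finite_toSet.image fun a => EvenGen.antighost a.1 a.2)).subset fun g hg => ?_
  cases g with
  | ghost2 Δ J => exact Or.inl ⟨(Δ, J), hg, rfl⟩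
  | antighost α J => exact Or.inr ⟨(α, J), hg, rfl⟩

/-- There are only finitely many monomials of given degrees in finitely many generators. -/
theorem finite_setOf_uses {P : OddGen n m q r → Prop} {Q : EvenGen n q r → Prop}
    (hP : {g | P g}.Finite) (hQ : {g | Q g}.Finite) (j g p : ℤ) :
    {M : Mono n m q r | M.Uses P Q ∧ M.antigh = j ∧ M.puregh = g ∧ M.formDeg = p}.Finite := by
  classical
  let B : EvenGen n q r →₀ ℕ := Finsupp.indicator hQ.toFinset fun _ _ => (j + g).toNat
  refine Set.Finite.of_finite_image (f := fun M => (M.odd, M.even))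
    (((hP.toFinset.powerset.finite_toSet).prod (Set.finite_Icc 0 B)).subset ?_) ?_
  · rintro _ ⟨M, ⟨⟨h1, h2⟩, h3, h4, -⟩, rfl⟩
    refine ⟨?_, bot_le, fun h => ?_⟩
    · simp only [Finset.coe_powerset, Set.mem_preimage, Set.mem_powerset_iff]
      intro h hh
      simpa using h1 h hh
    · by_cases hh : h ∈ M.even.support
      · have hQh : h ∈ hQ.toFinset := by simpa using h2 h hh
        rw [Finsupp.indicator_of_mem hQh]
        have e1 := M.mul_antigh_le h
        have e2 := M.mul_puregh_le h
        have e3 := M.antigh_nonneg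
        have e4 := M.puregh_nonneg
        change M.even h ≤ _
        cases h <;> simp only [EvenGen.antigh, EvenGen.puregh] at e1 e2 <;> omega
      · change M.even h ≤ _
        rw [Finsupp.notMem_support_iff.1 hh]
        exact Nat.zero_le _
  · rintro M - N - h
    exact Mono.ext (congrArg Prod.fst h) (congrArg Prod.snd h)

theorem oddIn_mono {C : Finset (Fin q × MIdx n)} {E E' : Finset (Fin m × MIdx n)}
    {H H' : Finset (Fin r × MIdx n)} (hE : E ⊆ E') (hH : H ⊆ H') (g : OddGen n m q r)
    (hg : oddIn C E H g) : oddIn C E' H' g := by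
  cases g with
  | dx μ => trivial
  | ghost α J => exact hg
  | antifield i J => exact hE hg
  | antighost2 Δ J => exact hH hg

theorem evenIn_mono {C' : Finset (Fin r × MIdx n)} {G G' : Finset (Fin q × MIdx n)} (hG : G ⊆ G')
    (g : EvenGen n q r) (hg : evenIn C' G g) : evenIn C' G' g := by
  cases g with
  | ghost2 Δ J => exact hg
  | antighost α J => exact hG hg

namespace GaugeTheory.BRSTDifferential

variable (s : T.BRSTDifferential)
include s

theorem delta_proj (R : ℤ → ℤ → ℤ → Prop) (a : Form n m q r) :
    T.delta (proj {M | R M.antigh M.puregh M.formDeg} a) =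
      proj {M | R (M.antigh + 1) M.puregh M.formDeg} (T.delta a) := by
  have := map_proj_of_degree (X := T.delta.toAddMonoidHom) (dj := -1) (dg := 0) (dp := 0)
    (fun j g p a ha => by rw [add_zero, add_zero]; exact s.delta_piece ha) R a
  simp only [sub_neg_eq_add, sub_zero] at this
  exact this

/-- Each jet has a neighbourhood where a given `δ`-cycle of positive antighost number is exact. -/
theorem exists_local_primitive (C : Finset (Fin q × MIdx n)) (C' : Finset (Fin r × MIdx n))
    {E : Finset (Fin m × MIdx n)} {G : Finset (Fin q × MIdx n)} {H : Finset (Fin r × MIdx n)}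
    (hcl : T.Closed E G H) {u : Jet n m}
    (hu : (∀ e ∈ E, (T.eqJet e).eval u = 0) → T.SplitsAt E G H u) {j g p : ℤ} (hj : 1 ≤ j)
    {a : Form n m q r} (ha : a ∈ genAlg n m q r (oddIn C E H) (evenIn C' G))
    (ha' : a ∈ piece n m q r j g p) (hδa : T.delta a = 0) :
    ∃ χ : LocFun n m, χ.eval u ≠ 0 ∧ ∃ b ∈ formsOn n m q r {M | M.Uses (oddIn C E H) (evenIn C' G) ∧
      M.antigh = j + 1 ∧ M.puregh = g ∧ M.formDeg = p}, T.delta b = χ • a := by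
  -- homogeneity of the primitive is achieved by projection
  suffices h : ∃ χ : LocFun n m, χ.eval u ≠ 0 ∧
      ∃ b ∈ genAlg n m q r (oddIn C E H) (evenIn C' G), T.delta b = χ • a by
    obtain ⟨χ, hχ, b, hb, h⟩ := h
    refine ⟨χ, hχ, proj {M | M.antigh = j + 1 ∧ M.puregh = g ∧ M.formDeg = p} b,
      fun M hM => ⟨proj_mem_of_mem hb hM, proj_mem _ b hM⟩, ?_⟩
    rw [s.delta_proj fun j' g' p' => j' = j + 1 ∧ g' = g ∧ p' = p]
    rw [h, proj_eq_self]
    refine Submodule.smul_mem _ _ (formsOn_mono ?_ (mem_piece.1 ha'))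
    rintro M ⟨h1, h2, h3⟩
    exact ⟨by omega, by omega, by omega⟩
  by_cases h0 : ∀ e ∈ E, (T.eqJet e).eval u = 0
  · obtain ⟨E₁, hE₁, G₁, hG₁, hind, hN, hR⟩ := hu h0
    obtain ⟨χ, hχ, c, hc, hac⟩ := s.exists_homologous_independent C C' hcl hE₁ hG₁ hN hR ha hδa
    let c' := proj {M | M.antigh = j + 1} c
    have h1 : T.delta c' = proj {M | M.antigh = j} (T.delta c) := by
      rw [s.delta_proj fun j' _ _ => j' = j + 1]
      simp only [add_left_inj]
    have h2 : χ • a - T.delta c' = proj {M | M.antigh = j} (χ • a - T.delta c) := by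
      rw [h1, sub_eq_add_neg, sub_eq_add_neg, proj_add, proj_eq_self (S := {M | M.antigh = j})
        (a := χ • a) (Submodule.smul_mem _ _ (formsOn_mono (fun M hM => hM.1) (mem_piece.1 ha')))]
      congr 1
      rw [eq_comm, eq_neg_iff_add_eq_zero, ← proj_add, neg_add_cancel, proj_zero]
    obtain ⟨χ', hχ', b, hb, hab⟩ := s.exists_koszul C C' hind hj (a := χ • a - T.delta c')
      (by
        rw [h2]
        exact fun M hM => ⟨proj_mem_of_mem hac hM, proj_mem _ _ hM⟩)
      (by rw [map_sub, map_smul, hδa, smul_zero, s.delta_delta, sub_zero])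
    refine ⟨χ' * χ, by rw [LocFun.eval_mul]; exact mul_ne_zero hχ' hχ, b + χ' • c', ?_, ?_⟩
    · refine add_mem (formsOn_mono ?_ hb) (Submodule.smul_mem _ _ (proj_mem_of_mem hc))
      rintro M ⟨⟨h3, h4⟩, -⟩
      exact ⟨fun g hg => oddIn_mono hE₁ (Finset.empty_subset _) g (h3 g hg),
        fun g hg => evenIn_mono (Finset.empty_subset _) g (h4 g hg)⟩
    · rw [map_add, map_smul, hab, smul_sub, sub_add_cancel, mul_smul]
  · -- where an equation of motion is invertible, it gives a contracting homotopy
    push Not at h0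
    obtain ⟨e, he, heu⟩ := h0
    refine ⟨T.eqJet e, heu, -wedge a (oddGen (.antifield e.1 e.2)), neg_mem
      (wedge_mem_genAlg ha (oddGen_mem_formsOn (uses_oddMono he))), ?_⟩
    rw [map_neg, s.delta_wedge_oddGen, hδa, T.deltaOdd_antifield]
    simp [wedge_ofFun_right, wedge_zero_left]

/-- The Koszul-Tate differential is acyclic in positive antighost number. -/
theorem exists_primitive (hreg : T.Regular) {j g p : ℤ} (hj : 1 ≤ j) {a : Form n m q r}
    (ha : a ∈ piece n m q r j g p) (hδa : T.delta a = 0) :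
    ∃ b ∈ piece n m q r (j + 1) g p, T.delta b = a := by
  classical
  -- the generators occurring in `a`
  have hodd : {g : OddGen n m q r | ∃ M ∈ a.support, g ∈ M.odd}.Finite := by
    have : {g : OddGen n m q r | ∃ M ∈ a.support, g ∈ M.odd} =
      ⋃ M ∈ a.support, (M.odd : Set (OddGen n m q r)) := by ext; simp
    rw [this]
    exact a.support.finite_toSet.biUnion fun M _ => M.odd.finite_toSet
  have heven : {g : EvenGen n q r | ∃ M ∈ a.support, g ∈ M.even.support}.Finite := by
    have : {g : EvenGen n q r | ∃ M ∈ a.support, g ∈ M.even.support} =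
      ⋃ M ∈ a.support, (M.even.support : Set (EvenGen n q r)) := by ext; simp
    rw [this]
    exact a.support.finite_toSet.biUnion fun M _ => M.even.support.finite_toSet
  let C : Finset (Fin q × MIdx n) := (hodd.preimage (f := fun c => OddGen.ghost c.1 c.2)
    (by rintro ⟨_, _⟩ - ⟨_, _⟩ - h; cases h; rfl)).toFinset
  let E₀ : Finset (Fin m × MIdx n) := (hodd.preimage (f := fun c => OddGen.antifield c.1 c.2)
    (by rintro ⟨_, _⟩ - ⟨_, _⟩ - h; cases h; rfl)).toFinset
  let H₀ : Finset (Fin r × MIdx n) := (hodd.preimage (f := fun c => OddGen.antighost2 c.1 c.2)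
    (by rintro ⟨_, _⟩ - ⟨_, _⟩ - h; cases h; rfl)).toFinset
  let C' : Finset (Fin r × MIdx n) := (heven.preimage (f := fun c => EvenGen.ghost2 c.1 c.2)
    (by rintro ⟨_, _⟩ - ⟨_, _⟩ - h; cases h; rfl)).toFinset
  let G₀ : Finset (Fin q × MIdx n) := (heven.preimage (f := fun c => EvenGen.antighost c.1 c.2)
    (by rintro ⟨_, _⟩ - ⟨_, _⟩ - h; cases h; rfl)).toFinset
  obtain ⟨E, G, H, hE, hG, hH, hcl, hsp⟩ := hreg E₀ G₀ H₀
  have haE : a ∈ genAlg n m q r (oddIn C E H) (evenIn C' G) := by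
    intro M hM
    refine ⟨fun h hh => ?_, fun h hh => ?_⟩
    · have : h ∈ {g : OddGen n m q r | ∃ M ∈ a.support, g ∈ M.odd} := ⟨M, hM, hh⟩
      cases h with
      | dx μ => trivial
      | ghost α J => exact (Set.Finite.mem_toFinset _).2 this
      | antifield i J => exact hE ((Set.Finite.mem_toFinset _).2 this)
      | antighost2 Δ J => exact hH ((Set.Finite.mem_toFinset _).2 this)
    · have : h ∈ {g : EvenGen n q r | ∃ M ∈ a.support, g ∈ M.even.support} := ⟨M, hM, hh⟩
      cases h with
      | ghost2 Δ J => exact (Set.Finite.mem_toFinset _).2 this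
      | antighost α J => exact hG ((Set.Finite.mem_toFinset _).2 this)
  have hS := finite_setOf_uses (finite_setOf_oddIn C E H) (finite_setOf_evenIn C' G) (j + 1) g p
  let S : Finset (Mono n m q r) := hS.toFinset
  have hmemS : ∀ M, M ∈ S ↔ M.Uses (oddIn C E H) (evenIn C' G) ∧
      M.antigh = j + 1 ∧ M.puregh = g ∧ M.formDeg = p := fun M => hS.mem_toFinset
  -- the equation `δ b = a` as a finite linear system for the coefficients of `b`
  let K : Finset (Mono n m q r) :=
    a.support ∪ S.biUnion fun M => (T.delta (Finsupp.single M 1)).support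
  obtain ⟨b, hb⟩ := exists_solution_of_local (κ := K) (ι := S)
    (fun i M => T.delta (Finsupp.single M.1 1) i.1) (fun i => a i.1) fun u => by
      obtain ⟨χ, hχ, b, hb, hab⟩ := s.exists_local_primitive C C' hcl (hsp u) hj haE ha hδa
      refine ⟨χ, hχ, fun M => b M.1, fun i => ?_⟩
      have h1 : b = ∑ M ∈ S, b M • (Finsupp.single M 1 : Form n m q r) := by
        simp only [Finsupp.smul_single, smul_eq_mul, mul_one]
        rw [← Finsupp.sum_of_support_subset b (fun M hM => (hmemS M).2 (hb hM))
          Finsupp.single (by simp), Finsupp.sum_single]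
      have h2 := congrArg (fun c : Form n m q r => c i.1) hab
      simp only [Finsupp.smul_apply, smul_eq_mul] at h2
      rw [← h2]
      conv_lhs => rw [h1]
      rw [map_sum, Finsupp.finsetSum_apply, ← Finset.sum_coe_sort S]
      exact Finset.sum_congr rfl fun M _ => by
        rw [map_smul, Finsupp.smul_apply, smul_eq_mul, mul_comm]
  refine ⟨∑ M : S, b M • Finsupp.single M.1 1, ?_, ?_⟩
  · refine mem_piece.2 (sum_mem fun M _ => Submodule.smul_mem _ _ (single_mem_formsOn ?_ 1))
    exact ((hmemS M.1).1 M.2).2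
  · refine Finsupp.ext fun N => ?_
    rw [map_sum, Finsupp.finsetSum_apply]
    by_cases hN : N ∈ K
    · rw [hb ⟨N, hN⟩]
      exact Finset.sum_congr rfl fun M _ => by
        rw [map_smul, Finsupp.smul_apply, smul_eq_mul, mul_comm]
    · simp only [K, Finset.mem_union, Finset.mem_biUnion, not_or, not_exists, not_and,
        Finsupp.notMem_support_iff] at hN
      rw [hN.1]
      refine Finset.sum_eq_zero fun M _ => ?_
      rw [map_smul, Finsupp.smul_apply, hN.2 M.1 M.2, smul_zero]

end GaugeTheory.BRSTDifferential

end Acyclicity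

/-! ### The variational complex with coefficients -/

section Ring

variable {ι A : Type*} [Fintype ι] [Ring A] {P e : ι → A}

/-- The square of a de Rham type differential `∑ P_μ e_μ`, with commuting `P_μ` and anticommuting
`e_μ`, is zero. -/
theorem sum_mul_sq_eq_zero [IsAddTorsionFree A] (hP : ∀ μ ν, Commute (P μ) (P ν))
    (hPe : ∀ μ ν, Commute (P μ) (e ν)) (he : ∀ μ ν, e μ * e ν = -(e ν * e μ)) :
    (∑ μ, P μ * e μ) * ∑ μ, P μ * e μ = 0 := by
  have h : (∑ μ, P μ * e μ) * ∑ μ, P μ * e μ = ∑ μ, ∑ ν, P μ * P ν * (e μ * e ν) := by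
    rw [Finset.sum_mul_sum]
    refine Finset.sum_congr rfl fun μ _ => Finset.sum_congr rfl fun ν _ => ?_
    rw [mul_assoc, ← mul_assoc (e μ), ← (hPe ν μ).eq]
    simp only [mul_assoc]
  rw [← self_eq_neg]
  conv_lhs => rw [h, Finset.sum_comm]
  rw [h, ← Finset.sum_neg_distrib]
  refine Finset.sum_congr rfl fun μ _ => ?_
  rw [← Finset.sum_neg_distrib]
  refine Finset.sum_congr rfl fun ν _ => ?_
  rw [he, (hP ν μ).eq, mul_neg]

theorem mul_mul_eq_neg {a b c : A} (hab : Commute a b) (hac : a * c = -(c * a)) :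
    a * (b * c) = -(b * c * a) := by
  rw [← mul_assoc, hab.eq, mul_assoc, hac, mul_neg, mul_assoc]

/-- The homotopy formula for a de Rham type differential. -/
theorem sum_mul_homotopy [DecidableEq ι] {τ i : ι → A}
    (hPi : ∀ μ ν, Commute (P μ) (i ν)) (hτe : ∀ μ ν, Commute (τ μ) (e ν))
    (hei : ∀ μ ν, e μ * i ν + i ν * e μ = if μ = ν then 1 else 0)
    (hτP : ∀ μ ν, τ ν * P μ = P μ * τ ν + if μ = ν then 1 else 0) :
    (∑ μ, P μ * e μ) * (∑ ν, τ ν * i ν) + (∑ ν, τ ν * i ν) * ∑ μ, P μ * e μ =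
      ∑ μ, P μ * τ μ + ∑ μ, i μ * e μ := by
  rw [Finset.sum_mul_sum, Finset.sum_mul_sum, Finset.sum_comm (s := Finset.univ)
    (t := Finset.univ) (f := fun ν μ => τ ν * i ν * (P μ * e μ)), ← Finset.sum_add_distrib,
    ← Finset.sum_add_distrib]
  refine Finset.sum_congr rfl fun μ _ => ?_
  have h : ∀ ν, P μ * e μ * (τ ν * i ν) + τ ν * i ν * (P μ * e μ) =
      if μ = ν then P μ * τ ν + i ν * e μ else 0 := by
    intro ν
    have e1 : P μ * e μ * (τ ν * i ν) = P μ * τ ν * (e μ * i ν) := by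
      rw [mul_assoc, ← mul_assoc (e μ), ← (hτe ν μ).eq]
      simp only [mul_assoc]
    have e2 : τ ν * i ν * (P μ * e μ) = τ ν * P μ * (i ν * e μ) := by
      rw [mul_assoc, ← mul_assoc (i ν), ← (hPi μ ν).eq]
      simp only [mul_assoc]
    rw [e1, e2, hτP, add_mul, ← add_assoc, ← mul_add, hei]
    split_ifs <;> simp
  rw [← Finset.sum_add_distrib, Finset.sum_congr rfl fun ν _ => h ν, Finset.sum_ite_eq]
  simp

end Ring

section Marked

variable {n : ℕ} {V : Type*} [AddCommGroup V] [Module ℝ V]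

/-- Polynomials with coefficients in `V` in variables `t_μ`; the monomial `t^J` marks the place of
the derivative `∂_J` of a ghost. -/
abbrev Marked (n : ℕ) (V : Type*) [AddCommGroup V] : Type _ := MIdx n →₀ V

/-- Multiplication by `t_μ`. -/
def markMul (μ : Fin n) : Module.End ℝ (Marked n V) :=
  Finsupp.lmapDomain V ℝ fun J => J.shift μ

/-- The derivative with respect to `t_μ`. -/
def markDer (μ : Fin n) : Module.End ℝ (Marked n V) :=
  Finsupp.lsum ℝ fun J => (J μ : ℝ) • Finsupp.lsingle (J - Pi.single μ 1)

/-- Operators acting on the coefficients. -/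
def coeffMap : Module.End ℝ V →+* Module.End ℝ (Marked n V) where
  toFun X := Finsupp.mapRange.linearMap X
  map_one' := Finsupp.mapRange.linearMap_id
  map_mul' X Y := Finsupp.mapRange.linearMap_comp X Y
  map_zero' := by ext; simp
  map_add' X Y := by ext; simp

@[simp]
theorem markMul_single (μ : Fin n) (J : MIdx n) (v : V) :
    markMul μ (Finsupp.single J v) = Finsupp.single (J.shift μ) v :=
  Finsupp.mapDomain_single

@[simp]
theorem markDer_single (μ : Fin n) (J : MIdx n) (v : V) :
    markDer μ (Finsupp.single J v) = (J μ : ℝ) • Finsupp.single (J - Pi.single μ 1) v := by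
  simp [markDer]

@[simp]
theorem coeffMap_single (X : Module.End ℝ V) (J : MIdx n) (v : V) :
    coeffMap X (Finsupp.single J v) = Finsupp.single J (X v) :=
  Finsupp.mapRange_single (hf := map_zero X)

@[simp]
theorem coeffMap_apply (X : Module.End ℝ V) (x : Marked n V) (J : MIdx n) :
    coeffMap X x J = X (x J) :=
  rfl

theorem marked_ext {X Y : Module.End ℝ (Marked n V)}
    (h : ∀ J v, X (Finsupp.single J v) = Y (Finsupp.single J v)) : X = Y :=
  Finsupp.lhom_ext h

theorem commute_markMul_coeffMap (μ : Fin n) (X : Module.End ℝ V) :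
    Commute (markMul μ) (coeffMap X) :=
  marked_ext fun J v => by simp

theorem commute_markDer_coeffMap (μ : Fin n) (X : Module.End ℝ V) :
    Commute (markDer μ) (coeffMap X) :=
  marked_ext fun J v => by simp

theorem commute_markMul (μ ν : Fin n) :
    Commute (markMul μ : Module.End ℝ (Marked n V)) (markMul ν) :=
  marked_ext fun J v => by simp [MIdx.shift_comm]

theorem MIdx.shift_sub_single (J : MIdx n) (μ : Fin n) : J.shift μ - Pi.single μ 1 = J :=
  add_tsub_cancel_right J _

theorem MIdx.sub_single_shift {J : MIdx n} {μ : Fin n} (h : J μ ≠ 0) :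
    MIdx.shift (J - Pi.single μ 1) μ = J := by
  refine tsub_add_cancel_of_le fun ν => ?_
  by_cases hν : ν = μ
  · subst hν
    simpa using Nat.one_le_iff_ne_zero.2 h
  · simp [hν]

theorem MIdx.order_shift (J : MIdx n) (μ : Fin n) : (J.shift μ).order = J.order + 1 := by
  simp [MIdx.order, MIdx.shift, Finset.sum_add_distrib]

theorem markDer_mul_markMul (μ ν : Fin n) :
    (markDer ν * markMul μ : Module.End ℝ (Marked n V)) =
      markMul μ * markDer ν + if μ = ν then 1 else 0 := by
  refine marked_ext fun J v => ?_
  by_cases h : μ = ν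
  · subst h
    by_cases hJ : J μ = 0
    · simp [hJ, MIdx.shift]
    · simp only [Module.End.mul_apply, markMul_single, markDer_single, MIdx.shift_sub_single,
        if_pos, LinearMap.add_apply, map_smul, Module.End.one_apply, MIdx.sub_single_shift hJ]
      simp [MIdx.shift, add_smul]
  · have e1 : (J.shift μ) ν = J ν := by simp [MIdx.shift, Ne.symm h]
    have e2 : J.shift μ - Pi.single ν 1 = MIdx.shift (J - Pi.single ν 1) μ := by
      funext κ
      simp only [MIdx.shift, Pi.sub_apply, Pi.add_apply, Pi.single_apply]
      split_ifs with h1 h2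
      · exact absurd (h1.symm.trans h2) h
      all_goals omega
    simp [h, e1, e2]

theorem sum_markMul_markDer_single (J : MIdx n) (v : V) :
    (∑ μ, markMul μ * markDer μ : Module.End ℝ (Marked n V)) (Finsupp.single J v) =
      (J.order : ℝ) • Finsupp.single J v := by
  rw [LinearMap.sum_apply, MIdx.order, Nat.cast_sum, Finset.sum_smul]
  refine Finset.sum_congr rfl fun μ _ => ?_
  by_cases hJ : J μ = 0
  · simp [hJ]
  · simp [MIdx.sub_single_shift hJ]

/-- The polynomials with coefficients in a subspace. -/
def markedIn (A : Submodule ℝ V) : Submodule ℝ (Marked n V) where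
  carrier := {x | ∀ J, x J ∈ A}
  zero_mem' := fun _ => A.zero_mem
  add_mem' := fun hx hy J => A.add_mem (hx J) (hy J)
  smul_mem' := fun t _ hx J => A.smul_mem t (hx J)

theorem single_mem_markedIn {A : Submodule ℝ V} {v : V} (hv : v ∈ A) (J : MIdx n) :
    Finsupp.single J v ∈ markedIn A := by
  classical
  intro K
  rw [Finsupp.single_apply]
  split_ifs
  exacts [hv, A.zero_mem]

theorem markedIn_induction {A : Submodule ℝ V} {B : Submodule ℝ (Marked n V)}
    {X : Module.End ℝ (Marked n V)} (h : ∀ J, ∀ v ∈ A, X (Finsupp.single J v) ∈ B)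
    {x : Marked n V} (hx : x ∈ markedIn A) : X x ∈ B := by
  rw [← Finsupp.sum_single x, Finsupp.sum, map_sum]
  exact sum_mem fun J _ => h J _ (hx J)

/-- Linear operators that model, on a space `V` graded by antighost number and form degree, the
total derivatives `D`, the multiplication `e` by the `dx`, the contraction `i` of the `dx`, and a
differential `δ` which is exact in positive antighost number. -/
structure VariationalData (n : ℕ) (V : Type*) [AddCommGroup V] [Module ℝ V] where
  D : Fin n → Module.End ℝ V
  Ds : MIdx n → Module.End ℝ V
  e : Fin n → Module.End ℝ V
  i : Fin n → Module.End ℝ V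
  δ : Module.End ℝ V
  A : ℤ → ℤ → Submodule ℝ V
  Ds_zero : Ds 0 = 1
  Ds_shift : ∀ J μ, Ds (J.shift μ) = Ds J * D μ
  D_comm : ∀ μ ν, Commute (D μ) (D ν)
  D_e : ∀ μ ν, Commute (D μ) (e ν)
  D_i : ∀ μ ν, Commute (D μ) (i ν)
  δ_D : ∀ μ, Commute δ (D μ)
  e_e : ∀ μ ν, e μ * e ν = -(e ν * e μ)
  e_i : ∀ μ ν, e μ * i ν + i ν * e μ = if μ = ν then 1 else 0
  δ_e : ∀ μ, δ * e μ = -(e μ * δ)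
  δ_i : ∀ μ, δ * i μ = -(i μ * δ)
  D_mem : ∀ μ j p, ∀ x ∈ A j p, D μ x ∈ A j p
  e_mem : ∀ μ j p, ∀ x ∈ A j p, e μ x ∈ A j (p + 1)
  i_mem : ∀ μ j p, ∀ x ∈ A j p, i μ x ∈ A j (p - 1)
  count : ∀ j p, ∀ x ∈ A j p, ∑ μ, i μ (e μ x) = (n - p : ℝ) • x
  eq_zero : ∀ j p, (n : ℤ) < p → ∀ x ∈ A j p, x = 0
  exact : ∀ j p, 1 ≤ j → ∀ x ∈ A j p, δ x = 0 → ∃ y ∈ A (j + 1) p, δ y = x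

namespace VariationalData

variable (S : VariationalData n V)

/-- The operators `t_μ + D_μ`. -/
def P (μ : Fin n) : Module.End ℝ (Marked n V) := markMul μ + coeffMap (S.D μ)

/-- The differential `∑ (t_μ + D_μ) e_μ`. -/
def d : Module.End ℝ (Marked n V) := ∑ μ, S.P μ * coeffMap (S.e μ)

/-- The homotopy `∑ (∂/∂t_μ) i_μ`. -/
def h : Module.End ℝ (Marked n V) := ∑ μ, markDer μ * coeffMap (S.i μ)

theorem commute_P_coeffMap {μ : Fin n} {X : Module.End ℝ V} (hX : Commute (S.D μ) X) :
    Commute (S.P μ) (coeffMap X) :=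
  (commute_markMul_coeffMap μ X).add_left (hX.map coeffMap)

theorem commute_P (μ ν : Fin n) : Commute (S.P μ) (S.P ν) :=
  ((commute_markMul μ ν).add_right (commute_markMul_coeffMap μ _)).add_left
    ((commute_markMul_coeffMap ν _).symm.add_right ((S.D_comm μ ν).map coeffMap))

theorem d_mul_d : S.d * S.d = 0 := by
  let := Module.compHom (Module.End ℝ (Marked n V)) (algebraMap ℚ ℝ)
  have : IsAddTorsionFree (Module.End ℝ (Marked n V)) := IsAddTorsionFree.of_module_rat _
  exact sum_mul_sq_eq_zero S.commute_P (fun μ ν => S.commute_P_coeffMap (S.D_e μ ν))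
    fun μ ν => by rw [← map_mul, S.e_e, map_neg, map_mul]

theorem homotopy : S.d * S.h + S.h * S.d =
    ∑ μ, S.P μ * markDer μ + ∑ μ, coeffMap (S.i μ) * coeffMap (S.e μ) :=
  sum_mul_homotopy (fun μ ν => S.commute_P_coeffMap (S.D_i μ ν))
    (fun μ _ => commute_markDer_coeffMap μ _)
    (fun μ ν => by
      rw [← map_mul, ← map_mul, ← map_add, S.e_i, apply_ite coeffMap, map_one, map_zero])
    fun μ ν => by
      rw [P, mul_add, markDer_mul_markMul, (commute_markDer_coeffMap ν (S.D μ)).eq, add_mul]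
      abel

theorem δ_mul_d : coeffMap S.δ * S.d = -(S.d * coeffMap S.δ) := by
  rw [d, Finset.mul_sum, Finset.sum_mul, ← Finset.sum_neg_distrib]
  refine Finset.sum_congr rfl fun μ _ => ?_
  exact mul_mul_eq_neg (S.commute_P_coeffMap (S.δ_D μ).symm).symm
    (by rw [← map_mul, S.δ_e, map_neg, map_mul])

theorem δ_mul_h : coeffMap S.δ * S.h = -(S.h * coeffMap S.δ) := by
  rw [h, Finset.mul_sum, Finset.sum_mul, ← Finset.sum_neg_distrib]
  refine Finset.sum_congr rfl fun μ _ => ?_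
  exact mul_mul_eq_neg (commute_markDer_coeffMap μ S.δ).symm
    (by rw [← map_mul, S.δ_i, map_neg, map_mul])

theorem d_mem {j p : ℤ} {x : Marked n V} (hx : x ∈ markedIn (S.A j p)) :
    S.d x ∈ markedIn (n := n) (S.A j (p + 1)) := by
  refine markedIn_induction (fun J v hv => ?_) hx
  rw [d, LinearMap.sum_apply]
  refine sum_mem fun μ _ => ?_
  simp only [P, Module.End.mul_apply, coeffMap_single, LinearMap.add_apply, markMul_single]
  exact add_mem (single_mem_markedIn (S.e_mem μ _ _ _ hv) _)
    (single_mem_markedIn (S.D_mem μ _ _ _ (S.e_mem μ _ _ _ hv)) _)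

theorem h_mem {j p : ℤ} {x : Marked n V} (hx : x ∈ markedIn (S.A j p)) :
    S.h x ∈ markedIn (n := n) (S.A j (p - 1)) := by
  refine markedIn_induction (fun J v hv => ?_) hx
  rw [h, LinearMap.sum_apply]
  refine sum_mem fun μ _ => ?_
  simp only [Module.End.mul_apply, coeffMap_single, markDer_single]
  exact Submodule.smul_mem _ _ (single_mem_markedIn (S.i_mem μ _ _ _ hv) _)

theorem exists_δ_eq {j p : ℤ} (hj : 1 ≤ j) {x : Marked n V} (hx : x ∈ markedIn (S.A j p))
    (hδ : coeffMap S.δ x = 0) : ∃ y ∈ markedIn (S.A (j + 1) p), coeffMap S.δ y = x := by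
  choose y hy hyx using fun J => S.exact j p hj (x J) (hx J) (DFunLike.congr_fun hδ J)
  refine ⟨∑ J ∈ x.support, Finsupp.single J (y J), sum_mem fun J _ =>
    single_mem_markedIn (hy J) J, ?_⟩
  rw [map_sum]
  simp only [coeffMap_single, hyx]
  exact Finsupp.sum_single x

/-- The Euler operator `∑ (-1)^{|J|} D_J x_J`. -/
def euler : Marked n V →ₗ[ℝ] V := Finsupp.lsum ℝ fun J => (-1 : ℝ) ^ J.order • S.Ds J

theorem euler_single (J : MIdx n) (v : V) :
    S.euler (Finsupp.single J v) = (-1 : ℝ) ^ J.order • S.Ds J v := by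
  simp [euler]

theorem euler_P (μ : Fin n) (x : Marked n V) : S.euler (S.P μ x) = 0 := by
  induction x using Finsupp.induction_linear with
  | zero => simp
  | add x y hx hy => rw [map_add, map_add, hx, hy, add_zero]
  | single J v =>
    rw [P, LinearMap.add_apply, markMul_single, coeffMap_single, map_add, euler_single,
      euler_single, MIdx.order_shift, S.Ds_shift, pow_succ]
    simp

theorem euler_d (x : Marked n V) : S.euler (S.d x) = 0 := by
  rw [d, LinearMap.sum_apply, map_sum]
  exact Finset.sum_eq_zero fun μ _ => S.euler_P μ _

/-- The homotopy formula, up to terms of lower degree in `t`. -/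
theorem homotopy_sub_mem {j p : ℤ} {N : ℕ} {x : Marked n V} (hx : x ∈ markedIn (S.A j p))
    (hN : x ∈ Finsupp.supported V ℝ {J : MIdx n | J.order < N + 1}) :
    S.d (S.h x) + S.h (S.d x) - (N + n - p : ℝ) • x ∈
      Finsupp.supported V ℝ {J : MIdx n | J.order < N} := by
  have key : ∀ J : MIdx n, J.order < N + 1 → ∀ v ∈ S.A j p,
      (S.d * S.h + S.h * S.d - (N + n - p : ℝ) • (1 : Module.End ℝ (Marked n V)))
        (Finsupp.single J v) ∈ Finsupp.supported V ℝ {J : MIdx n | J.order < N} := by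
    intro J hJ v hv
    have e1 : (∑ μ, coeffMap (S.i μ) * coeffMap (S.e μ) : Module.End ℝ (Marked n V))
        (Finsupp.single J v) = (n - p : ℝ) • Finsupp.single J v := by
      rw [LinearMap.sum_apply]
      simp only [Module.End.mul_apply, coeffMap_single]
      rw [Finsupp.smul_single, ← S.count j p v hv, Finsupp.single_finsetSum]
    have e2 : (∑ μ, S.P μ * markDer μ : Module.End ℝ (Marked n V)) (Finsupp.single J v) =
        (J.order : ℝ) • Finsupp.single J v +
        ∑ μ, (J μ : ℝ) • Finsupp.single (J - Pi.single μ 1) (S.D μ v) := by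
      rw [← sum_markMul_markDer_single]
      simp only [P, add_mul, Finset.sum_add_distrib, LinearMap.add_apply, LinearMap.sum_apply]
      congr 1
      refine Finset.sum_congr rfl fun μ _ => ?_
      simp
    rw [S.homotopy, LinearMap.sub_apply, LinearMap.add_apply, e1, e2, LinearMap.smul_apply,
      Module.End.one_apply]
    have e3 : (J.order : ℝ) • Finsupp.single J v +
        ∑ μ, (J μ : ℝ) • Finsupp.single (J - Pi.single μ 1) (S.D μ v) +
        (n - p : ℝ) • Finsupp.single J v - (N + n - p : ℝ) • Finsupp.single J v =
        ((J.order : ℝ) - N) • Finsupp.single J v +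
        ∑ μ, (J μ : ℝ) • Finsupp.single (J - Pi.single μ 1) (S.D μ v) := by
      module
    rw [e3]
    refine add_mem ?_ (sum_mem fun μ _ => ?_)
    · by_cases h : J.order = N
      · rw [h, sub_self, zero_smul]
        exact zero_mem _
      · refine Submodule.smul_mem _ _ (Finsupp.single_mem_supported _ _ ?_)
        change J.order < N
        omega
    · by_cases h : J μ = 0
      · rw [h, Nat.cast_zero, zero_smul]
        exact zero_mem _
      · refine Submodule.smul_mem _ _ (Finsupp.single_mem_supported _ _ ?_)
        have := MIdx.order_shift (J - Pi.single μ 1) μ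
        rw [MIdx.sub_single_shift h] at this
        change MIdx.order (J - Pi.single μ 1) < N
        omega
  have e : S.d (S.h x) + S.h (S.d x) - (N + n - p : ℝ) • x =
      (S.d * S.h + S.h * S.d - (N + n - p : ℝ) • (1 : Module.End ℝ (Marked n V))) x := rfl
  rw [e, ← Finsupp.sum_single x, Finsupp.sum, map_sum]
  exact sum_mem fun J hJ => key J (hN hJ) _ (hx J)

/-- In positive antighost number, the cohomology of `δ` modulo `d` is trivial. -/
theorem exists_relative_primitive {j p : ℤ} (hj : 1 ≤ j) {x z : Marked n V}
    (hx : x ∈ markedIn (S.A j p)) (hz : coeffMap S.δ x + S.d z = 0) :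
    ∃ w ∈ markedIn (S.A (j + 1) p), ∃ v ∈ markedIn (S.A j (p - 1)),
      coeffMap S.δ w + S.d v = x := by
  by_cases hp : (n : ℤ) < p
  · refine ⟨0, zero_mem _, 0, zero_mem _, ?_⟩
    have : x = 0 := Finsupp.ext fun J => S.eq_zero j p hp _ (hx J)
    simp [this]
  obtain ⟨N, hN⟩ : ∃ N, x ∈ Finsupp.supported V ℝ {J : MIdx n | J.order < N} := by
    refine ⟨x.support.sup MIdx.order + 1, fun J hJ => ?_⟩
    exact Nat.lt_succ_of_le (Finset.le_sup (f := MIdx.order) hJ)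
  induction N generalizing x z with
  | zero =>
    refine ⟨0, zero_mem _, 0, zero_mem _, ?_⟩
    have : x = 0 := by
      refine Finsupp.ext fun J => ?_
      by_contra h
      exact absurd (hN (Finsupp.mem_support_iff.2 h)) (Nat.not_lt_zero _)
    simp [this]
  | succ N ih =>
    by_cases hc : N = 0 ∧ p = n
    · -- the exterior derivative of highest degree is controlled by the Euler operator
      obtain ⟨rfl, rfl⟩ := hc
      have hx0 : x = Finsupp.single 0 (x 0) := by
        refine Finsupp.ext fun J => ?_
        by_cases hJ : J = 0
        · rw [hJ, Finsupp.single_eq_same]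
        · rw [Finsupp.single_eq_of_ne hJ]
          by_contra h
          have h1 : J.order < 0 + 1 := hN (Finsupp.mem_support_iff.2 h)
          have h2 : J.order = 0 := by omega
          rw [MIdx.order, Finset.sum_eq_zero_iff] at h2
          exact hJ (funext fun μ => h2 μ (Finset.mem_univ μ))
      have hδ : S.δ (x 0) = 0 := by
        have := congrArg S.euler hz
        rw [map_add, euler_d, map_zero, add_zero, hx0, coeffMap_single, euler_single,
          S.Ds_zero] at this
        simpa [MIdx.order] using this
      obtain ⟨y, hy, hyx⟩ := S.exact j _ hj (x 0) (hx 0) hδ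
      refine ⟨Finsupp.single 0 y, single_mem_markedIn hy 0, 0, zero_mem _, ?_⟩
      rw [coeffMap_single, hyx, map_zero S.d, add_zero, ← hx0]
    -- otherwise the homotopy removes the terms of degree `N` in `t`: `h d x` is a `δ`-cycle, hence
    -- a `δ`-boundary, and `d h x` is `d`-exact
    · have hc' : (N + n - p : ℝ) ≠ 0 := by
        have : (N + n - p : ℤ) ≠ 0 := by omega
        exact_mod_cast this
      set c : ℝ := N + n - p with hcdef
      have hmul : ∀ X Y : Module.End ℝ (Marked n V), X * Y = -(Y * X) →
          ∀ y, X (Y y) = -Y (X y) := fun X Y h y => by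
        have := LinearMap.congr_fun h y
        simpa using this
      have hdd : ∀ y, S.d (S.d y) = 0 := fun y => LinearMap.congr_fun S.d_mul_d y
      have hδx : coeffMap S.δ x = -S.d z := eq_neg_of_add_eq_zero_left hz
      have hy : coeffMap S.δ (S.h (S.d x)) = 0 := by
        rw [hmul _ _ S.δ_mul_h, hmul _ _ S.δ_mul_d, hδx]
        simp [hdd]
      have hmem : S.h (S.d x) ∈ markedIn (n := n) (S.A j p) := by
        have := S.h_mem (S.d_mem hx)
        rwa [add_sub_cancel_right] at this
      have hmem' : S.d (S.h x) ∈ markedIn (n := n) (S.A j p) := by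
        have := S.d_mem (S.h_mem hx)
        rwa [sub_add_cancel] at this
      obtain ⟨w₁, hw₁, hw₁y⟩ := S.exists_δ_eq hj hmem hy
      obtain ⟨w, hw, v, hv, hwv⟩ := ih (x := x - c⁻¹ • (S.d (S.h x) + S.h (S.d x)))
        (z := z - c⁻¹ • coeffMap S.δ (S.h x))
        (sub_mem hx (Submodule.smul_mem _ _ (add_mem hmem' hmem)))
        (by
          rw [map_sub, map_sub, map_smul, map_smul, map_add, hy, hmul _ _ S.δ_mul_d, hδx]
          module)
        (by
          have := Submodule.smul_mem _ (-c⁻¹) (S.homotopy_sub_mem hx hN)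
          rw [← hcdef, smul_sub, smul_smul, neg_mul, inv_mul_cancel₀ hc'] at this
          convert this using 1
          module)
      refine ⟨w + c⁻¹ • w₁, add_mem hw (Submodule.smul_mem _ _ hw₁), v + c⁻¹ • S.h x,
        add_mem hv (Submodule.smul_mem _ _ (S.h_mem hx)), ?_⟩
      rw [map_add, map_add, map_smul, map_smul, hw₁y, add_add_add_comm, hwv]
      module

end VariationalData

end Marked

/-! ### The variational complex of local forms -/

section Operators

variable {n m q r : ℕ}

instance : DecidableEq (EvenGen n q r) := Classical.decEq _

/-- The derivative with respect to a commuting generator. -/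
def contrEven (g : EvenGen n q r) : Form n m q r →ₗ[LocFun n m] Form n m q r :=
  rightDer 0 fun h => if h = g then ofFun 1 else 0

theorem isRightDer_contrEven (g : EvenGen n q r) :
    IsRightDer 0 ((contrEven g : Form n m q r →ₗ[LocFun n m] _).restrictScalars ℝ) := by
  refine isRightDer_rightDer (fun h => zero_mem _) fun h => ?_
  split_ifs
  · exact ofFun_mem_parityPiece 1
  · exact zero_mem _

theorem contrEven_single (g : EvenGen n q r) (M : Mono n m q r) (f : LocFun n m) :
    contrEven g (Finsupp.single M f) =
      M.even g • Finsupp.single ⟨M.odd, M.even - Finsupp.single g 1⟩ f := by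
  rw [contrEven, rightDer_single]
  simp only [Pi.zero_apply, wedge_zero_right, smul_zero, Finset.sum_const_zero, zero_add]
  by_cases hg : g ∈ M.even.support
  · rw [Finset.sum_eq_single g]
    · rw [if_pos rfl, wedge_ofFun_right, one_smul]
    · intro h _ hh
      rw [if_neg hh, wedge_zero_right, smul_zero]
    · exact fun h => absurd hg h
  · rw [Finsupp.notMem_support_iff.1 hg, zero_smul]
    refine Finset.sum_eq_zero fun h hh => ?_
    rw [if_neg fun e : h = g => hg (e ▸ hh), wedge_zero_right, smul_zero]

@[simp]
theorem contrEven_ofFun (g : EvenGen n q r) (f : LocFun n m) :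
    contrEven g (ofFun f : Form n m q r) = 0 :=
  rightDer_ofFun _ _ f

@[simp]
theorem contrEven_oddGen (g : EvenGen n q r) (h : OddGen n m q r) :
    contrEven g (oddGen h) = 0 :=
  rightDer_oddGen _ _ h

@[simp]
theorem contrEven_evenGen (g h : EvenGen n q r) :
    contrEven g (evenGen h : Form n m q r) = if h = g then ofFun 1 else 0 :=
  rightDer_evenGen _ _ h

theorem contrEven_eq_zero {g : EvenGen n q r} {a : Form n m q r}
    (ha : a ∈ formsOn n m q r {M | M.even g = 0}) : contrEven g a = 0 := by
  refine supported_induction (P := fun a => contrEven g a = 0) (by simp)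
    (fun x y hx hy => by rw [map_add, hx, hy, add_zero]) (fun M hM f => ?_) a ha
  rw [contrEven_single, show M.even g = 0 from hM, zero_smul]

theorem contrEven_mem {S S' : Set (Mono n m q r)} {g : EvenGen n q r}
    (h : ∀ M ∈ S, g ∈ M.even.support → ⟨M.odd, M.even - Finsupp.single g 1⟩ ∈ S')
    {a : Form n m q r} (ha : a ∈ formsOn n m q r S) : contrEven g a ∈ formsOn n m q r S' := by
  refine map_mem_formsOn (X := (contrEven g).toAddMonoidHom) (fun M hM f => ?_) ha
  change contrEven g _ ∈ _
  rw [contrEven_single]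
  by_cases hg : g ∈ M.even.support
  · exact nsmul_mem (single_mem_formsOn (h M hM hg) f) _
  · rw [Finsupp.notMem_support_iff.1 hg, zero_smul]
    exact zero_mem _

/-- The commutator of `∂_μ` with a right derivation is determined by the generators. -/
theorem IsRightDer.apply_formD {ε : ℕ} {X Y : Form n m q r →ₗ[ℝ] Form n m q r}
    (hX : IsRightDer ε X) (hY : IsRightDer ε Y) {μ : Fin n} (hX0 : ∀ f, X (ofFun f) = 0)
    (hY0 : ∀ f, Y (ofFun f) = 0)
    (odd : ∀ g, X (shiftOdd μ g) = formD μ (X (LocalBRST.oddGen g)) + Y (LocalBRST.oddGen g))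
    (even : ∀ g, X (shiftEven μ g) = formD μ (X (LocalBRST.evenGen g)) + Y (LocalBRST.evenGen g))
    (a : Form n m q r) : X (formD μ a) = formD μ (X a) + Y a := by
  have h := hX.commutator (isRightDer_formD μ)
  have := h.ext hY (fun f => by simp [hX0, hY0]) (fun g => by simp [odd])
    (fun g => by simp [even])
  have := LinearMap.congr_fun this a
  simp only [mul_zero, pow_zero, one_smul, LinearMap.sub_apply, LinearMap.comp_apply] at this
  rw [← this]
  abel

theorem formD_ofFun_one (μ : Fin n) : formD μ (ofFun 1 : Form n m q r) = 0 := by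
  rw [formD_ofFun, totalD_one, ofFun, Finsupp.single_zero]

theorem contrOdd_formD_add {g g' : OddGen n m q r} {μ : Fin n}
    (h : ∀ k, contrOdd g (shiftOdd μ k) = contrOdd g' (oddGen k)) (a : Form n m q r) :
    contrOdd g (formD μ a) = formD μ (contrOdd g a) + contrOdd g' a := by
  refine (isRightDer_contrOdd g).apply_formD (isRightDer_contrOdd g') (fun f => contrOdd_ofFun g f)
    (fun f => contrOdd_ofFun g' f) (fun k => ?_) (fun k => ?_) a
  · change contrOdd g _ = formD μ (contrOdd g _) + contrOdd g' _
    rw [h, contrOdd_oddGen g]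
    split_ifs <;> simp only [formD_ofFun_one, map_zero, zero_add]
  · change contrOdd g _ = formD μ (contrOdd g _) + contrOdd g' _
    cases k <;> simp [shiftEven]

theorem contrOdd_formD {g : OddGen n m q r} {μ : Fin n}
    (h : ∀ k, contrOdd g (shiftOdd μ k) = 0) (a : Form n m q r) :
    contrOdd g (formD μ a) = formD μ (contrOdd g a) := by
  refine ((isRightDer_contrOdd g).apply_formD (isRightDer_zero 1) (fun f => contrOdd_ofFun g f)
    (fun f => rfl) (fun k => ?_) (fun k => ?_) a).trans (add_zero _)
  · change contrOdd g _ = formD μ (contrOdd g _) + 0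
    rw [h, contrOdd_oddGen g]
    split_ifs <;> simp only [formD_ofFun_one, map_zero, add_zero]
  · change contrOdd g _ = formD μ (contrOdd g _) + 0
    cases k <;> simp [shiftEven]

theorem contrEven_formD_add {g g' : EvenGen n q r} {μ : Fin n}
    (h : ∀ k, contrEven g (shiftEven μ k : Form n m q r) = contrEven g' (evenGen k))
    (a : Form n m q r) :
    contrEven g (formD μ a) = formD μ (contrEven g a) + contrEven g' a := by
  refine (isRightDer_contrEven g).apply_formD (isRightDer_contrEven g')
    (fun f => contrEven_ofFun g f) (fun f => contrEven_ofFun g' f) (fun k => ?_) (fun k => ?_) a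
  · change contrEven g _ = formD μ (contrEven g _) + contrEven g' _
    cases k <;> simp [shiftOdd]
  · change contrEven g _ = formD μ (contrEven g _) + contrEven g' _
    rw [h, contrEven_evenGen g]
    split_ifs <;> simp only [formD_ofFun_one, map_zero, zero_add]

theorem contrEven_formD {g : EvenGen n q r} {μ : Fin n}
    (h : ∀ k, contrEven g (shiftEven μ k : Form n m q r) = 0) (a : Form n m q r) :
    contrEven g (formD μ a) = formD μ (contrEven g a) := by
  refine ((isRightDer_contrEven g).apply_formD (isRightDer_zero 0) (fun f => contrEven_ofFun g f)
    (fun f => rfl) (fun k => ?_) (fun k => ?_) a).trans (add_zero _)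
  · change contrEven g _ = formD μ (contrEven g _) + 0
    cases k <;> simp [shiftOdd]
  · change contrEven g _ = formD μ (contrEven g _) + 0
    rw [h, contrEven_evenGen g]
    split_ifs <;> simp only [formD_ofFun_one, map_zero, add_zero]

theorem formD_wedge_dx (μ ν : Fin n) (a : Form n m q r) :
    formD μ (wedge a (oddGen (.dx ν))) = wedge (formD μ a) (oddGen (.dx ν)) := by
  rw [(isRightDer_formD μ).oddGen, formD_oddGen, shiftOdd, wedge_zero_right, zero_add, pow_zero,
    one_smul]

theorem wedge_oddGen_oddGen (a : Form n m q r) (g h : OddGen n m q r) :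
    wedge (wedge a (oddGen g)) (oddGen h) = -wedge (wedge a (oddGen h)) (oddGen g) := by
  rw [wedge_assoc, wedge_assoc, wedge_comm_of_parity (oddGen_mem_parityPiece g)
    (oddGen_mem_parityPiece h), mul_one, pow_one, neg_smul, one_smul, wedge_neg_right]

theorem wedge_oddGen_evenGen (a : Form n m q r) (g : OddGen n m q r) (h : EvenGen n q r) :
    wedge (wedge a (oddGen g)) (evenGen h) = wedge (wedge a (evenGen h)) (oddGen g) := by
  rw [wedge_assoc, wedge_assoc, wedge_comm_of_parity (oddGen_mem_parityPiece g)
    (evenGen_mem_parityPiece h), mul_zero, pow_zero, one_smul]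

theorem formD_mem_piece (μ : Fin n) {j g p : ℤ} {a : Form n m q r} (ha : a ∈ piece n m q r j g p) :
    formD μ a ∈ piece n m q r j g p := by
  refine map_mem_formsOn (X := (formD μ).toAddMonoidHom) (fun M hM f => ?_) ha
  have hodd : ∀ g, shiftOdd μ g ∈ piece n m q r (g.antigh) (g.puregh) (g.formDeg) := by
    intro g
    cases g
    · exact zero_mem _
    all_goals exact oddGen_mem_piece _
  have heven : ∀ g, shiftEven μ g ∈ piece n m q r (g.antigh) (g.puregh) 0 := by
    intro g
    cases g <;> exact evenGen_mem_piece _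
  obtain ⟨rfl, rfl, rfl⟩ := hM
  refine add_mem ?_ (rightDer_single_mem (fun g hg f => ?_) (fun g hg f => ?_) f)
  · change Finsupp.mapRange.linearMap (totalD μ) (Finsupp.single M f) ∈ _
    rw [Finsupp.mapRange.linearMap_apply, Finsupp.mapRange_single]
    exact single_mem_piece M _
  · have := wedge_mem_piece (single_mem_piece ⟨M.odd.erase g, M.even⟩ f) (hodd g)
    simp only [Mono.antigh_eq_weight, Mono.puregh_eq_weight, Mono.formDeg_eq_weight] at this
    rw [Mono.weight_erase _ _ hg, Mono.weight_erase _ _ hg, Mono.weight_erase _ _ hg,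
      ← Mono.formDeg_eq_weight] at this
    exact this
  · have := wedge_mem_piece (single_mem_piece ⟨M.odd, M.even - Finsupp.single g 1⟩ f) (heven g)
    have h0 := Mono.weight_sub OddGen.formDeg (0 : EvenGen n q r → ℤ) hg
    rw [Pi.zero_apply] at h0
    simp only [Mono.antigh_eq_weight, Mono.puregh_eq_weight, Mono.formDeg_eq_weight] at this
    rw [Mono.weight_sub _ _ hg, Mono.weight_sub _ _ hg, h0, ← Mono.formDeg_eq_weight] at this
    exact this

theorem contrOdd_mem_piece (g : OddGen n m q r) {j k p : ℤ} {a : Form n m q r}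
    (ha : a ∈ piece n m q r j k p) :
    contrOdd g a ∈ piece n m q r (j - g.antigh) (k - g.puregh) (p - g.formDeg) := by
  refine mem_piece.2 (contrOdd_mem (fun M hM hg => ?_) (mem_piece.1 ha))
  obtain ⟨rfl, rfl, rfl⟩ := hM
  simp only [Mono.antigh_eq_weight, Mono.puregh_eq_weight, Mono.formDeg_eq_weight]
  rw [← Mono.weight_erase OddGen.antigh EvenGen.antigh hg,
    ← Mono.weight_erase OddGen.puregh EvenGen.puregh hg,
    ← Mono.weight_erase OddGen.formDeg 0 hg]
  exact ⟨(add_sub_cancel_right _ _).symm, (add_sub_cancel_right _ _).symm,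
    (add_sub_cancel_right _ _).symm⟩

theorem contrEven_mem_piece (g : EvenGen n q r) {j k p : ℤ} {a : Form n m q r}
    (ha : a ∈ piece n m q r j k p) :
    contrEven g a ∈ piece n m q r (j - g.antigh) (k - g.puregh) p := by
  refine mem_piece.2 (contrEven_mem (fun M hM hg => ?_) (mem_piece.1 ha))
  obtain ⟨rfl, rfl, rfl⟩ := hM
  have h0 := Mono.weight_sub OddGen.formDeg (0 : EvenGen n q r → ℤ) hg
  rw [Pi.zero_apply, add_zero] at h0
  simp only [Mono.antigh_eq_weight, Mono.puregh_eq_weight, Mono.formDeg_eq_weight]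
  rw [← Mono.weight_sub OddGen.antigh EvenGen.antigh hg,
    ← Mono.weight_sub OddGen.puregh EvenGen.puregh hg]
  exact ⟨(add_sub_cancel_right _ _).symm, (add_sub_cancel_right _ _).symm, h0⟩

theorem wedge_contrOdd_single (g : OddGen n m q r) (M : Mono n m q r) (f : LocFun n m) :
    wedge (contrOdd g (Finsupp.single M f)) (oddGen g) =
      if g ∈ M.odd then Finsupp.single M f else 0 := by
  split_ifs with hg
  · have := contrOdd_wedge_oddGen g g (Finsupp.single M f)
    rw [single_wedge_oddGen_of_mem f hg, map_zero, if_pos rfl] at this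
    exact (sub_eq_zero.1 this.symm).symm
  · rw [contrOdd_single, if_neg hg, wedge_zero_left]

theorem wedge_contrEven_single (g : EvenGen n q r) (M : Mono n m q r) (f : LocFun n m) :
    wedge (contrEven g (Finsupp.single M f)) (evenGen g) = M.even g • Finsupp.single M f := by
  rw [contrEven_single, wedge_nsmul_left, single_wedge_evenGen]
  by_cases hg : M.even g = 0
  · rw [hg, zero_smul, zero_smul]
  · have : M.even - Finsupp.single g 1 + Finsupp.single g 1 = M.even :=
      tsub_add_cancel_of_le (Finsupp.single_le_iff.2 (Nat.one_le_iff_ne_zero.2 hg))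
    simp only [this]

theorem Mono.formDeg_eq_card (M : Mono n m q r) :
    M.formDeg = (Finset.univ.filter fun μ => OddGen.dx μ ∈ M.odd).card := by
  classical
  have h : ((Finset.univ.filter fun μ => OddGen.dx μ ∈ M.odd).map
      ⟨OddGen.dx, fun μ ν h => by cases h; rfl⟩) ⊆ M.odd := by
    intro g hg
    obtain ⟨μ, hμ, rfl⟩ := Finset.mem_map.1 hg
    exact (Finset.mem_filter.1 hμ).2
  rw [Mono.formDeg, ← Finset.sum_subset h, Finset.sum_map]
  · change ∑ μ ∈ _, (1 : ℤ) = _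
    simp
  · intro g hg hg'
    cases g with
    | dx μ => exact absurd (Finset.mem_map.2 ⟨μ, by simp [hg], rfl⟩) hg'
    | _ => rfl

theorem sum_contrOdd_wedge_dx {j g p : ℤ} {a : Form n m q r} (ha : a ∈ piece n m q r j g p) :
    ∑ μ : Fin n, contrOdd (.dx μ) (wedge a (oddGen (.dx μ))) = (n - p : ℝ) • a := by
  refine supported_induction (P := fun a : Form n m q r =>
    ∑ μ : Fin n, contrOdd (.dx μ) (wedge a (oddGen (.dx μ))) = (n - p : ℝ) • a) (by simp)
    (fun x y hx hy => ?_) (fun M hM f => ?_) a (mem_piece.1 ha)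
  · simp only [wedge_add_left, map_add, Finset.sum_add_distrib, hx, hy, smul_add]
  · have h : ∀ μ : Fin n, contrOdd (.dx μ) (wedge (Finsupp.single M f) (oddGen (.dx μ))) =
        Finsupp.single M f - if OddGen.dx μ ∈ M.odd then Finsupp.single M f else 0 := by
      intro μ
      rw [contrOdd_wedge_oddGen, wedge_contrOdd_single, if_pos rfl]
    rw [Finset.sum_congr rfl fun μ _ => h μ, Finset.sum_sub_distrib, ← Finset.sum_filter,
      Finset.sum_const, Finset.sum_const, Finset.card_univ, Fintype.card_fin, ← hM.2.2,
      M.formDeg_eq_card, sub_smul, Nat.cast_smul_eq_nsmul, Int.cast_natCast,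
      Nat.cast_smul_eq_nsmul]

theorem eq_zero_of_mem_piece_lt {j g p : ℤ} (h : (n : ℤ) < p) {a : Form n m q r}
    (ha : a ∈ piece n m q r j g p) : a = 0 := by
  refine Finsupp.ext fun M => ?_
  by_contra hM
  obtain ⟨-, -, h3⟩ := mem_formsOn.1 (mem_piece.1 ha) M hM
  rw [M.formDeg_eq_card] at h3
  have := Finset.card_filter_le (Finset.univ : Finset (Fin n)) fun μ => OddGen.dx μ ∈ M.odd
  rw [Finset.card_univ, Fintype.card_fin] at this
  omega

variable {T : GaugeTheory n m q r}

theorem commute_of_forall {V : Type*} [AddCommGroup V] [Module ℝ V] {X Y : Module.End ℝ V}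
    (h : ∀ a, X (Y a) = Y (X a)) : Commute X Y :=
  LinearMap.ext h

theorem anticommute_of_forall {V : Type*} [AddCommGroup V] [Module ℝ V] {X Y : Module.End ℝ V}
    (h : ∀ a, X (Y a) = -Y (X a)) : X * Y = -(Y * X) :=
  LinearMap.ext h

namespace GaugeTheory.BRSTDifferential

variable (s : T.BRSTDifferential)
include s

/-- The graded commutator of `δ` with a right derivation is determined by the generators. -/
theorem apply_delta {ε : ℕ} {X : Form n m q r →ₗ[ℝ] Form n m q r} (hX : IsRightDer ε X)
    (hX0 : ∀ f, X (ofFun f) = 0)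
    (odd : ∀ g, X (T.deltaOdd g) = (-1 : ℤ) ^ ε • T.delta (X (oddGen g)))
    (even : ∀ g, X (T.deltaEven g) = (-1 : ℤ) ^ ε • T.delta (X (evenGen g))) (a : Form n m q r) :
    X (T.delta a) = (-1 : ℤ) ^ ε • T.delta (X a) := by
  have h := hX.commutator s.isRightDer_delta
  have h0 : ∀ f, T.delta (ofFun f) = 0 := fun f => rightDer_ofFun _ _ f
  have h1 : ∀ g, T.delta (oddGen g) = T.deltaOdd g := fun g => rightDer_oddGen _ _ g
  have h2 : ∀ g, T.delta (evenGen g) = T.deltaEven g := fun g => rightDer_evenGen _ _ g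
  have e : ∀ x, (X ∘ₗ T.delta.restrictScalars ℝ -
      (-1 : ℤ) ^ (ε * 1) • (T.delta.restrictScalars ℝ ∘ₗ X)) x =
      X (T.delta x) - (-1 : ℤ) ^ ε • T.delta (X x) := fun x => by rw [mul_one]; rfl
  have := h.ext (isRightDer_zero _) (fun f => by rw [e, hX0, h0]; simp)
    (fun g => by rw [e, h1, odd, sub_self]; rfl) (fun g => by rw [e, h2, even, sub_self]; rfl)
  have := LinearMap.congr_fun this a
  rw [e] at this
  exact sub_eq_zero.1 this

theorem contrOdd_delta {g : OddGen n m q r} (hg : 0 < g.puregh + g.formDeg) (a : Form n m q r) :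
    contrOdd g (T.delta a) = -T.delta (contrOdd g a) := by
  have h0 : T.delta (ofFun 1) = 0 := rightDer_ofFun _ _ _
  have hpos : ∀ M : Mono n m q r, g ∈ M.odd → 0 < M.puregh + M.formDeg := fun M hM => by
    have := Mono.puregh_le_of_mem_odd hM
    have := Mono.formDeg_le_of_mem_odd hM
    omega
  have key : ∀ {j : ℤ} {x : Form n m q r}, x ∈ piece n m q r j 0 0 → contrOdd g x = 0 := by
    intro j x hx
    refine contrOdd_eq_zero (formsOn_mono ?_ (mem_piece.1 hx))
    rintro M ⟨-, h1, h2⟩ hM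
    have := hpos M hM
    omega
  have := s.apply_delta (isRightDer_contrOdd g) (fun f => contrOdd_ofFun g f) (fun h => ?_)
    (fun h => ?_) a
  · rwa [pow_one, neg_smul, one_smul] at this
  · have e : T.delta (contrOdd g (oddGen h)) = 0 := by
      rw [contrOdd_oddGen]
      split_ifs
      exacts [h0, map_zero _]
    change contrOdd g _ = _ • T.delta (contrOdd g _)
    rw [e, smul_zero]
    cases h with
    | dx μ => exact map_zero _
    | ghost α J => exact map_zero _
    | antifield i J =>
      rw [T.deltaOdd_antifield (i, J)]
      exact contrOdd_ofFun _ _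
    | antighost2 Δ J => exact key (s.deltaOdd_antighost2_mem Δ J)
  · have e : T.delta (contrOdd g (evenGen h)) = 0 := by
      rw [contrOdd_evenGen, map_zero]
    change contrOdd g _ = _ • T.delta (contrOdd g _)
    rw [e, smul_zero]
    cases h with
    | ghost2 Δ J => exact map_zero _
    | antighost α J => exact key (s.deltaEven_antighost_mem α J)

theorem contrEven_delta {g : EvenGen n q r} (hg : 0 < g.puregh) (a : Form n m q r) :
    contrEven g (T.delta a) = T.delta (contrEven g a) := by
  have h0 : T.delta (ofFun 1) = 0 := rightDer_ofFun _ _ _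
  have key : ∀ {j : ℤ} {x : Form n m q r}, x ∈ piece n m q r j 0 0 → contrEven g x = 0 := by
    intro j x hx
    refine contrEven_eq_zero (formsOn_mono ?_ (mem_piece.1 hx))
    rintro M ⟨-, h1, h2⟩
    have := M.mul_puregh_le g
    rw [h1] at this
    by_contra hM
    have : 0 < (M.even g : ℤ) * g.puregh :=
      mul_pos (by exact_mod_cast Nat.pos_of_ne_zero hM) hg
    omega
  have := s.apply_delta (isRightDer_contrEven g) (fun f => contrEven_ofFun g f) (fun h => ?_)
    (fun h => ?_) a
  · rwa [pow_zero, one_smul] at this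
  · have e : T.delta (contrEven g (oddGen h)) = 0 := by
      rw [contrEven_oddGen, map_zero]
    change contrEven g _ = _ • T.delta (contrEven g _)
    rw [e, smul_zero]
    cases h with
    | dx μ => exact map_zero _
    | ghost α J => exact map_zero _
    | antifield i J =>
      rw [T.deltaOdd_antifield (i, J)]
      exact contrEven_ofFun _ _
    | antighost2 Δ J => exact key (s.deltaOdd_antighost2_mem Δ J)
  · have e : T.delta (contrEven g (evenGen h)) = 0 := by
      rw [contrEven_evenGen]
      split_ifs
      exacts [h0, map_zero _]
    change contrEven g _ = _ • T.delta (contrEven g _)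
    rw [e, smul_zero]
    cases h with
    | ghost2 Δ J => exact map_zero _
    | antighost α J => exact key (s.deltaEven_antighost_mem α J)

omit s in
theorem delta_wedge_evenGen (s : T.BRSTDifferential) (a : Form n m q r) (g : EvenGen n q r) :
    T.delta (wedge a (evenGen g)) = wedge a (T.deltaEven g) + wedge (T.delta a) (evenGen g) := by
  have := s.isRightDer_delta.evenGen a g
  simp only [LinearMap.restrictScalars_apply] at this
  rw [this, GaugeTheory.delta, rightDer_evenGen]

/-- The local forms of given pure ghost number as a variational complex. -/
def variationalData (hreg : T.Regular) (g : ℤ) : VariationalData n (Form n m q r) where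
  D := formD
  Ds := formDs
  e μ := (rightMul (oddGen (.dx μ))).restrictScalars ℝ
  i μ := (contrOdd (.dx μ)).restrictScalars ℝ
  δ := T.deltaR
  A j p := piece n m q r j g p
  Ds_zero := formDs_zero
  Ds_shift J μ := LinearMap.ext fun a => (formDs_shift J μ a).trans (formDs_formD J μ a).symm
  D_comm μ ν := commute_of_forall fun a => formD_comm μ ν a
  D_e μ ν := commute_of_forall fun a => formD_wedge_dx μ ν a
  D_i μ ν := commute_of_forall fun a => (contrOdd_formD (fun k => by
    cases k <;> simp [shiftOdd]) a).symm
  δ_D μ := commute_of_forall fun a => s.delta_formD μ a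
  e_e μ ν := anticommute_of_forall fun a => wedge_oddGen_oddGen a (.dx ν) (.dx μ)
  e_i μ ν := LinearMap.ext fun a => by
    change wedge (contrOdd (.dx ν) a) (oddGen (.dx μ)) +
      contrOdd (.dx ν) (wedge a (oddGen (.dx μ))) = _
    rw [contrOdd_wedge_oddGen, add_sub_cancel]
    by_cases h : μ = ν
    · rw [if_pos h, if_pos (by rw [h])]; rfl
    · rw [if_neg h, if_neg fun h' => h (by cases h'; rfl)]; rfl
  δ_e μ := anticommute_of_forall fun a => by
    refine (s.delta_wedge_oddGen a (.dx μ)).trans ?_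
    rw [show T.deltaOdd (.dx μ) = 0 from rfl, wedge_zero_right, zero_sub]
    rfl
  δ_i μ := anticommute_of_forall fun a => by
    have := s.contrOdd_delta (g := .dx μ) (by simp [OddGen.puregh, OddGen.formDeg]) a
    exact (neg_eq_iff_eq_neg.2 this).symm
  D_mem μ j p x hx := formD_mem_piece μ hx
  e_mem μ j p x hx := by
    have := wedge_mem_piece hx (oddGen_mem_piece (.dx μ))
    simp only [OddGen.antigh, OddGen.puregh, OddGen.formDeg, add_zero] at this
    exact this
  i_mem μ j p x hx := by
    have := contrOdd_mem_piece (.dx μ) hx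
    simp only [OddGen.antigh, OddGen.puregh, OddGen.formDeg, sub_zero] at this
    exact this
  count j p x hx := by
    have := sum_contrOdd_wedge_dx hx
    rw [← this]
    exact Finset.sum_congr rfl fun μ _ => rfl
  eq_zero j p h x hx := eq_zero_of_mem_piece_lt h hx
  exact j p hj x hx h := by
    obtain ⟨y, hy, hyx⟩ := s.exists_primitive hreg hj hx (show T.delta x = 0 from h)
    exact ⟨y, hy, show T.delta y = x from hyx⟩

end GaugeTheory.BRSTDifferential

end Operators

/-! ### Triviality of the relative cohomology in positive pure ghost number -/

section Marking

variable {n m q r : ℕ}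

theorem MIdx.shift_injective (μ : Fin n) : Function.Injective fun J : MIdx n => J.shift μ :=
  fun _ _ h => add_right_cancel h

theorem MIdx.shift_ne {K : MIdx n} {μ : Fin n} (hK : K μ = 0) (J : MIdx n) : J.shift μ ≠ K := by
  rintro rfl
  simp [MIdx.shift] at hK

theorem markMul_apply_shift {V : Type*} [AddCommGroup V] [Module ℝ V] (μ : Fin n)
    (x : Marked n V) (J : MIdx n) : markMul μ x (J.shift μ) = x J :=
  Finsupp.mapDomain_apply (MIdx.shift_injective μ) x J

theorem markMul_apply_eq_zero {V : Type*} [AddCommGroup V] [Module ℝ V] {μ : Fin n}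
    (x : Marked n V) {K : MIdx n} (hK : K μ = 0) : markMul μ x K = 0 :=
  Finsupp.mapDomain_of_notMem_range x K (by rintro ⟨J, hJ⟩; exact MIdx.shift_ne hK J hJ)

/-- Replacement of the marks `t^J` by the forms `C_J`. -/
def unmark (C : MIdx n → Form n m q r) : Marked n (Form n m q r) →ₗ[ℝ] Form n m q r :=
  Finsupp.lsum ℝ fun J => (rightMul (C J)).restrictScalars ℝ

theorem unmark_single (C : MIdx n → Form n m q r) (J : MIdx n) (a : Form n m q r) :
    unmark C (Finsupp.single J a) = wedge a (C J) := by
  rw [unmark, Finsupp.lsum_single]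
  rfl

/-- Replacement of each factor `γ J` in turn by the mark `t^J`, for a family of anticommuting
generators. -/
def markOdd (γ : MIdx n → OddGen n m q r) (hγ : Function.Injective γ) :
    Form n m q r →ₗ[ℝ] Marked n (Form n m q r) :=
  Finsupp.lsum ℝ fun M => ∑ J ∈ M.odd.preimage γ hγ.injOn,
    Finsupp.lsingle J ∘ₗ (contrOdd (γ J)).restrictScalars ℝ ∘ₗ Finsupp.lsingle M

theorem markOdd_single (γ : MIdx n → OddGen n m q r) (hγ : Function.Injective γ)
    (M : Mono n m q r) (f : LocFun n m) :
    markOdd γ hγ (Finsupp.single M f) = ∑ J ∈ M.odd.preimage γ hγ.injOn,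
      Finsupp.single J (contrOdd (γ J) (Finsupp.single M f)) := by
  rw [markOdd, Finsupp.lsum_single, LinearMap.sum_apply]
  rfl

theorem markOdd_apply (γ : MIdx n → OddGen n m q r) (hγ : Function.Injective γ)
    (a : Form n m q r) (J : MIdx n) : markOdd γ hγ a J = contrOdd (γ J) a := by
  classical
  induction a using Finsupp.induction_linear with
  | zero => rw [map_zero, map_zero]; rfl
  | add x y hx hy => rw [map_add, map_add, Finsupp.add_apply, hx, hy]
  | single M f =>
    rw [markOdd_single, Finsupp.finsetSum_apply]
    simp only [Finsupp.single_apply]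
    rw [Finset.sum_ite_eq']
    split_ifs with h
    · rfl
    · rw [contrOdd_single, if_neg fun h' => h (Finset.mem_preimage.2 h')]

theorem unmark_markOdd_single (γ : MIdx n → OddGen n m q r) (hγ : Function.Injective γ)
    (M : Mono n m q r) (f : LocFun n m) :
    unmark (fun J => oddGen (γ J)) (markOdd γ hγ (Finsupp.single M f)) =
      (M.odd.preimage γ hγ.injOn).card • Finsupp.single M f := by
  rw [markOdd_single, map_sum, ← Finset.sum_const]
  refine Finset.sum_congr rfl fun J hJ => ?_
  rw [unmark_single, wedge_contrOdd_single, if_pos (Finset.mem_preimage.1 hJ)]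

/-- Replacement of each factor `γ J` in turn by the mark `t^J`, for a family of commuting
generators. -/
def markEven (γ : MIdx n → EvenGen n q r) (hγ : Function.Injective γ) :
    Form n m q r →ₗ[ℝ] Marked n (Form n m q r) :=
  Finsupp.lsum ℝ fun M => ∑ J ∈ M.even.support.preimage γ hγ.injOn,
    Finsupp.lsingle J ∘ₗ (contrEven (γ J)).restrictScalars ℝ ∘ₗ Finsupp.lsingle M

theorem markEven_single (γ : MIdx n → EvenGen n q r) (hγ : Function.Injective γ)
    (M : Mono n m q r) (f : LocFun n m) :
    markEven γ hγ (Finsupp.single M f) = ∑ J ∈ M.even.support.preimage γ hγ.injOn,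
      Finsupp.single J (contrEven (γ J) (Finsupp.single M f)) := by
  rw [markEven, Finsupp.lsum_single, LinearMap.sum_apply]
  rfl

theorem markEven_apply (γ : MIdx n → EvenGen n q r) (hγ : Function.Injective γ)
    (a : Form n m q r) (J : MIdx n) : markEven γ hγ a J = contrEven (γ J) a := by
  classical
  induction a using Finsupp.induction_linear with
  | zero => rw [map_zero, map_zero]; rfl
  | add x y hx hy => rw [map_add, map_add, Finsupp.add_apply, hx, hy]
  | single M f =>
    rw [markEven_single, Finsupp.finsetSum_apply]
    simp only [Finsupp.single_apply]
    rw [Finset.sum_ite_eq']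
    split_ifs with h
    · rfl
    · rw [Finset.mem_preimage] at h
      rw [contrEven_single, Finsupp.notMem_support_iff.1 h, zero_smul]

theorem unmark_markEven_single (γ : MIdx n → EvenGen n q r) (hγ : Function.Injective γ)
    (M : Mono n m q r) (f : LocFun n m) :
    unmark (fun J => evenGen (γ J)) (markEven γ hγ (Finsupp.single M f)) =
      (∑ J ∈ M.even.support.preimage γ hγ.injOn, M.even (γ J)) • Finsupp.single M f := by
  rw [markEven_single, map_sum, Finset.sum_smul]
  refine Finset.sum_congr rfl fun J hJ => ?_
  rw [unmark_single, wedge_contrEven_single]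

theorem ghost_injective (α : Fin q) :
    Function.Injective (OddGen.ghost α : MIdx n → OddGen n m q r) :=
  fun J K h => by cases h; rfl

theorem ghost2_injective (Δ : Fin r) :
    Function.Injective (EvenGen.ghost2 Δ : MIdx n → EvenGen n q r) :=
  fun J K h => by cases h; rfl

theorem Mono.puregh_eq_sum (M : Mono n m q r) :
    M.puregh = ∑ α, ((M.odd.preimage (OddGen.ghost α) (ghost_injective α).injOn).card : ℤ) +
      ∑ Δ, 2 * ((∑ J ∈ M.even.support.preimage (EvenGen.ghost2 Δ) (ghost2_injective Δ).injOn,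
        M.even (.ghost2 Δ J) : ℕ) : ℤ) := by
  classical
  rw [Mono.puregh, Finsupp.sum]
  congr 1
  · have h : ∀ α : Fin q, ((M.odd.preimage (OddGen.ghost α) (ghost_injective α).injOn).card : ℤ) =
        ∑ g ∈ M.odd, if g ∈ Set.range (OddGen.ghost α) then 1 else 0 := fun α => by
      rw [← Finset.sum_filter, ← Finset.sum_preimage' (OddGen.ghost α) M.odd
        (ghost_injective α).injOn (fun _ => (1 : ℤ))]
      simp
    rw [Finset.sum_congr rfl fun α _ => h α, Finset.sum_comm]
    refine Finset.sum_congr rfl fun g _ => ?_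
    cases g <;> simp [OddGen.puregh]
  · have h : ∀ Δ : Fin r, 2 * ((∑ J ∈ M.even.support.preimage (EvenGen.ghost2 Δ)
        (ghost2_injective Δ).injOn, M.even (.ghost2 Δ J) : ℕ) : ℤ) =
        ∑ g ∈ M.even.support, if g ∈ Set.range (EvenGen.ghost2 Δ) then 2 * (M.even g : ℤ) else 0 :=
      fun Δ => by
      rw [← Finset.sum_filter, ← Finset.sum_preimage' (EvenGen.ghost2 Δ) M.even.support
        (ghost2_injective Δ).injOn (fun g => 2 * (M.even g : ℤ)), ← Finset.mul_sum]
      push_cast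
      rfl
    rw [Finset.sum_congr rfl fun Δ _ => h Δ, Finset.sum_comm]
    refine Finset.sum_congr rfl fun g _ => ?_
    cases g <;> simp [EvenGen.puregh, mul_comm]

/-- The counting operator of the pure ghost number. -/
theorem sum_unmark_mark {j g p : ℤ} {a : Form n m q r} (ha : a ∈ piece n m q r j g p) :
    ∑ α, unmark (fun J => oddGen (.ghost α J)) (markOdd _ (ghost_injective α) a) +
      ∑ Δ, (2 : ℤ) • unmark (fun J => evenGen (.ghost2 Δ J)) (markEven _ (ghost2_injective Δ) a) =
      g • a := by
  refine supported_induction (P := fun a : Form n m q r =>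
    ∑ α, unmark (fun J => oddGen (.ghost α J)) (markOdd _ (ghost_injective α) a) +
      ∑ Δ, (2 : ℤ) • unmark (fun J => evenGen (.ghost2 Δ J)) (markEven _ (ghost2_injective Δ) a) =
      g • a) (by simp) (fun x y hx hy => ?_) (fun M hM f => ?_) a (mem_piece.1 ha)
  · simp only [map_add, smul_add, Finset.sum_add_distrib, ← hx, ← hy]
    abel
  · simp only [unmark_markOdd_single, unmark_markEven_single]
    rw [← hM.2.1, M.puregh_eq_sum, add_smul, Finset.sum_smul, Finset.sum_smul]
    simp only [mul_smul, natCast_zsmul]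

theorem extD_apply (a : Form n m q r) :
    extD a = ∑ μ : Fin n, wedge (formD μ a) (oddGen (.dx μ)) := by
  rw [extD, LinearMap.sum_apply]
  rfl

variable {T : GaugeTheory n m q r}

namespace GaugeTheory.BRSTDifferential

variable (s : T.BRSTDifferential)
include s

/-- The part of a cocycle of `δ` modulo `d` that counts the generators of one family is trivial.
Here `C J` are the generators of the family, of pure ghost number `w`, and `X J` the derivatives with
respect to them; the sign `ε` is that of the commutation of `C J` with the anticommuting
generators. -/
theorem unmark_mark_mem (hreg : T.Regular) {j g w p : ℤ} (hj : 1 ≤ j) {ε : ℤ} (hε : ε * ε = 1)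
    {X : MIdx n → Form n m q r → Form n m q r} {C : MIdx n → Form n m q r}
    {Λ : Form n m q r →ₗ[ℝ] Marked n (Form n m q r)} (hΛ : ∀ a J, Λ a J = X J a)
    (hXD : ∀ J μ a, X (J.shift μ) (formD μ a) = formD μ (X (J.shift μ) a) + X J a)
    (hXD0 : ∀ J μ a, J μ = 0 → X J (formD μ a) = formD μ (X J a))
    (hXe : ∀ J μ a, X J (wedge a (oddGen (.dx μ))) = ε • wedge (X J a) (oddGen (.dx μ)))
    (hXδ : ∀ J a, X J (T.delta a) = ε • T.delta (X J a))
    (hXmem : ∀ J, ∀ a ∈ piece n m q r j g p, X J a ∈ piece n m q r j (g - w) p)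
    (hCD : ∀ J μ a, formD μ (wedge a (C J)) = wedge (formD μ a) (C J) + wedge a (C (J.shift μ)))
    (hCe : ∀ J μ a, wedge (wedge a (oddGen (.dx μ))) (C J) =
      ε • wedge (wedge a (C J)) (oddGen (.dx μ)))
    (hCδ : ∀ J a, T.delta (wedge a (C J)) = ε • wedge (T.delta a) (C J))
    (hCmem : ∀ J j p, ∀ a ∈ piece n m q r j (g - w) p, wedge a (C J) ∈ piece n m q r j g p)
    {a b : Form n m q r} (ha : a ∈ piece n m q r j g p) (hab : T.delta a + extD b = 0) :
    ∃ u ∈ piece n m q r (j + 1) g p, ∃ v ∈ piece n m q r j g (p - 1),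
      T.delta u + extD v = unmark C (Λ a) := by
  have hεε : ∀ x : Form n m q r, ε • ε • x = x := fun x => by rw [smul_smul, hε, one_smul]
  let S := s.variationalData hreg (g - w)
  have hSe : ∀ μ (x : Form n m q r), S.e μ x = wedge x (oddGen (.dx μ)) := fun _ _ => rfl
  have hSD : ∀ μ (x : Form n m q r), S.D μ x = formD μ x := fun _ _ => rfl
  have hSδ : ∀ x : Form n m q r, S.δ x = T.delta x := fun _ => rfl
  -- marking intertwines `δ` and `d` with the operators of the variational complex, up to `ε`
  have h1 : Λ (T.delta a) = ε • coeffMap S.δ (Λ a) := by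
    refine Finsupp.ext fun J => ?_
    rw [hΛ, hXδ, Finsupp.smul_apply, coeffMap_apply, hΛ, hSδ]
  have h2 : Λ (extD b) = ε • S.d (Λ b) := by
    refine Finsupp.ext fun K => ?_
    rw [extD_apply, map_sum, Finsupp.finsetSum_apply, Finsupp.smul_apply, VariationalData.d,
      LinearMap.sum_apply, Finsupp.finsetSum_apply, Finset.smul_sum]
    refine Finset.sum_congr rfl fun μ _ => ?_
    rw [hΛ, hXe, Module.End.mul_apply, VariationalData.P, LinearMap.add_apply, Finsupp.add_apply,
      coeffMap_apply, coeffMap_apply, hΛ, hSe, hSD, formD_wedge_dx]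
    congr 1
    by_cases hK : K μ = 0
    · rw [markMul_apply_eq_zero _ hK, zero_add, hXD0 K μ b hK]
    · obtain ⟨J, rfl⟩ : ∃ J, K = MIdx.shift J μ := ⟨_, (MIdx.sub_single_shift hK).symm⟩
      rw [markMul_apply_shift, hXD, wedge_add_left, coeffMap_apply, hΛ, hSe, add_comm]
  have h3 : coeffMap S.δ (Λ a) + S.d (Λ b) = 0 := by
    have := congrArg (fun x => ε • Λ x) hab
    simp only [map_add, map_zero, smul_zero, h1, h2, smul_add, smul_smul, hε, one_smul] at this
    exact this
  obtain ⟨x, hx, y, hy, hxy⟩ := S.exists_relative_primitive hj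
    (show Λ a ∈ markedIn (S.A j p) from fun J => hΛ a J ▸ hXmem J a ha) h3
  have hmem : ∀ {j p : ℤ} {x : Marked n (Form n m q r)}, x ∈ markedIn (S.A j p) →
      unmark C x ∈ piece n m q r j g p := by
    intro j p x hx
    rw [← Finsupp.sum_single x, Finsupp.sum, map_sum]
    refine sum_mem fun J _ => ?_
    rw [unmark_single]
    exact hCmem J j p _ (hx J)
  -- and so does the replacement of the marks by the generators
  have h4 : ∀ x, unmark C (coeffMap S.δ x) = ε • T.delta (unmark C x) := by
    intro x
    induction x using Finsupp.induction_linear with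
    | zero => simp
    | add x y hx hy => simp only [map_add, smul_add, hx, hy]
    | single J y =>
      rw [coeffMap_single, unmark_single, unmark_single, hCδ, hεε, hSδ]
  have h5 : ∀ x, unmark C (S.d x) = ε • extD (unmark C x) := by
    intro x
    induction x using Finsupp.induction_linear with
    | zero => simp
    | add x y hx hy => simp only [map_add, smul_add, hx, hy]
    | single J y =>
      rw [VariationalData.d, LinearMap.sum_apply, map_sum, unmark_single, extD_apply,
        Finset.smul_sum]
      refine Finset.sum_congr rfl fun μ _ => ?_
      rw [Module.End.mul_apply, coeffMap_single, VariationalData.P, LinearMap.add_apply,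
        markMul_single, coeffMap_single, map_add, unmark_single, unmark_single, hSe, hSD,
        add_comm, ← hCD, hCe, map_zsmul, formD_wedge_dx]
  refine ⟨ε • unmark C x, zsmul_mem (hmem hx) ε, ε • unmark C y, zsmul_mem (hmem hy) ε, ?_⟩
  rw [map_zsmul, map_zsmul, ← h4, ← h5, ← map_add, hxy]

theorem unmark_markOdd_mem (hreg : T.Regular) {j g p : ℤ} (hj : 1 ≤ j) (α : Fin q)
    {a b : Form n m q r} (ha : a ∈ piece n m q r j g p) (hab : T.delta a + extD b = 0) :
    ∃ u ∈ piece n m q r (j + 1) g p, ∃ v ∈ piece n m q r j g (p - 1), T.delta u + extD v =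
      unmark (fun J => oddGen (.ghost α J)) (markOdd _ (ghost_injective α) a) := by
  refine s.unmark_mark_mem hreg hj (w := 1) (ε := -1) (by norm_num)
    (X := fun J => contrOdd (.ghost α J)) (fun a J => markOdd_apply _ _ a J) (fun J μ a => ?_)
    (fun J μ a hJ => ?_) (fun J μ a => ?_) (fun J a => ?_) (fun J a ha => ?_) (fun J μ a => ?_)
    (fun J μ a => ?_) (fun J a => ?_) (fun J j p a ha => ?_) ha hab
  · refine contrOdd_formD_add (fun k => ?_) a
    cases k with
    | ghost β K =>
      simp only [shiftOdd, contrOdd_oddGen, OddGen.ghost.injEq]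
      simp only [(MIdx.shift_injective μ).eq_iff]
    | _ => simp [shiftOdd]
  · refine contrOdd_formD (fun k => ?_) a
    cases k with
    | ghost β K =>
      simp only [shiftOdd, contrOdd_oddGen, OddGen.ghost.injEq]
      rw [if_neg fun h => MIdx.shift_ne hJ K h.2]
    | _ => simp [shiftOdd]
  · rw [contrOdd_wedge_oddGen, if_neg (by simp), zero_sub, neg_smul, one_smul]
  · rw [s.contrOdd_delta (by simp [OddGen.puregh, OddGen.formDeg]), neg_smul, one_smul]
  · have := contrOdd_mem_piece (.ghost α J) ha
    simpa only [OddGen.antigh, OddGen.puregh, OddGen.formDeg, sub_zero] using this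
  · rw [(isRightDer_formD μ).oddGen, formD_oddGen, pow_zero, one_smul, add_comm]
    rfl
  · rw [wedge_oddGen_oddGen, neg_smul, one_smul]
  · rw [s.delta_wedge_oddGen, show T.deltaOdd (.ghost α J) = 0 from rfl, wedge_zero_right,
      zero_sub, neg_smul, one_smul]
  · have := wedge_mem_piece ha (oddGen_mem_piece (.ghost α J))
    simpa only [OddGen.antigh, OddGen.puregh, OddGen.formDeg, add_zero, sub_add_cancel] using this

theorem unmark_markEven_mem (hreg : T.Regular) {j g p : ℤ} (hj : 1 ≤ j) (Δ : Fin r)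
    {a b : Form n m q r} (ha : a ∈ piece n m q r j g p) (hab : T.delta a + extD b = 0) :
    ∃ u ∈ piece n m q r (j + 1) g p, ∃ v ∈ piece n m q r j g (p - 1), T.delta u + extD v =
      unmark (fun J => evenGen (.ghost2 Δ J)) (markEven _ (ghost2_injective Δ) a) := by
  refine s.unmark_mark_mem hreg hj (w := 2) (ε := 1) (by norm_num)
    (X := fun J => contrEven (.ghost2 Δ J)) (fun a J => markEven_apply _ _ a J) (fun J μ a => ?_)
    (fun J μ a hJ => ?_) (fun J μ a => ?_) (fun J a => ?_) (fun J a ha => ?_) (fun J μ a => ?_)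
    (fun J μ a => ?_) (fun J a => ?_) (fun J j p a ha => ?_) ha hab
  · refine contrEven_formD_add (fun k => ?_) a
    cases k with
    | ghost2 Δ' K =>
      simp only [shiftEven, contrEven_evenGen, EvenGen.ghost2.injEq]
      simp only [(MIdx.shift_injective μ).eq_iff]
    | antighost β K => simp [shiftEven]
  · refine contrEven_formD (fun k => ?_) a
    cases k with
    | ghost2 Δ' K =>
      simp only [shiftEven, contrEven_evenGen, EvenGen.ghost2.injEq]
      rw [if_neg fun h => MIdx.shift_ne hJ K h.2]
    | antighost β K => simp [shiftEven]
  · have := (isRightDer_contrEven (m := m) (.ghost2 Δ J : EvenGen n q r)).oddGen a (.dx μ)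
    simp only [LinearMap.restrictScalars_apply, contrEven_oddGen, wedge_zero_right, zero_add,
      pow_zero] at this
    exact this
  · rw [s.contrEven_delta (by simp [EvenGen.puregh]), one_smul]
  · have := contrEven_mem_piece (.ghost2 Δ J) ha
    simpa only [EvenGen.antigh, EvenGen.puregh, sub_zero] using this
  · rw [(isRightDer_formD μ).evenGen, formD_evenGen, add_comm]
    rfl
  · rw [wedge_oddGen_evenGen, one_smul]
  · rw [s.delta_wedge_evenGen, show T.deltaEven (.ghost2 Δ J) = 0 from rfl, wedge_zero_right,
      zero_add, one_smul]
  · have := wedge_mem_piece ha (evenGen_mem_piece (m := m) (.ghost2 Δ J : EvenGen n q r))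
    simpa only [EvenGen.antigh, EvenGen.puregh, add_zero, sub_add_cancel] using this

/-- The cohomology of `δ` modulo `d` is trivial in positive antighost number and positive pure ghost
number. -/
theorem exists_relative_primitive (hreg : T.Regular) {j g p : ℤ} (hj : 1 ≤ j) (hg : 1 ≤ g)
    {a b : Form n m q r} (ha : a ∈ piece n m q r j g p) (hab : T.delta a + extD b = 0) :
    ∃ u ∈ piece n m q r (j + 1) g p, ∃ v ∈ piece n m q r j g (p - 1), T.delta u + extD v = a := by
  choose u hu v hv huv using fun α => s.unmark_markOdd_mem hreg hj α ha hab
  choose u' hu' v' hv' huv' using fun Δ => s.unmark_markEven_mem hreg hj Δ ha hab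
  have h := sum_unmark_mark ha
  simp only [← huv, ← huv'] at h
  have hg0 : (g : ℝ) ≠ 0 := by
    have : g ≠ 0 := by omega
    exact_mod_cast this
  refine ⟨(g : ℝ)⁻¹ • (∑ α, u α + ∑ Δ, (2 : ℤ) • u' Δ), Submodule.smul_mem _ _ (add_mem
    (sum_mem fun α _ => hu α) (sum_mem fun Δ _ => zsmul_mem (hu' Δ) _)),
    (g : ℝ)⁻¹ • (∑ α, v α + ∑ Δ, (2 : ℤ) • v' Δ), Submodule.smul_mem _ _ (add_mem
    (sum_mem fun α _ => hv α) (sum_mem fun Δ _ => zsmul_mem (hv' Δ) _)), ?_⟩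
  have e : ∀ x : Form n m q r, T.delta x = T.deltaR x := fun _ => rfl
  simp only [e] at h ⊢
  rw [map_smul, map_smul, ← smul_add, inv_smul_eq_iff₀ hg0, Int.cast_smul_eq_zsmul, ← h]
  simp only [map_add, map_sum, map_zsmul, smul_add, Finset.sum_add_distrib]
  abel

end GaugeTheory.BRSTDifferential

end Marking

/-! ### Homological perturbation theory -/

section Quotients

variable {V W : Type*} [AddCommGroup V] [Module ℝ V] [AddCommGroup W] [Module ℝ W]

/-- A linear map induces an isomorphism of cohomology groups if it maps cocycles to cocycles,
coboundaries to coboundaries, and is injective and surjective on classes. -/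
theorem exists_quotient_equiv (f : V →ₗ[ℝ] W) {Z B : Submodule ℝ V} {Z' B' : Submodule ℝ W}
    (hZ : ∀ a ∈ Z, f a ∈ Z') (hB : ∀ a ∈ B, f a ∈ B') (hinj : ∀ a ∈ Z, f a ∈ B' → a ∈ B)
    (hsurj : ∀ c ∈ Z', ∃ a ∈ Z, f a - c ∈ B') :
    ∃ Φ : (Z ⧸ B.submoduleOf Z) ≃ₗ[ℝ] (Z' ⧸ B'.submoduleOf Z'),
      ∀ a : Z, ∃ h : f a.1 ∈ Z',
        Φ (Submodule.Quotient.mk a) = Submodule.Quotient.mk ⟨f a.1, h⟩ := by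
  let F : Z →ₗ[ℝ] Z' := f.restrict hZ
  have hF : B.submoduleOf Z ≤ (B'.submoduleOf Z').comap F := fun a ha => hB a.1 ha
  refine ⟨LinearEquiv.ofBijective (Submodule.mapQ _ _ F hF) ⟨?_, ?_⟩, fun a =>
    ⟨hZ a.1 a.2, rfl⟩⟩
  · rw [← LinearMap.ker_eq_bot, LinearMap.ker_eq_bot']
    intro x hx
    obtain ⟨a, rfl⟩ := Submodule.Quotient.mk_surjective _ x
    rw [Submodule.mapQ_apply, Submodule.Quotient.mk_eq_zero] at hx
    rw [Submodule.Quotient.mk_eq_zero]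
    exact hinj a.1 a.2 hx
  · intro y
    obtain ⟨c, rfl⟩ := Submodule.Quotient.mk_surjective _ y
    obtain ⟨a, ha, h⟩ := hsurj c.1 c.2
    refine ⟨Submodule.Quotient.mk ⟨a, ha⟩, ?_⟩
    rw [Submodule.mapQ_apply, Submodule.Quotient.eq]
    exact h

end Quotients

section Perturbation

variable {n m q r : ℕ} {T : GaugeTheory n m q r}

theorem extD_mem {j g p : ℤ} {a : Form n m q r} (ha : a ∈ piece n m q r j g (p - 1)) :
    extD a ∈ piece n m q r j g p := by
  rw [extD_apply]
  refine sum_mem fun μ _ => ?_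
  have := wedge_mem_piece (formD_mem_piece μ ha) (oddGen_mem_piece (.dx μ))
  simpa only [OddGen.antigh, OddGen.puregh, OddGen.formDeg, add_zero, sub_add_cancel] using this

theorem extD_proj (R : ℤ → ℤ → Prop) (a : Form n m q r) :
    extD (proj {M | R M.antigh M.puregh} a) = proj {M | R M.antigh M.puregh} (extD a) := by
  have := map_proj_of_degree (X := (extD : Form n m q r →ₗ[ℝ] _).toAddMonoidHom) (dj := 0)
    (dg := 0) (dp := 1) (fun j g p a ha => by
      rw [add_zero, add_zero]
      exact extD_mem (by rwa [add_sub_cancel_right])) (fun j g _ => R j g) a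
  simp only [sub_zero] at this
  exact this

theorem single_mem_Series {k p : ℤ} {j : ℕ} {a : Form n m q r}
    (ha : a ∈ piece n m q r j (j + k) p) :
    (Pi.single j a : ℕ → Form n m q r) ∈ Series n m q r k p := by
  intro i _
  by_cases h : i = j
  · subst h
    rwa [Pi.single_eq_same]
  · rw [Pi.single_eq_of_ne h]
    exact zero_mem _

namespace GaugeTheory.BRSTDifferential

variable (s : T.BRSTDifferential)

theorem total_apply (a : ℕ → Form n m q r) (j : ℕ) :
    s.total a j = ∑ x ∈ Finset.HasAntidiagonal.antidiagonal (j + 1), s.comp x.1 (a x.2) := by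
  rw [total, LinearMap.pi_apply, LinearMap.sum_apply]
  rfl

theorem comp_extD (k : ℕ) (a : Form n m q r) : s.comp k (extD a) = -extD (s.comp k a) := by
  rw [extD_apply, extD_apply, map_sum, ← Finset.sum_neg_distrib]
  refine Finset.sum_congr rfl fun μ _ => ?_
  rw [(s.isRightDer_comp k).oddGen, s.comp_dx, wedge_zero_right, zero_add, pow_one, neg_smul,
    one_smul, s.comm]

theorem total_extD (a : ℕ → Form n m q r) :
    s.total (extDSeries n m q r a) = -extDSeries n m q r (s.total a) := by
  funext j
  have h : ∀ (b : ℕ → Form n m q r) i, extDSeries n m q r b i = extD (b i) := fun _ _ => rfl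
  rw [Pi.neg_apply, h, total_apply, total_apply, map_sum, ← Finset.sum_neg_distrib]
  exact Finset.sum_congr rfl fun x _ => by rw [h, comp_extD]

/-- `s² = 0` on formal series. The components of `s a` start at antighost number zero, so that `δ a_0`
has to be zero; for elements of `Series` this is automatic. -/
theorem total_total {a : ℕ → Form n m q r} (ha : s.comp 0 (a 0) = 0) :
    s.total (s.total a) = 0 := by
  funext j
  have h : ∑ x ∈ Finset.HasAntidiagonal.antidiagonal (j + 2), s.comp x.1
      (∑ y ∈ Finset.HasAntidiagonal.antidiagonal x.2, s.comp y.1 (a y.2)) = 0 := by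
    have h1 : ∑ x ∈ Finset.HasAntidiagonal.antidiagonal (j + 2),
        ∑ y ∈ Finset.HasAntidiagonal.antidiagonal x.1, s.comp y.1 (s.comp y.2 (a x.2)) = 0 :=
      Finset.sum_eq_zero fun x _ => s.nilpotent x.1 (a x.2)
    simp only [map_sum]
    rw [← h1, Finset.sum_sigma', Finset.sum_sigma']
    refine Finset.sum_nbij' (fun z => ⟨(z.1.1 + z.2.1, z.2.2), (z.1.1, z.2.1)⟩)
      (fun z => ⟨(z.2.1, z.2.2 + z.1.2), (z.2.2, z.1.2)⟩) ?_ ?_ ?_ ?_ ?_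
    · rintro ⟨⟨x1, x2⟩, ⟨y1, y2⟩⟩ h
      simp only [Finset.mem_sigma, Finset.HasAntidiagonal.mem_antidiagonal] at h ⊢
      exact ⟨by omega, trivial⟩
    · rintro ⟨⟨x1, x2⟩, ⟨y1, y2⟩⟩ h
      simp only [Finset.mem_sigma, Finset.HasAntidiagonal.mem_antidiagonal] at h ⊢
      exact ⟨by omega, trivial⟩
    · rintro ⟨⟨x1, x2⟩, ⟨y1, y2⟩⟩ h
      simp only [Finset.mem_sigma, Finset.HasAntidiagonal.mem_antidiagonal] at h
      obtain ⟨-, rfl⟩ := h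
      rfl
    · rintro ⟨⟨x1, x2⟩, ⟨y1, y2⟩⟩ h
      simp only [Finset.mem_sigma, Finset.HasAntidiagonal.mem_antidiagonal] at h
      obtain ⟨-, rfl⟩ := h
      rfl
    · exact fun _ _ => rfl
  rw [Finset.Nat.sum_antidiagonal_succ', Finset.Nat.antidiagonal_zero, Finset.sum_singleton, ha,
    map_zero, zero_add] at h
  rw [total_apply]
  simp only [total_apply]
  exact h

theorem total_mem {k p : ℤ} {a : ℕ → Form n m q r} (ha : a ∈ Series n m q r k p) :
    s.total a ∈ Series n m q r (k + 1) p := by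
  intro j _
  change s.total a j ∈ _
  rw [total_apply]
  refine sum_mem fun x hx => ?_
  have h := s.degree x.1 _ _ _ _ (ha x.2 trivial)
  have hx' : ((x.1 : ℤ) + x.2) = j + 1 := by
    exact_mod_cast Finset.HasAntidiagonal.mem_antidiagonal.1 hx
  rwa [show (x.2 : ℤ) + x.1 - 1 = j by omega, show (x.2 : ℤ) + k + x.1 = j + (k + 1) by omega] at h

theorem extDSeries_mem {k p : ℤ} {a : ℕ → Form n m q r} (ha : a ∈ Series n m q r k (p - 1)) :
    extDSeries n m q r a ∈ Series n m q r k p :=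
  fun j _ => extD_mem (ha j trivial)

theorem comp_zero_apply_zero {k p : ℤ} {a : ℕ → Form n m q r} (ha : a ∈ Series n m q r k p) :
    s.comp 0 (a 0) = 0 :=
  eq_zero_of_mem_piece_neg (Or.inl (by norm_num)) (s.degree 0 _ _ _ _ (ha 0 trivial))

/-- The lowest component of `s` applied to a formal series that starts at antighost number `N`. -/
theorem total_apply_of_forall_lt {a : ℕ → Form n m q r} {N : ℕ} (h : ∀ j < N + 1, a j = 0) :
    s.total a N = T.delta (a (N + 1)) := by
  rw [total_apply, Finset.sum_eq_single (0, N + 1)]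
  · rw [s.comp_zero]; rfl
  · rintro ⟨i, l⟩ hx hne
    have := Finset.HasAntidiagonal.mem_antidiagonal.1 hx
    simp only at this
    by_cases hl : l = N + 1
    · exact absurd (Prod.ext (by simp only; omega) hl) hne
    · rw [h l (by omega), map_zero]
  · intro h
    simp at h

theorem total_apply_eq_zero {a : ℕ → Form n m q r} {N : ℕ} (h : ∀ j ≤ N + 1, a j = 0) :
    s.total a N = 0 := by
  rw [total_apply]
  refine Finset.sum_eq_zero fun x hx => ?_
  have := Finset.HasAntidiagonal.mem_antidiagonal.1 hx
  rw [h x.2 (by omega), map_zero]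

/-- One step of the recursive solution of `c + s u + d v = 0`: the component of lowest antighost number
of the left hand side is a cocycle of `δ` modulo `d` of positive pure ghost number. -/
theorem exists_step (hreg : T.Regular) {k p : ℤ} {N : ℕ} (hN : 1 ≤ N) (hk : 0 ≤ N + k)
    {c f : ℕ → Form n m q r} (hc : c ∈ Series n m q r (k + 1) p)
    (hcf : s.total c = extDSeries n m q r f) {u v : ℕ → Form n m q r}
    (hu : u ∈ Series n m q r k p) (hv : v ∈ Series n m q r (k + 1) (p - 1))
    (h : ∀ j < N, (c + s.total u + extDSeries n m q r v) j = 0) :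
    ∃ u' ∈ Series n m q r k p, ∃ v' ∈ Series n m q r (k + 1) (p - 1),
      (∀ j ≤ N, u' j = u j) ∧ (∀ j < N, v' j = v j) ∧
      ∀ j < N + 1, (c + s.total u' + extDSeries n m q r v') j = 0 := by
  obtain ⟨N, rfl⟩ : ∃ N', N = N' + 1 := ⟨N - 1, by omega⟩
  set e := c + s.total u + extDSeries n m q r v with he
  have hemem : e ∈ Series n m q r (k + 1) p :=
    add_mem (add_mem hc (s.total_mem hu)) (extDSeries_mem hv)
  have hse : s.total e = extDSeries n m q r (f - s.total v) := by
    rw [he, map_add, map_add, hcf, s.total_total (s.comp_zero_apply_zero hu), s.total_extD, map_sub]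
    abel
  have h1 : T.delta (e (N + 1)) + extD (-(f - s.total v) N) = 0 := by
    rw [← s.total_apply_of_forall_lt h, hse, map_neg]
    exact add_neg_cancel _
  obtain ⟨x, hx, y, hy, hxy⟩ := s.exists_relative_primitive hreg (by push_cast; omega)
    (by push_cast at hk ⊢; omega) (hemem (N + 1) trivial) h1
  refine ⟨u - Pi.single (N + 2) x, sub_mem hu (single_mem_Series ?_), v - Pi.single (N + 1) y,
    sub_mem hv (single_mem_Series hy), fun j hj => ?_, fun j hj => ?_, fun j hj => ?_⟩
  · have e1 : ((N + 2 : ℕ) : ℤ) = ((N + 1 : ℕ) : ℤ) + 1 := by push_cast; ring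
    rwa [e1, add_assoc, add_comm 1 k]
  · rw [Pi.sub_apply, Pi.single_eq_of_ne (by omega), sub_zero]
  · rw [Pi.sub_apply, Pi.single_eq_of_ne (by omega), sub_zero]
  · have e1 : c + s.total (u - Pi.single (N + 2) x) +
        extDSeries n m q r (v - Pi.single (N + 1) y) =
        e - (s.total (Pi.single (N + 2) x) + extDSeries n m q r (Pi.single (N + 1) y)) := by
      rw [he, map_sub, map_sub]
      abel
    rw [e1, Pi.sub_apply, Pi.add_apply]
    change e j - (s.total (Pi.single (N + 2) x) j + extD ((Pi.single (N + 1) y : ℕ → _) j)) = 0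
    by_cases hj' : j = N + 1
    · subst hj'
      rw [s.total_apply_of_forall_lt fun i hi =>
          Pi.single_eq_of_ne (M := fun _ => Form n m q r) (by omega) _,
        Pi.single_eq_same, Pi.single_eq_same, hxy, sub_self]
    · rw [s.total_apply_eq_zero fun i hi =>
          Pi.single_eq_of_ne (M := fun _ => Form n m q r) (by omega) _,
        Pi.single_eq_of_ne hj', map_zero, add_zero, sub_zero]
      exact h j (by omega)

/-- If the terms of `c + s u + d v` of low antighost number vanish, then the remaining ones can be
removed by adding terms of higher antighost number to `u` and `v`. -/
theorem exists_correction (hreg : T.Regular) {k p : ℤ} {N : ℕ} (hN : 1 ≤ N) (hk : 0 ≤ N + k)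
    {c f : ℕ → Form n m q r} (hc : c ∈ Series n m q r (k + 1) p)
    (hcf : s.total c = extDSeries n m q r f) {u v : ℕ → Form n m q r}
    (hu : u ∈ Series n m q r k p) (hv : v ∈ Series n m q r (k + 1) (p - 1))
    (h : ∀ j < N, (c + s.total u + extDSeries n m q r v) j = 0) :
    ∃ u' ∈ Series n m q r k p, ∃ v' ∈ Series n m q r (k + 1) (p - 1),
      (∀ j ≤ N, u' j = u j) ∧ c + s.total u' + extDSeries n m q r v' = 0 := by
  let A : ℕ → Type := fun t => {x : (ℕ → Form n m q r) × (ℕ → Form n m q r) //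
    x.1 ∈ Series n m q r k p ∧ x.2 ∈ Series n m q r (k + 1) (p - 1) ∧
    ∀ j < N + t, (c + s.total x.1 + extDSeries n m q r x.2) j = 0}
  have step : ∀ t (x : A t), ∃ y : A (t + 1), (∀ j ≤ N + t, y.1.1 j = x.1.1 j) ∧
      ∀ j < N + t, y.1.2 j = x.1.2 j := by
    rintro t ⟨⟨u, v⟩, hu, hv, h⟩
    obtain ⟨u', hu', v', hv', h1, h2, h3⟩ := s.exists_step hreg (N := N + t) (by omega)
      (by push_cast; omega) hc hcf hu hv h
    exact ⟨⟨⟨u', v'⟩, hu', hv', h3⟩, h1, h2⟩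
  choose F hF1 hF2 using step
  let x : ∀ t, A t := fun t => Nat.rec ⟨⟨u, v⟩, hu, hv, h⟩ F t
  have hx1 : ∀ t j i, j ≤ N + t → (x (t + i)).1.1 j = (x t).1.1 j := by
    intro t j i hj
    induction i with
    | zero => rfl
    | succ i ih => exact (hF1 (t + i) (x (t + i)) j (by omega)).trans ih
  have hx2 : ∀ t j i, j < N + t → (x (t + i)).1.2 j = (x t).1.2 j := by
    intro t j i hj
    induction i with
    | zero => rfl
    | succ i ih => exact (hF2 (t + i) (x (t + i)) j (by omega)).trans ih
  refine ⟨fun j => (x j).1.1 j, fun j hj => (x j).2.1 j hj, fun j => (x j).1.2 j,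
    fun j hj => (x j).2.2.1 j hj, fun j hj => ?_, ?_⟩
  · have := hx1 0 j j hj
    rwa [zero_add] at this
  · funext j
    refine Eq.trans ?_ ((x (j + 1)).2.2.2 j (by omega))
    simp only [Pi.add_apply]
    congr 1
    · congr 1
      rw [total_apply, total_apply]
      refine Finset.sum_congr rfl fun y hy => ?_
      have := Finset.HasAntidiagonal.mem_antidiagonal.1 hy
      obtain ⟨i, hi⟩ : ∃ i, j + 1 = y.2 + i := ⟨y.1, by omega⟩
      rw [hi, hx1 y.2 y.2 i (by omega)]
    · exact congrArg extD (hx2 j j 1 (by omega)).symm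

theorem proj_apply_of_mem {S : Set (Mono n m q r)} {M : Mono n m q r} (h : M ∈ S)
    (a : Form n m q r) : proj S a M = a M := by
  classical exact Finsupp.filter_apply_pos _ _ h

theorem proj_apply_of_notMem {S : Set (Mono n m q r)} {M : Mono n m q r} (h : M ∉ S)
    (a : Form n m q r) : proj S a M = 0 := by
  classical exact Finsupp.filter_apply_neg _ _ h

include s in
/-- The part of positive pure ghost number of a cocycle of `δ` modulo `d` is a coboundary. -/
theorem sub_proj_mem_deltaCoboundaries (hreg : T.Regular) {j p : ℤ} (hj : 1 ≤ j)
    {a b : Form n m q r} (ha : a ∈ antighPiece n m q r j p) (hab : T.deltaR a + extD b = 0) :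
    proj {M | M.puregh = 0} a - a ∈ T.deltaCoboundaries j p := by
  classical
  have hle : ∀ {j g p : ℤ}, piece n m q r j g p ≤ antighPiece n m q r j p := fun {j g p} =>
    Finsupp.supported_mono fun M hM => ⟨hM.1, hM.2.2⟩
  have hg : ∀ g ∈ (a.support.image Mono.puregh).erase 0,
      proj {M | M.puregh = g} a ∈ T.deltaCoboundaries j p := by
    intro g hg
    obtain ⟨hg0, hg⟩ := Finset.mem_erase.1 hg
    obtain ⟨M, -, rfl⟩ := Finset.mem_image.1 hg
    have h1 : 1 ≤ M.puregh := by
      have := M.puregh_nonneg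
      omega
    obtain ⟨u, hu, v, hv, h⟩ := s.exists_relative_primitive hreg hj h1
      (a := proj {N | N.puregh = M.puregh} a) (b := proj {N | N.puregh = M.puregh} b) (p := p)
      (fun N hN => by
        have h2 := proj_mem_of_mem (S := {N | N.puregh = M.puregh}) (a := a) ha hN
        exact ⟨h2.1, proj_mem _ a hN, h2.2⟩)
      (by
        have e1 := s.delta_proj (fun _ g _ => g = M.puregh) a
        have e2 := extD_proj (fun _ g => g = M.puregh) b
        rw [e1, e2, ← proj_add]
        exact (congrArg _ hab).trans (proj_zero _))
    rw [← h]
    exact add_mem (Submodule.mem_sup_left ⟨u, hle hu, rfl⟩)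
      (Submodule.mem_sup_right ⟨v, hle hv, rfl⟩)
  have h : proj {M | M.puregh = 0} a - a =
      -∑ g ∈ (a.support.image Mono.puregh).erase 0, proj {M | M.puregh = g} a := by
    refine Finsupp.ext fun M => ?_
    rw [Finsupp.sub_apply, Finsupp.neg_apply, Finsupp.finsetSum_apply]
    have e : ∀ g, proj {M | M.puregh = g} a M = if M.puregh = g then a M else 0 := fun g => by
      split_ifs with hg
      · exact proj_apply_of_mem hg a
      · exact proj_apply_of_notMem hg a
    simp only [e]
    rw [Finset.sum_ite_eq]
    by_cases h0 : M.puregh = 0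
    · simp [h0]
    · by_cases hM : a M = 0
      · simp [hM]
      · rw [if_neg h0, if_pos, zero_sub]
        exact Finset.mem_erase.2 ⟨h0, Finset.mem_image_of_mem _ (Finsupp.mem_support_iff.2 hM)⟩
  rw [h]
  exact neg_mem (sum_mem hg)

theorem apply_eq_zero_of_mem_Series {k p : ℤ} {a : ℕ → Form n m q r}
    (ha : a ∈ Series n m q r k p) {j : ℕ} (hj : j + k < 0) : a j = 0 :=
  eq_zero_of_mem_piece_neg (Or.inr (Or.inl hj)) (ha j trivial)

end GaugeTheory.BRSTDifferential

end Perturbation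

/-! ### The cohomology of `s` modulo `d` -/

section Isomorphisms

variable {n m q r : ℕ} {T : GaugeTheory n m q r}

namespace GaugeTheory.BRSTDifferential

variable (s : T.BRSTDifferential)

theorem piece_le_antighPiece (j g p : ℤ) : piece n m q r j g p ≤ antighPiece n m q r j p :=
  Finsupp.supported_mono fun _ hM => ⟨hM.1, hM.2.2⟩

theorem proj_mem_piece {j p : ℤ} {a : Form n m q r} (ha : a ∈ antighPiece n m q r j p) :
    proj {M | M.puregh = 0} a ∈ piece n m q r j 0 p := by
  intro M hM
  have h2 := proj_mem_of_mem (S := {N | N.puregh = 0}) (a := a) ha hM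
  exact ⟨h2.1, proj_mem _ a hM, h2.2⟩

include s in
theorem deltaR_proj (a : Form n m q r) :
    T.deltaR (proj {M | M.puregh = 0} a) = proj {M | M.puregh = 0} (T.deltaR a) :=
  s.delta_proj (fun _ g _ => g = 0) a

/-- The equation of cocycles of `s` modulo `d` in lowest antighost number. -/
theorem delta_add_extD_eq_zero {k : ℕ} {p : ℤ} {a b : ℕ → Form n m q r}
    (ha : a ∈ Series n m q r (-(k + 1 : ℕ)) p) (h : s.total a + extDSeries n m q r b = 0) :
    T.deltaR (a (k + 1)) + extD (b k) = 0 := by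
  have h1 := congrFun h k
  rw [Pi.add_apply, s.total_apply_of_forall_lt fun j hj =>
    apply_eq_zero_of_mem_Series ha (by push_cast; omega)] at h1
  exact h1

theorem total_apply_zero (a : ℕ → Form n m q r) :
    s.total a 0 = s.gamma (a 0) + T.deltaR (a 1) := by
  rw [total_apply, Finset.Nat.sum_antidiagonal_succ, Finset.Nat.antidiagonal_zero,
    Finset.sum_singleton, s.comp_zero, add_comm]
  rfl

theorem total_single_add_single_apply_zero (u w : Form n m q r) :
    s.total (Pi.single 0 u + Pi.single 1 w) 0 = s.gamma u + T.deltaR w := by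
  rw [total_apply_zero]
  simp

theorem gamma_add_extD_add_delta_eq_zero {a b : ℕ → Form n m q r}
    (h : s.total a + extDSeries n m q r b = 0) :
    s.gamma (a 0) + extD (b 0) + T.deltaR (a 1) = 0 := by
  have h1 := congrFun h 0
  rw [Pi.add_apply, total_apply_zero] at h1
  rw [add_right_comm]
  exact h1

/-- A cocycle of `s` modulo `d` is a coboundary if it is one up to terms of high antighost
number. -/
theorem mem_coboundaries_of_forall_lt (hreg : T.Regular) {k p : ℤ} {N : ℕ} (hN : 1 ≤ N)
    (hk : 1 ≤ N + k) {a : ℕ → Form n m q r} (ha : a ∈ s.cocycles k p) {u v : ℕ → Form n m q r}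
    (hu : u ∈ Series n m q r (k - 1) p) (hv : v ∈ Series n m q r k (p - 1))
    (h : ∀ j < N, (a - s.total u - extDSeries n m q r v) j = 0) : a ∈ s.coboundaries k p := by
  obtain ⟨ha, b, -, hb⟩ := ha
  have hk' : k - 1 + 1 = k := sub_add_cancel k 1
  obtain ⟨u', hu', v', hv', -, h'⟩ := s.exists_correction hreg (k := k - 1) (p := p) (N := N)
    (c := a) (f := -b) (u := -u) (v := -v) hN (by omega) (by rwa [hk'])
    (by rw [map_neg]; exact eq_neg_of_add_eq_zero_left hb) (neg_mem hu)
    (by rw [hk']; exact neg_mem hv)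
    (fun j hj => by
      rw [map_neg, map_neg, ← sub_eq_add_neg, ← sub_eq_add_neg]
      exact h j hj)
  rw [hk'] at hv'
  refine Submodule.mem_sup.2 ⟨s.total (-u'), ⟨-u', neg_mem hu', rfl⟩,
    extDSeries n m q r (-v'), ⟨-v', neg_mem hv', rfl⟩, ?_⟩
  rw [map_neg, map_neg, ← neg_add, neg_eq_iff_add_eq_zero, add_comm, ← add_assoc]
  exact h'

/-- A truncated cocycle of `s` modulo `d` extends to a cocycle. -/
theorem exists_cocycle (hreg : T.Regular) {k p : ℤ} {N : ℕ} (hN : 1 ≤ N)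
    (hk : 0 ≤ N + k) {u v : ℕ → Form n m q r}
    (hu : u ∈ Series n m q r k p) (hv : v ∈ Series n m q r (k + 1) (p - 1))
    (h : ∀ j < N, (s.total u + extDSeries n m q r v) j = 0) :
    ∃ a ∈ s.cocycles k p, ∀ j ≤ N, a j = u j := by
  obtain ⟨u', hu', v', hv', h1, h2⟩ := s.exists_correction hreg (c := 0) (f := 0) hN hk
    (zero_mem _) (by rw [map_zero, map_zero]) hu hv (by rwa [zero_add])
  rw [zero_add] at h2
  exact ⟨u', ⟨hu', v', hv', h2⟩, h1⟩

/-- In negative ghost number, only the part of pure ghost number zero of the classes of `δ` modulo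
`d` matters, and it extends to a formal series. -/
theorem exists_equiv_HDelta (hreg : T.Regular) (k : ℕ) (p : ℤ) :
    ∃ Φ : s.H (-(k + 1 : ℕ)) p ≃ₗ[ℝ] T.HDelta (k + 1 : ℕ) p,
      ∀ a : s.cocycles (-(k + 1 : ℕ)) p, ∃ h : a.1 (k + 1) ∈ T.deltaCocycles (k + 1 : ℕ) p,
        Φ (Submodule.Quotient.mk a) = Submodule.Quotient.mk ⟨a.1 (k + 1), h⟩ := by
  have hmem : ∀ {a : ℕ → Form n m q r} {l p : ℤ} {j : ℕ}, a ∈ Series n m q r l p →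
      (j : ℤ) + l = 0 → a j ∈ piece n m q r j 0 p := by
    intro a l p j ha hj
    have h : a j ∈ piece n m q r j (j + l) p := ha j trivial
    rwa [hj] at h
  refine exists_quotient_equiv
    (LinearMap.proj (R := ℝ) (φ := fun _ : ℕ => Form n m q r) (k + 1)) ?_ ?_ ?_ ?_
  · rintro a ⟨ha, b, hb, h⟩
    refine ⟨piece_le_antighPiece _ _ _ (hmem ha (by push_cast; ring)), b k, ?_,
      s.delta_add_extD_eq_zero ha h⟩
    have h1 := piece_le_antighPiece _ _ _ (hmem (j := k) hb (by push_cast; ring))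
    rwa [show ((k + 1 : ℕ) : ℤ) - 1 = k by push_cast; ring]
  · intro a ha
    obtain ⟨_, ⟨u, hu, rfl⟩, _, ⟨v, hv, rfl⟩, rfl⟩ := Submodule.mem_sup.1 ha
    refine Submodule.mem_sup.2 ⟨T.deltaR (u (k + 2)), ⟨u (k + 2), ?_, rfl⟩, extD (v (k + 1)),
      ⟨v (k + 1), ?_, rfl⟩, ?_⟩
    · have h1 := piece_le_antighPiece _ _ _ (hmem (j := k + 2) hu (by push_cast; ring))
      rwa [show ((k + 1 : ℕ) : ℤ) + 1 = (k + 2 : ℕ) by push_cast; ring]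
    · exact piece_le_antighPiece _ _ _ (hmem hv (by push_cast; ring))
    · rw [LinearMap.proj_apply, Pi.add_apply, s.total_apply_of_forall_lt fun j hj =>
        apply_eq_zero_of_mem_Series hu (by push_cast; omega)]
      rfl
  · rintro a ⟨ha, b, hb, h⟩ h'
    obtain ⟨_, ⟨u, hu, rfl⟩, _, ⟨v, hv, rfl⟩, huv⟩ := Submodule.mem_sup.1 h'
    have hu0 := proj_mem_piece hu
    have hv0 := proj_mem_piece hv
    have huv0 : T.deltaR (proj {M | M.puregh = 0} u) + extD (proj {M | M.puregh = 0} v) =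
        a (k + 1) := by
      rw [s.deltaR_proj, extD_proj (fun _ g => g = 0), ← proj_add, huv]
      exact proj_eq_self (formsOn_mono (fun M hM => hM.2.1)
        (mem_piece.1 (hmem ha (by push_cast; ring))))
    set u₀ := proj {M | M.puregh = 0} u
    set v₀ := proj {M | M.puregh = 0} v
    -- `u₀` and `v₀` trivialize the lowest component of `a`
    refine s.mem_coboundaries_of_forall_lt hreg (N := k + 2) (by omega) (by push_cast; omega)
      ⟨ha, b, hb, h⟩ (u := Pi.single (k + 2) u₀) (v := Pi.single (k + 1) v₀) ?_ ?_ fun j hj => ?_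
    · refine single_mem_Series ?_
      convert hu0 using 2 <;> push_cast <;> ring
    · refine single_mem_Series ?_
      convert hv0 using 2
      push_cast
      ring
    · rw [Pi.sub_apply, Pi.sub_apply]
      change _ - _ - extD ((Pi.single (k + 1) v₀ : ℕ → Form n m q r) j) = 0
      by_cases hj' : j = k + 1
      · subst hj'
        rw [s.total_apply_of_forall_lt fun i hi =>
            Pi.single_eq_of_ne (M := fun _ => Form n m q r) (by omega) _,
          Pi.single_eq_same, Pi.single_eq_same, sub_sub, sub_eq_zero]
        exact huv0.symm
      · rw [s.total_apply_eq_zero fun i hi =>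
            Pi.single_eq_of_ne (M := fun _ => Form n m q r) (by omega) _,
          Pi.single_eq_of_ne hj', apply_eq_zero_of_mem_Series ha (by push_cast; omega), map_zero,
          sub_zero, sub_zero]
  · rintro c ⟨hc, b, hb, h⟩
    have hc0 := proj_mem_piece hc
    have hb0 := proj_mem_piece hb
    have hcb : T.deltaR (proj {M | M.puregh = 0} c) + extD (proj {M | M.puregh = 0} b) = 0 := by
      rw [s.deltaR_proj, extD_proj (fun _ g => g = 0), ← proj_add, h, proj_zero]
    obtain ⟨a, ha, hac⟩ := s.exists_cocycle hreg (k := -(k + 1 : ℕ)) (p := p) (N := k + 1)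
      (u := Pi.single (k + 1) (proj {M | M.puregh = 0} c))
      (v := Pi.single k (proj {M | M.puregh = 0} b)) (by omega) (by omega)
      (single_mem_Series (by rwa [add_neg_cancel]))
      (single_mem_Series (by
        convert hb0 using 2 <;> push_cast <;> ring))
      (fun j hj => by
        rw [Pi.add_apply]
        change _ + extD ((Pi.single k _ : ℕ → Form n m q r) j) = 0
        by_cases hj' : j = k
        · subst hj'
          rw [s.total_apply_of_forall_lt fun i hi =>
              Pi.single_eq_of_ne (M := fun _ => Form n m q r) (by omega) _,
            Pi.single_eq_same, Pi.single_eq_same]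
          exact hcb
        · rw [s.total_apply_eq_zero fun i hi =>
              Pi.single_eq_of_ne (M := fun _ => Form n m q r) (by omega) _,
            Pi.single_eq_of_ne hj', map_zero, add_zero])
    refine ⟨a, ha, ?_⟩
    rw [LinearMap.proj_apply, hac _ le_rfl, Pi.single_eq_same]
    exact s.sub_proj_mem_deltaCoboundaries hreg (by push_cast; omega) hc h

/-- In ghost number at least zero, the equations of a cocycle, or coboundary, in antighost number
zero involve `γ` and `δ`; the remaining ones can always be solved. -/
theorem exists_equiv_HGamma (hreg : T.Regular) (k : ℕ) (p : ℤ) :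
    ∃ Φ : s.H k p ≃ₗ[ℝ] s.HGamma k p,
      ∀ a : s.cocycles k p, ∃ h : a.1 0 ∈ s.gammaCocycles k p,
        Φ (Submodule.Quotient.mk a) = Submodule.Quotient.mk ⟨a.1 0, h⟩ := by
  refine exists_quotient_equiv
    (LinearMap.proj (R := ℝ) (φ := fun _ : ℕ => Form n m q r) 0) ?_ ?_ ?_ ?_
  · rintro a ⟨ha, b, hb, h⟩
    have h0 := ha 0 trivial
    have h1 := ha 1 trivial
    have h2 := hb 0 trivial
    simp only [Nat.cast_zero, zero_add, Nat.cast_one] at h0 h1 h2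
    rw [add_comm 1 (k : ℤ)] at h1
    exact ⟨h0, b 0, h2, a 1, h1, s.gamma_add_extD_add_delta_eq_zero h⟩
  · intro a ha
    obtain ⟨_, ⟨u, hu, rfl⟩, _, ⟨v, hv, rfl⟩, rfl⟩ := Submodule.mem_sup.1 ha
    have h0 := hu 0 trivial
    have h1 := hu 1 trivial
    have h2 := hv 0 trivial
    simp only [Nat.cast_zero, zero_add, Nat.cast_one, add_sub_cancel] at h0 h1 h2
    rw [LinearMap.proj_apply, Pi.add_apply, s.total_apply_zero]
    change s.gamma (u 0) + T.deltaR (u 1) + extD (v 0) ∈ _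
    rw [add_right_comm]
    exact add_mem (Submodule.mem_sup_left (add_mem (Submodule.mem_sup_left ⟨_, h0, rfl⟩)
      (Submodule.mem_sup_right ⟨_, h2, rfl⟩))) (Submodule.mem_sup_right ⟨_, h1, rfl⟩)
  · intro a ha h'
    obtain ⟨_, h', _, ⟨w, hw, rfl⟩, huvw⟩ := Submodule.mem_sup.1 h'
    obtain ⟨_, ⟨u, hu, rfl⟩, _, ⟨v, hv, rfl⟩, rfl⟩ := Submodule.mem_sup.1 h'
    refine s.mem_coboundaries_of_forall_lt hreg (N := 1) le_rfl (by omega) ha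
      (u := Pi.single 0 u + Pi.single 1 w) (v := Pi.single 0 v)
      (add_mem (single_mem_Series ?_) (single_mem_Series ?_)) (single_mem_Series ?_) fun j hj => ?_
    · rwa [Nat.cast_zero, zero_add]
    · rwa [Nat.cast_one, add_sub_cancel]
    · rwa [Nat.cast_zero, zero_add]
    · obtain rfl : j = 0 := by omega
      rw [Pi.sub_apply, Pi.sub_apply, s.total_single_add_single_apply_zero, sub_sub, sub_eq_zero]
      refine huvw.symm.trans ?_
      rw [add_right_comm]
      rfl
  · rintro c ⟨hc, b, hb, w, hw, h⟩
    obtain ⟨a, ha, hac⟩ := s.exists_cocycle hreg (k := k) (p := p) (N := 1)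
      (u := Pi.single 0 c + Pi.single 1 w) (v := Pi.single 0 b) le_rfl (by omega)
      (add_mem (single_mem_Series (by rwa [Nat.cast_zero, zero_add]))
        (single_mem_Series (by rwa [Nat.cast_one, add_comm])))
      (single_mem_Series (by rwa [Nat.cast_zero, zero_add]))
      (fun j hj => by
        obtain rfl : j = 0 := by omega
        rw [Pi.add_apply, s.total_single_add_single_apply_zero, ← h, add_right_comm]
        rfl)
    refine ⟨a, ha, ?_⟩
    rw [LinearMap.proj_apply, hac 0 (by omega), Pi.add_apply, Pi.single_eq_same,
      Pi.single_eq_of_ne (M := fun _ => Form n m q r) (by omega) _, add_zero, sub_self]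
    exact zero_mem _

end GaugeTheory.BRSTDifferential

end Isomorphisms

end LocalBRST

end

theorem theorem6p1 {n m q r : ℕ} (T : LocalBRST.GaugeTheory n m q r) (hT : T.Identities)
    (hreg : T.Regular) (s : T.BRSTDifferential) (p : ℕ) :
    (∀ k : ℕ, 0 < k → ∃ Φ : s.H (-k) p ≃ₗ[ℝ] T.HDelta k p,
      ∀ a : s.cocycles (-k) p, ∃ h : a.1 k ∈ T.deltaCocycles k p,
        Φ (Submodule.Quotient.mk a) = Submodule.Quotient.mk ⟨a.1 k, h⟩) ∧
    (∀ k : ℕ, ∃ Φ : s.H k p ≃ₗ[ℝ] s.HGamma k p,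
      ∀ a : s.cocycles k p, ∃ h : a.1 0 ∈ s.gammaCocycles k p,
        Φ (Submodule.Quotient.mk a) = Submodule.Quotient.mk ⟨a.1 0, h⟩) := by
  refine ⟨fun k hk => ?_, fun k => s.exists_equiv_HGamma hreg k p⟩
  obtain ⟨k, rfl⟩ : ∃ k', k = k' + 1 := ⟨k - 1, by omega⟩
  exact s.exists_equiv_HDelta hreg k p
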